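/- **Setting.** Fix $d\ge 3$. The comb graph $G^d=\mathbb Z^d\dashv\mathbb Z$ has vertex set $\mathbb Z^d\times\mathbb Z$; $(j,i)$ and $(j',i')$ are adjacent iff either $j=j'$ and $|i-i'|=1$, or $i=i'=0$ and $j,j'$ are nearest neighbours in $\mathbb Z^d$. Let $A$ be its adjacency operator on $\ell^2(G^d)$, $R_{G^d}(\lambda)=(\lambda-A)^{-1}$, and $H=\|A\|I-A\ge 0$, so that $R_{G^d}(\|A\|)=H^{-1}$. Let $\Lambda_n=X_n\dashv Y_n$, where $X_n=(\mathbb Z/(2n+1))^d$ (periodic boundary condition) and $Y_n$ is the chain $\{-n,\dots,n\}$ with distinguished vertex $0$; its vertices are identified with $[-n,n]^d\times[-n,n]\subset\mathbb Z^d\times\mathbb Z$, and its adjacency operator $A_{\Lambda_n}$ acts on $\ell^2(G^d)$, being zero on the vectors supported outside $\Lambda_n$. For a chemical potential $\mu_n$ put $H_n=(\|A\|-\mu_n)I-A_{\Lambda_n}$. Let $\tau_{\Lambda_n}(T)=|\Lambda_n|^{-1}\sum_{x\in\Lambda_n}\langle\delta_x,T\delta_x\rangle$. Let $\mathcal S_0$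 be the set of $\xi\in\ell^2(G^d)$ such that $j\mapsto\|\xi(j,\cdot)\|_{\ell^2(\mathbb Z)}$ is rapidly decreasing on $\mathbb Z^d$. Let $v(j,i)=w(i)$, where $w=\|R_{\mathbb Z}(\|A\|)\delta_0\|^{-1}R_{\mathbb Z}(\|A\|)\delta_0\in\ell^2(\mathbb Z)$ and $R_{\mathbb Z}(\lambda)=(\lambda-A_{\mathbb Z})^{-1}$ with $A_{\mathbb Z}$ the adjacency operator of the chain $\mathbb Z$. Put $\langle\eta,v\rangle=\sum_x\overline{\eta(x)}v(x)$ and $\langle v,\xi\rangle=\sum_x\overline{v(x)}\xi(x)$. For an injective bounded positive operator $T$, $T^{-1/2}$ denotes the inverse of $T^{1/2}$, with domain $\mathrm{Ran}(T^{1/2})$, and $\langle\eta,T^{-1}\xi\rangle:=\langle T^{-1/2}\eta,T^{-1/2}\xi\rangle$ for $\eta,\xi$ in this domain. **Theorem.** (i) $A$ is transient: for every vertex $x$, $\langle\delta_x,R_{G^d}(\|A\|)\delta_x\rangle:=\lim_{\lambda\downarrow\|A\|}\langle\delta_x,R_{G^d}(\lambda)\delta_x\rangle<\infty$. (ii) $H$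 is injective and $\mathcal S_0\subset\mathcal D\big(R_{G^d}(\|A\|)^{1/2}\big)=\mathcal D(H^{-1/2})$. (iii) $v$ is a generalized Perron–Frobenius vector: $v>0$ and $\sum_{y\sim x}v(y)=\|A\|\,v(x)$ for every $x$; and the series $\langle v,\xi\rangle$ converges absolutely for $\xi\in\mathcal S_0$. (iv) $H$ has a density of states: there is a unique Borel measure $N_H$ on $\mathbb R$ such that every continuous $\varphi:\mathbb R\to\mathbb R$ is $N_H$-integrable and $\int\varphi\,dN_H=\tau(\varphi(H)):=\lim_n\tau_{\Lambda_n}(\varphi(H))$. Let moreover $\beta>0$, $\mu_n<0$, $\mu_n\to0$ and $$\lim_n\frac1{-\mu_n(2n+1)^d}=c<\infty .$$ Then $e^{\beta H_n}-I$ is invertible for every $n$, $e^{\beta H}-I$ is injective, $\mathcal S_0\subset\mathcal D\big((e^{\beta H}-I)^{-1/2}\big)$, and $$\lim_n\langle\eta,(e^{\beta H_n}-I)^{-1}\xi\rangle=\langle\eta,(e^{\beta H}-I)^{-1}\xi\rangle+\frac c\beta\,\langle\eta,v\rangle\langle v,\xi\rangle\qquad\text{for all }\xi,\eta\in\mathcal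 S_0,$$ $$\lim_n\tau_{\Lambda_n}\big((e^{\beta H_n}-I)^{-1}\big)=\tau\big((e^{\beta H}-I)^{-1}\big):=\int\frac{dN_H(h)}{e^{\beta h}-1}<\infty .$$ In particular the limit of the densities does not depend on $c$: the condensate does not contribute to the density. -/

import Mathlib

open Filter Topology MeasureTheory
open scoped ENNReal ComplexConjugate

noncomputable section

/-! ### Functions of operators on a Hilbert space -/

section Operators

variable {E : Type*} [NormedAddCommGroup E] [InnerProductSpace ℂ E] [CompleteSpace E]

/-- `φ(T)` for a bounded self-adjoint operator `T` and a continuous function `φ`. -/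
def opFun (φ : ℝ → ℝ) (T : E →L[ℂ] E) : E →L[ℂ] E := cfc φ T

/-- The operator `T^{-1/2}` of an injective bounded positive operator `T`: the (in general
unbounded) inverse of the positive square root `T^{1/2}`, with domain the range of `T^{1/2}`. -/
def invSqrt (T : E →L[ℂ] E) : E →ₗ.[ℂ] E :=
  ((opFun Real.sqrt T).toLinearMap.toPMap ⊤).inverse

/-- The operator `e^{βT} - I`. -/
def expSubOne (β : ℝ) (T : E →L[ℂ] E) : E →L[ℂ] E :=
  NormedSpace.exp ((β : ℂ) • T) - 1

end Operators

/-! ### Graphs and their adjacency operators -/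

/-- The Hilbert space `ℓ²(V)`. -/
abbrev Ell2 (V : Type*) : Type _ := lp (fun _ : V => ℂ) 2

/-- The basis vector `δ_x` of `ℓ²(V)`. -/
def delta {V : Type*} (x : V) : Ell2 V :=
  haveI := Classical.decEq V
  lp.single 2 x 1

/-- Vertex degrees are uniformly bounded. -/
def BoundedDegree {V : Type*} (G : SimpleGraph V) : Prop :=
  ∃ D : ℕ, ∀ x, (G.neighborSet x).encard ≤ D

theorem BoundedDegree.finite {V : Type*} {G : SimpleGraph V} (h : BoundedDegree G) (x : V) :
    (G.neighborSet x).Finite := by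
  obtain ⟨D, hD⟩ := h
  exact Set.finite_of_encard_le_coe (hD x)

theorem adj_bound {V : Type*} (G : SimpleGraph V) (D : ℕ)
    (hD : ∀ x, (G.neighborSet x).encard ≤ D) (hfin : ∀ x, (G.neighborSet x).Finite) (f : V → ℂ) :
    ∑' x, ‖∑ y ∈ (hfin x).toFinset, f y‖ₑ ^ 2 ≤ (D : ℝ≥0∞) ^ 2 * ∑' y, ‖f y‖ₑ ^ 2 := by
  classical
  have hcard : ∀ x, ((hfin x).toFinset.card : ℝ≥0∞) ≤ D := by
    intro x
    have h := hD x
    rw [(hfin x).encard_eq_coe_toFinset_card] at h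
    exact_mod_cast h
  have h1 : ∀ x, ‖∑ y ∈ (hfin x).toFinset, f y‖ₑ ^ 2
      ≤ D * ∑ y ∈ (hfin x).toFinset, ‖f y‖ₑ ^ 2 := by
    intro x
    have h2 : (‖∑ y ∈ (hfin x).toFinset, f y‖₊) ^ 2
        ≤ (hfin x).toFinset.card * ∑ y ∈ (hfin x).toFinset, ‖f y‖₊ ^ 2 :=
      (pow_le_pow_left₀ (by positivity) (nnnorm_sum_le _ _) 2).trans sq_sum_le_card_mul_sum_sq
    have h3 : ‖∑ y ∈ (hfin x).toFinset, f y‖ₑ ^ 2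
        ≤ (hfin x).toFinset.card * ∑ y ∈ (hfin x).toFinset, ‖f y‖ₑ ^ 2 := by
      simp only [enorm_eq_nnnorm]
      exact_mod_cast h2
    exact h3.trans (mul_le_mul_left (hcard x) _)
  have h4 : ∀ x, ∑ y ∈ (hfin x).toFinset, ‖f y‖ₑ ^ 2
      = ∑' y, if G.Adj x y then ‖f y‖ₑ ^ 2 else 0 := by
    intro x
    rw [tsum_eq_sum (s := (hfin x).toFinset)]
    · refine Finset.sum_congr rfl fun y hy => ?_
      simp only [Set.Finite.mem_toFinset, SimpleGraph.mem_neighborSet] at hy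
      simp [hy]
    · intro y hy
      simp only [Set.Finite.mem_toFinset, SimpleGraph.mem_neighborSet] at hy
      simp [hy]
  have h5 : ∀ y, (∑' x, if G.Adj x y then ‖f y‖ₑ ^ 2 else 0) ≤ D * ‖f y‖ₑ ^ 2 := by
    intro y
    rw [tsum_eq_sum (s := (hfin y).toFinset)]
    · refine (Finset.sum_le_card_nsmul _ _ (‖f y‖ₑ ^ 2) ?_).trans ?_
      · intro x _
        split_ifs <;> simp
      · rw [nsmul_eq_mul]
        exact mul_le_mul_left (hcard y) _
    · intro x hx
      simp only [Set.Finite.mem_toFinset, SimpleGraph.mem_neighborSet] at hx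
      simp [G.adj_comm x y, hx]
  calc ∑' x, ‖∑ y ∈ (hfin x).toFinset, f y‖ₑ ^ 2
      ≤ ∑' x, (D : ℝ≥0∞) * ∑' y, (if G.Adj x y then ‖f y‖ₑ ^ 2 else 0) :=
        ENNReal.tsum_le_tsum fun x => by rw [← h4]; exact h1 x
    _ = D * ∑' y, ∑' x, (if G.Adj x y then ‖f y‖ₑ ^ 2 else 0) := by
        rw [ENNReal.tsum_mul_left, ENNReal.tsum_comm]
    _ ≤ D * ∑' y, D * ‖f y‖ₑ ^ 2 :=
        mul_le_mul_right (ENNReal.tsum_le_tsum h5) _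
    _ = (D : ℝ≥0∞) ^ 2 * ∑' y, ‖f y‖ₑ ^ 2 := by
        rw [ENNReal.tsum_mul_left, ← mul_assoc, sq]

theorem tsum_enorm_sq {V : Type*} (f : Ell2 V) : ∑' y, ‖f y‖ₑ ^ 2 = ‖f‖ₑ ^ 2 := by
  have hs : Summable fun y => ‖f y‖ ^ 2 := by
    simpa using (lp.memℓp f).summable (by simp)
  have h := lp.norm_rpow_eq_tsum (p := 2) (by simp) f
  simp only [ENNReal.toReal_ofNat, Real.rpow_ofNat] at h
  rw [← ofReal_norm, ← ENNReal.ofReal_pow (norm_nonneg _), h,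
    ENNReal.ofReal_tsum_of_nonneg (fun _ => by positivity) hs]
  simp only [← ofReal_norm, ENNReal.ofReal_pow (norm_nonneg _)]

theorem summable_of_tsum_enorm_sq {V : Type*} (g : V → ℂ) (h : ∑' y, ‖g y‖ₑ ^ 2 ≠ ⊤) :
    Summable fun y => ‖g y‖ ^ 2 := by
  have := ENNReal.summable_toReal h
  simpa using this

/-- The adjacency operator of a graph of bounded degree: `(A f)(x) = ∑_{y ∼ x} f(y)`. -/
def adjOp {V : Type*} (G : SimpleGraph V) (hG : BoundedDegree G) : Ell2 V →L[ℂ] Ell2 V :=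
  LinearMap.mkContinuousOfExistsBound
    { toFun := fun f => ⟨fun x => ∑ y ∈ (hG.finite x).toFinset, f y, by
        obtain ⟨D, hD⟩ := id hG
        apply memℓp_gen
        have h := adj_bound G D hD hG.finite f
        rw [tsum_enorm_sq] at h
        simpa using summable_of_tsum_enorm_sq (fun x => ∑ y ∈ (hG.finite x).toFinset, f y)
          (ne_top_of_le_ne_top (by finiteness) h)⟩
      map_add' := fun f g => by
        ext x
        exact Finset.sum_add_distrib
      map_smul' := fun a f => by
        ext x
        simp [Finset.mul_sum] }
    (by
      obtain ⟨D, hD⟩ := id hG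
      refine ⟨D, fun f => ?_⟩
      have h := adj_bound G D hD hG.finite f
      rw [tsum_enorm_sq, ← mul_pow] at h
      have h' : ∀ g : Ell2 V, (∀ x, g x = ∑ y ∈ (hG.finite x).toFinset, f y) →
          ‖g‖ ≤ D * ‖f‖ := by
        intro g hg
        simp only [← hg] at h
        rw [tsum_enorm_sq] at h
        have h2 := (ENNReal.pow_le_pow_left_iff two_ne_zero).1 h
        simp only [enorm_eq_nnnorm] at h2
        exact_mod_cast h2
      exact h' _ fun x => rfl)

@[simp]
theorem adjOp_apply {V : Type*} (G : SimpleGraph V) (hG : BoundedDegree G) (f : Ell2 V) (x : V) :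
    adjOp G hG f x = ∑ y ∈ (hG.finite x).toFinset, f y := rfl

/-- The bounded operator `A` is transient: all diagonal matrix elements
`⟨δ_x, R_A(‖A‖) δ_x⟩`, that is, the monotone limits of `⟨δ_x, (t - A)⁻¹ δ_x⟩` as `t ↓ ‖A‖`
with values in `[0, ∞]`, are finite. -/
def Transient {V : Type*} (A : Ell2 V →L[ℂ] Ell2 V) : Prop :=
  ∀ x, (⨆ (t : ℝ) (_ : ‖A‖ < t),
    ENNReal.ofReal (inner ℂ (delta x) (resolvent A (t : ℂ) (delta x))).re) < ⊤

/-- A generalized Perron-Frobenius vector: a strictly positive, not necessarily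
square summable, function `v` with `∑_{y ∼ x} v(y) = ‖A‖ v(x)` at every vertex `x`. -/
def IsGeneralizedPF {V : Type*} (G : SimpleGraph V) (hG : BoundedDegree G) (v : V → ℂ) : Prop :=
  (∀ x, ∃ r : ℝ, 0 < r ∧ v x = r) ∧
    ∀ x, ∑ y ∈ (hG.finite x).toFinset, v y = (‖adjOp G hG‖ : ℂ) * v x

/-- The pairing `⟨f, g⟩ = ∑_x conj (f x) g x` of functions on the vertices. -/
def pairing {V : Type*} (f g : V → ℂ) : ℂ := ∑' x, conj (f x) * g x

/-! ### Comb graphs -/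

/-- The comb product `G ⊣ (H, o)` with base graph `G` and fibre graph `H`. -/
def combProduct {V W : Type*} (G : SimpleGraph V) (H : SimpleGraph W) (o : W) :
    SimpleGraph (V × W) where
  Adj p q := (p.1 = q.1 ∧ H.Adj p.2 q.2) ∨ (p.2 = o ∧ q.2 = o ∧ G.Adj p.1 q.1)
  symm := ⟨by
    rintro p q (⟨h1, h2⟩ | ⟨h1, h2, h3⟩)
    · exact Or.inl ⟨h1.symm, h2.symm⟩
    · exact Or.inr ⟨h2, h1, h3.symm⟩⟩
  loopless := ⟨by
    rintro p (⟨-, h⟩ | ⟨-, -, h⟩)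
    · exact H.loopless.irrefl _ h
    · exact G.loopless.irrefl _ h⟩

/-- Nearest neighbours in `R^d`, for `R = ℤ` (the lattice) or `R = ℤ/N` (the torus): the two
points are distinct and differ by `1` in exactly one coordinate. -/
def gridGraph (R : Type*) [AddGroupWithOne R] (d : ℕ) : SimpleGraph (Fin d → R) where
  Adj x y := x ≠ y ∧ ∃ i, (x i - y i = 1 ∨ y i - x i = 1) ∧ ∀ k, k ≠ i → x k = y k
  symm := ⟨by
    rintro x y ⟨h, i, h1, h2⟩
    exact ⟨h.symm, i, h1.symm, fun k hk => (h2 k hk).symm⟩⟩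
  loopless := ⟨fun x h => h.1 rfl⟩

/-- The infinite chain `ℤ`. -/
def chainGraph : SimpleGraph ℤ where
  Adj x y := x - y = 1 ∨ y - x = 1
  symm := ⟨fun _ _ h => h.symm⟩
  loopless := ⟨fun x h => by simp at h⟩

/-- The vertex set `ℤ^d × ℤ` of the comb `ℤ^d ⊣ ℤ`. -/
abbrev CombVertex (d : ℕ) : Type := (Fin d → ℤ) × ℤ

/-- The comb graph `G^d = ℤ^d ⊣ ℤ`. -/
def combGraph (d : ℕ) : SimpleGraph (CombVertex d) :=
  combProduct (gridGraph ℤ d) chainGraph 0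

/-- The vertices of the finite chain `Y_n = [-n, n]`. -/
abbrev FiniteChain (n : ℕ) : Type := Set.Icc (-(n : ℤ)) (n : ℤ)

/-- The origin of the finite chain. -/
def chainOrigin (n : ℕ) : FiniteChain n := ⟨0, by simp⟩

/-- The vertices of `Λ_n = X_n ⊣ Y_n`, where `X_n = (ℤ/(2n+1))^d`. -/
abbrev FiniteCombVertex (d n : ℕ) : Type := (Fin d → ZMod (2 * n + 1)) × FiniteChain n

/-- The finite comb `Λ_n = X_n ⊣ Y_n`: the base is the torus `(ℤ/(2n+1))^d` (periodic boundary
condition), the fibre is the finite chain `[-n, n]`. -/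
def finiteComb (d n : ℕ) : SimpleGraph (FiniteCombVertex d n) :=
  combProduct (gridGraph (ZMod (2 * n + 1)) d) (chainGraph.induce (Set.Icc (-(n : ℤ)) (n : ℤ)))
    (chainOrigin n)

/-- The identification of the vertices of `Λ_n` with `[-n, n]^d × [-n, n] ⊆ ℤ^d × ℤ`: each
residue modulo `2n+1` is replaced by its representative in `[-n, n]`. -/
def finiteEmb (d n : ℕ) : FiniteCombVertex d n ↪ CombVertex d where
  toFun p := (fun i => (p.1 i).valMinAbs, p.2)
  inj' := by
    rintro ⟨a, b⟩ ⟨a', b'⟩ h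
    simp only [Prod.mk.injEq, funext_iff, ZMod.valMinAbs_inj, SetCoe.ext_iff] at h
    exact Prod.ext (funext h.1) h.2

/-- `Λ_n` as a graph on the vertices of `G^d`; the vertices outside `Λ_n` are isolated. -/
def finiteCombGraph (d n : ℕ) : SimpleGraph (CombVertex d) :=
  (finiteComb d n).map (finiteEmb d n)

theorem chainGraph_bounded : BoundedDegree chainGraph := by
  refine ⟨2, fun x => ?_⟩
  have h : chainGraph.neighborSet x ⊆ {x - 1, x + 1} := by
    rintro y (h | h)
    · left; omega
    · right; show y = x + 1; omega
  refine (Set.encard_le_encard h).trans ?_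
  refine (Set.encard_insert_le _ _).trans ?_
  rw [Set.encard_singleton]
  norm_num

theorem gridGraph_bounded (d : ℕ) : BoundedDegree (gridGraph ℤ d) := by
  refine ⟨3 ^ d, fun x => ?_⟩
  have h : (gridGraph ℤ d).neighborSet x ⊆
      (Finset.Icc (fun i => x i - 1) (fun i => x i + 1) : Finset (Fin d → ℤ)) := by
    rintro y ⟨-, i, h1, h2⟩
    rw [Finset.coe_Icc, Set.mem_Icc, Pi.le_def, Pi.le_def, ← forall_and]
    intro k
    by_cases hk : k = i
    · subst hk; omega
    · have := h2 k hk; omega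
  refine (Set.encard_le_encard h).trans ?_
  rw [Set.encard_coe_eq_coe_finsetCard, Pi.card_Icc]
  have : ∀ i, (Finset.Icc (x i - 1) (x i + 1)).card = 3 := by
    intro i
    rw [Int.card_Icc]
    omega
  simp [this]

theorem combProduct_bounded {V W : Type*} {G : SimpleGraph V} {H : SimpleGraph W} {o : W}
    (hG : BoundedDegree G) (hH : BoundedDegree H) : BoundedDegree (combProduct G H o) := by
  obtain ⟨D, hD⟩ := hG
  obtain ⟨D', hD'⟩ := hH
  refine ⟨D' + D, fun p => ?_⟩
  have h : (combProduct G H o).neighborSet p ⊆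
      (Prod.mk p.1 '' H.neighborSet p.2) ∪ ((fun g => (g, o)) '' G.neighborSet p.1) := by
    rintro ⟨a, b⟩ (⟨h1, h2⟩ | ⟨-, h2, h3⟩)
    · left
      exact ⟨b, h2, by simp only at h1; rw [h1]⟩
    · right
      exact ⟨a, h3, by simp only at h2; rw [h2]⟩
  refine (Set.encard_le_encard h).trans ((Set.encard_union_le _ _).trans ?_)
  push_cast
  exact add_le_add ((Set.encard_image_le _ _).trans (hD' _))
    ((Set.encard_image_le _ _).trans (hD _))

theorem combGraph_bounded (d : ℕ) : BoundedDegree (combGraph d) :=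
  combProduct_bounded (gridGraph_bounded d) chainGraph_bounded

theorem finiteCombGraph_bounded (d n : ℕ) : BoundedDegree (finiteCombGraph d n) := by
  refine ⟨(Set.range (finiteEmb d n)).ncard, fun x => ?_⟩
  have h : (finiteCombGraph d n).neighborSet x ⊆ Set.range (finiteEmb d n) := by
    intro y hy
    obtain ⟨a, b, -, -, rfl⟩ := (SimpleGraph.map_adj _ _ _ _).1 hy
    exact ⟨b, rfl⟩
  rw [(Set.finite_range (finiteEmb d n)).cast_ncard_eq]
  exact Set.encard_le_encard h

/-- The adjacency operator of `G^d`. -/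
def combAdj (d : ℕ) : Ell2 (CombVertex d) →L[ℂ] Ell2 (CombVertex d) :=
  adjOp (combGraph d) (combGraph_bounded d)

/-- The adjacency operator of `Λ_n`, acting on `ℓ²(G^d)`. -/
def finiteCombAdj (d n : ℕ) : Ell2 (CombVertex d) →L[ℂ] Ell2 (CombVertex d) :=
  adjOp (finiteCombGraph d n) (finiteCombGraph_bounded d n)

/-- The adjacency operator of the chain `ℤ`. -/
def chainAdj : Ell2 ℤ →L[ℂ] Ell2 ℤ := adjOp chainGraph chainGraph_bounded

/-! ### Hamiltonians, the space `S₀`, the ground state, and the density -/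

/-- The pure hopping Hamiltonian `H = ‖A‖ I - A` on `G^d`. -/
def combHam (d : ℕ) : Ell2 (CombVertex d) →L[ℂ] Ell2 (CombVertex d) :=
  (‖combAdj d‖ : ℂ) • 1 - combAdj d

/-- The finite volume Hamiltonian `(‖A‖ - μ) I - A_{Λ_n}` with chemical potential `μ`. -/
def finiteHam (d n : ℕ) (μ : ℝ) : Ell2 (CombVertex d) →L[ℂ] Ell2 (CombVertex d) :=
  ((‖combAdj d‖ - μ : ℝ) : ℂ) • 1 - finiteCombAdj d n

/-- The restriction of `ξ ∈ ℓ²(G^d)` to the fibre over `j ∈ ℤ^d`. -/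
def fibre {d : ℕ} (ξ : Ell2 (CombVertex d)) (j : Fin d → ℤ) : Ell2 ℤ :=
  ⟨fun i => ξ (j, i), by
    apply memℓp_gen
    exact ((lp.memℓp ξ).summable (by simp)).comp_injective (Prod.mk_right_injective j)⟩

/-- The vectors `ξ ∈ ℓ²(G^d)` whose fibre norms `‖ξ_j‖` are rapidly decreasing in `j ∈ ℤ^d`. -/
def rapidSpace (d : ℕ) : Set (Ell2 (CombVertex d)) :=
  {ξ | ∀ k : ℕ, ∃ C : ℝ, ∀ j : Fin d → ℤ, (1 + ‖j‖) ^ k * ‖fibre ξ j‖ ≤ C}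

/-- The vector `R_ℤ(‖A‖) δ_0 ∈ ℓ²(ℤ)`, where `A` is the adjacency operator of `G^d`. -/
def fibreResolvent (d : ℕ) : Ell2 ℤ := resolvent chainAdj (‖combAdj d‖ : ℂ) (delta 0)

/-- The function `v = u ⊗ w` on the vertices of `G^d`, where `u = 1` on `ℤ^d` and
`w = ‖R_ℤ(‖A‖) δ_0‖⁻¹ R_ℤ(‖A‖) δ_0` on `ℤ`. -/
def groundState (d : ℕ) (x : CombVertex d) : ℂ :=
  (‖fibreResolvent d‖ : ℂ)⁻¹ * fibreResolvent d x.2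

/-- The normalized trace `τ_{Λ_n}(T) = |Λ_n|⁻¹ ∑_{x ∈ Λ_n} ⟨δ_x, T δ_x⟩`. -/
def normalizedTrace (d n : ℕ) (T : Ell2 (CombVertex d) →L[ℂ] Ell2 (CombVertex d)) : ℂ :=
  (Fintype.card (FiniteCombVertex d n) : ℂ)⁻¹ *
    ∑ x : FiniteCombVertex d n,
      inner ℂ (delta (finiteEmb d n x)) (T (delta (finiteEmb d n x)))

/-- `N` is the (integrated) density of states of the self-adjoint operator `T`, as a measure:
for each continuous `φ`, the trace per unit volume `τ(φ(T)) = lim_n τ_{Λ_n}(φ(T))` exists and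
equals `∫ φ dN`. -/
def IsDensityOfStates (d : ℕ) (T : Ell2 (CombVertex d) →L[ℂ] Ell2 (CombVertex d))
    (N : Measure ℝ) : Prop :=
  ∀ φ : ℝ → ℝ, Continuous φ →
    Integrable φ N ∧
      Tendsto (fun n => normalizedTrace d n (opFun φ T)) atTop (𝓝 ((∫ h, φ h ∂N : ℝ) : ℂ))

/-- `τ((e^{βH} - I)⁻¹) = ∫ (e^{βh} - 1)⁻¹ dN(h)` in `[0, ∞]`, for a positive operator `H` with
density of states `N`; the integrand is `∞` at `h = 0`. -/
def criticalDensity (β : ℝ) (N : Measure ℝ) : ℝ≥0∞ :=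
  ∫⁻ h, (ENNReal.ofReal (Real.exp (β * h) - 1))⁻¹ ∂N

end

/-!
Write `L = ‖A‖`. The Bose function splits as `(e^{βh} - 1)⁻¹ = (βh)⁻¹ + g(h)` with `g` continuous
on `ℝ` (`boseReg`, `isUnit_expSubOne_and_inverse`). Since `A_{Λ_n} → A` strongly, `g(H_n) → g(H)`
strongly (`tendsto_cfc_apply`), and everything is reduced to the behaviour of the resolvents
`H_n⁻¹`.

*The norm.* The function `q^{|i|}`, `q = √(d² + 1) - d`, which is constant along the base, solves
the eigenvalue equation of `G^d` with eigenvalue `2√(d² + 1)`. It gives the upper bound on `‖A‖`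
and on `‖A_{Λ_n}‖` by the Schur test, and after a slow cutoff along the base also the lower bound
(`norm_combAdj`). It is the generalized Perron–Frobenius vector `v` up to normalization.

*Fourier decomposition.* The characters of the torus `X_n` decompose `A_{Λ_n}` into the operators
`A_{Y_n} + θ(k) |δ₀⟩⟨δ₀|` on the fibre (`modeCoeff_finiteCombAdj`), where `θ(k)` is the eigenvalue
of the torus. For `θ = 2d` the top of the spectrum is at most `L`, for `θ = -2d` it is at most
`2`, so by convexity the mode `k` lies below `L` by a multiple of `2d - θ(k)`
(`re_inner_fibreAdj_le`), which is of order `|k|²`. As `|k|⁻²` is integrable in dimension `d ≥ 3`,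
the nonzero modes contribute to `⟨η, H_n⁻¹ ξ⟩`, for `η, ξ ∈ S₀`, an amount that is continuous at
zero energy uniformly in `n` (`norm_regularPart_sub_le`). In the limit `n → ∞` at fixed energy
this shows that `⟨ξ, (H + s)⁻¹ ξ⟩` converges as `s ↓ 0`, hence that `ξ ∈ Ran H^{1/2}`
(`exists_sqrt_apply_eq`); this is transience and the inclusion `S₀ ⊂ D(H^{-1/2})`, and the
injectivity of `H` follows. Exchanging the two limits, the nonzero modes converge to `⟨H^{-1/2} η,
H^{-1/2} ξ⟩` (`tendsto_regularPart_of_tendsto_zero`).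

*The condensate.* The mode `k = 0` is a fibre operator that converges to `A_ℤ + 2d |δ₀⟩⟨δ₀|`,
whose top eigenvalue `L` is simple (`eq_smul_fibreGround_of_zeroModeAdj_eq`). Multiplied by
`-μ_n`, the resolvents converge strongly to the projection onto the eigenvector
(`tendsto_smul_fibreRes`). The cutoff of the fibre moves the eigenvalue by an amount that is
exponentially small in `n`, against `-μ_n`, which is at least of order `n^{-d}`. The normalization
of the mode supplies the factor `(2n + 1)^{-d}`, and the limit is `c ⟨η, v⟩ ⟨v, ξ⟩`
(`tendsto_zeroMode`).

*Densities.* All but a vanishing fraction of the vertices are far from the base and from the ends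
of the fibres, and there `A`, `A_{Λ_n}` and `A_{Y_n}` have the moments of the chain `ℤ`. Hence the
density of states is the image of the arcsine law under `t ↦ L - t` (`tendsto_averageState_pow`,
`isDensityOfStates_combDensity`). It is supported in `[L - 2, L + 2]`, away from zero, which makes
the critical density finite. The trace of a fibre resolvent changes by a bounded multiple of the
inverse gap under the rank-one perturbation `θ(k) |δ₀⟩⟨δ₀|` (`norm_sum_inner_fibreRes_sub_le`).
Summed over `k`, including the zero mode, this is of order `(2n + 1)^d`, one power less than the
number of vertices (`norm_averageState_finiteRes_sub_le`), and so neither the base nor the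
condensate affects the density.
-/


/-! ### Bounded operators on a Hilbert space -/

section HilbertOperators

variable {E : Type*} [NormedAddCommGroup E] [InnerProductSpace ℂ E]

theorem mul_norm_le_norm_apply {T : E →L[ℂ] E} {c : ℝ}
    (h : ∀ x, c * ‖x‖ ^ 2 ≤ (inner ℂ x (T x)).re) (x : E) : c * ‖x‖ ≤ ‖T x‖ := by
  rcases eq_or_ne x 0 with rfl | hx
  · simp
  have h1 : c * ‖x‖ ^ 2 ≤ ‖x‖ * ‖T x‖ :=
    (h x).trans ((Complex.re_le_norm _).trans (norm_inner_le_norm _ _))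
  have hx' : 0 < ‖x‖ := norm_pos_iff.2 hx
  nlinarith

theorem tendsto_of_dense_of_bounded {ι : Type*} {l : Filter ι} {T : ι → E →L[ℂ] E}
    {S : E →L[ℂ] E} {C : ℝ} (hC : 0 ≤ C) (hT : ∀ᶠ i in l, ‖T i - S‖ ≤ C) {K : Set E}
    (hK : Dense K) (h : ∀ x ∈ K, Tendsto (fun i => T i x) l (𝓝 (S x))) (x : E) :
    Tendsto (fun i => T i x) l (𝓝 (S x)) := by
  rw [Metric.tendsto_nhds]
  intro ε hε
  obtain ⟨y, hy, hxy⟩ := Metric.dense_iff.1 hK x (ε / (2 * (C + 1))) (by positivity)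
  filter_upwards [hT, Metric.tendsto_nhds.1 (h y hxy) (ε / 2) (by positivity)] with i hi hi2
  rw [dist_eq_norm] at hi2 ⊢
  have h1 : ‖(T i - S) (x - y)‖ ≤ C * ‖x - y‖ := (T i - S).le_of_opNorm_le hi _
  have h2 : ‖x - y‖ < ε / (2 * (C + 1)) := by
    rw [← dist_eq_norm, dist_comm]; exact hy
  have h3 : C * ‖x - y‖ ≤ ε / 2 := by
    calc C * ‖x - y‖ ≤ (C + 1) * (ε / (2 * (C + 1))) := by gcongr; linarith
      _ = ε / 2 := by field_simp
  calc ‖T i x - S x‖ = ‖(T i - S) (x - y) + (T i y - S y)‖ := by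
        congr 1; simp only [sub_apply, map_sub]; abel
    _ ≤ _ := norm_add_le _ _
    _ < ε := by linarith

variable [CompleteSpace E]

theorem isUnit_of_le_re_inner {T : E →L[ℂ] E} {c : ℝ} (hc : 0 < c)
    (h : ∀ x, c * ‖x‖ ^ 2 ≤ (inner ℂ x (T x)).re) : IsUnit T := by
  refine T.isUnit_of_forall_le_norm_inner_map (c := ⟨c, hc.le⟩) hc fun x => ?_
  rw [← norm_inner_symm, mul_comm]
  exact (h x).trans (Complex.re_le_norm _)

theorem norm_inverse_apply_le {T : E →L[ℂ] E} {c : ℝ} (hc : 0 < c)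
    (h : ∀ x, c * ‖x‖ ^ 2 ≤ (inner ℂ x (T x)).re) (x : E) : ‖Ring.inverse T x‖ ≤ ‖x‖ / c := by
  have h1 := mul_norm_le_norm_apply h (Ring.inverse T x)
  have h2 : T (Ring.inverse T x) = x := by
    rw [← mul_apply_eq_comp, Ring.mul_inverse_cancel _ (isUnit_of_le_re_inner hc h)]
    rfl
  rw [h2] at h1
  rw [le_div_iff₀ hc]
  linarith

theorem spectrum_subset_Icc {T : E →L[ℂ] E} (hT : IsSelfAdjoint T) {C : ℝ} (hC : ‖T‖ ≤ C) :
    spectrum ℝ T ⊆ Set.Icc (-C) C := by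
  intro t ht
  have := (IsometricContinuousFunctionalCalculus.norm_spectrum_le T ht hT).trans hC
  exact abs_le.1 this

theorem norm_cfc_sub_cfc_le {T : E →L[ℂ] E} (hT : IsSelfAdjoint T) {C ε : ℝ} (hC : ‖T‖ ≤ C)
    (hε : 0 ≤ ε) {f g : ℝ → ℝ} (hf : Continuous f) (hg : Continuous g)
    (h : ∀ t ∈ Set.Icc (-C) C, |f t - g t| ≤ ε) : ‖cfc f T - cfc g T‖ ≤ ε := by
  rw [← cfc_sub f g T hf.continuousOn hg.continuousOn]
  exact norm_cfc_le hε fun t ht => h t (spectrum_subset_Icc hT hC ht)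

theorem inner_cfc_left {T : E →L[ℂ] E} (f : ℝ → ℝ) (x y : E) :
    inner ℂ (cfc f T x) y = inner ℂ x (cfc f T y) := by
  have h : IsSelfAdjoint (cfc f T) := cfc_predicate f T
  rw [← ContinuousLinearMap.adjoint_inner_right, ← ContinuousLinearMap.star_eq_adjoint, h.star_eq]

theorem cfc_apply_cfc_apply (T : E →L[ℂ] E) {f g : ℝ → ℝ} (hf : Continuous f)
    (hg : Continuous g) (x : E) : cfc f T (cfc g T x) = cfc (fun t => f t * g t) T x := by
  rw [cfc_mul f g T hf.continuousOn hg.continuousOn]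
  rfl

theorem norm_cfc_apply_sq (T : E →L[ℂ] E) {f : ℝ → ℝ} (hf : Continuous f) (x : E) :
    ‖cfc f T x‖ ^ 2 = (inner ℂ x (cfc (fun t => f t * f t) T x)).re := by
  rw [← cfc_apply_cfc_apply T hf hf, ← inner_cfc_left, ← inner_self_eq_norm_sq (𝕜 := ℂ)]
  rfl

theorem re_inner_cfc_mono {T : E →L[ℂ] E} {f g : ℝ → ℝ} (hf : Continuous f)
    (hg : Continuous g) (h : ∀ t ∈ spectrum ℝ T, f t ≤ g t) (x : E) :
    (inner ℂ x (cfc f T x)).re ≤ (inner ℂ x (cfc g T x)).re := by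
  have h1 : cfc f T ≤ cfc g T := cfc_mono h hf.continuousOn hg.continuousOn
  have h2 := ((ContinuousLinearMap.le_def _ _).1 h1).re_inner_nonneg_right x
  simp only [sub_apply, inner_sub_right, map_sub] at h2
  exact sub_nonneg.1 h2

/-- Strong convergence of uniformly bounded self-adjoint operators passes to continuous functions
of them. -/
theorem tendsto_cfc_apply {T : ℕ → E →L[ℂ] E} {S : E →L[ℂ] E} {C : ℝ}
    (hT : ∀ n, IsSelfAdjoint (T n)) (hS : IsSelfAdjoint S) (hTC : ∀ n, ‖T n‖ ≤ C) (hSC : ‖S‖ ≤ C)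
    (h : ∀ x, Tendsto (fun n => T n x) atTop (𝓝 (S x))) {φ : ℝ → ℝ} (hφ : Continuous φ) (x : E) :
    Tendsto (fun n => cfc φ (T n) x) atTop (𝓝 (cfc φ S x)) := by
  have hpow : ∀ m : ℕ, ∀ x, Tendsto (fun n => (T n ^ m) x) atTop (𝓝 ((S ^ m) x)) := by
    intro m
    induction m with
    | zero => intro x; simp
    | succ m ih =>
      intro x
      have h1 : Tendsto (fun n => T n ((T n ^ m) x - (S ^ m) x)) atTop (𝓝 0) := by
        have h2 : Tendsto (fun n => C * ‖(T n ^ m) x - (S ^ m) x‖) atTop (𝓝 0) := by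
          simpa using ((tendsto_iff_norm_sub_tendsto_zero.1 (ih x)).const_mul C)
        exact squeeze_zero_norm (fun n => (T n).le_of_opNorm_le (hTC n) _) h2
      have h3 := h1.add (h ((S ^ m) x))
      simpa [pow_succ', map_sub] using h3
  have hpoly : ∀ p : Polynomial ℝ, Tendsto (fun n => Polynomial.aeval (T n) p x) atTop
      (𝓝 (Polynomial.aeval S p x)) := by
    intro p
    induction p using Polynomial.induction_on' with
    | add p q hp hq => simpa using hp.add hq
    | monomial m a =>
      simpa [Polynomial.aeval_monomial, mul_apply_eq_comp,
        Algebra.algebraMap_eq_smul_one] using (hpow m x).const_smul a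
  rw [Metric.tendsto_atTop]
  intro ε hε
  obtain ⟨p, hp⟩ := exists_polynomial_near_of_continuousOn (-C) C φ hφ.continuousOn
    (ε / (3 * (‖x‖ + 1))) (by positivity)
  have hbound : ∀ A : E →L[ℂ] E, IsSelfAdjoint A → ‖A‖ ≤ C →
      ‖cfc φ A x - Polynomial.aeval A p x‖ ≤ ε / 3 := by
    intro A hA hAC
    have h1 : ‖cfc φ A - cfc p.eval A‖ ≤ ε / (3 * (‖x‖ + 1)) :=
      norm_cfc_sub_cfc_le hA hAC (by positivity) hφ p.continuous fun t ht => by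
        rw [abs_sub_comm]; exact (hp t ht).le
    rw [cfc_polynomial p A hA] at h1
    calc ‖cfc φ A x - Polynomial.aeval A p x‖ ≤ ε / (3 * (‖x‖ + 1)) * ‖x‖ :=
          (cfc φ A - Polynomial.aeval A p).le_of_opNorm_le h1 x
      _ ≤ ε / (3 * (‖x‖ + 1)) * (‖x‖ + 1) := by gcongr; linarith
      _ = ε / 3 := by field_simp
  obtain ⟨n₀, hn₀⟩ := Metric.tendsto_atTop.1 (hpoly p) (ε / 3) (by positivity)
  refine ⟨n₀, fun n hn => ?_⟩
  have h1 := hbound (T n) (hT n) (hTC n)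
  have h2 := hbound S hS hSC
  have h3 := hn₀ n hn
  rw [dist_eq_norm] at h3 ⊢
  calc ‖cfc φ (T n) x - cfc φ S x‖
      = ‖(cfc φ (T n) x - Polynomial.aeval (T n) p x)
          + (Polynomial.aeval (T n) p x - Polynomial.aeval S p x)
          - (cfc φ S x - Polynomial.aeval S p x)‖ := by congr 1; abel
    _ ≤ _ := (norm_sub_le _ _).trans (add_le_add_left (norm_add_le _ _) _)
    _ < ε := by linarith

/-! ### The range of the square root of a positive operator -/

/-- The function `h ↦ (h + s)⁻¹` on `[0, ∞)`, extended to a continuous function on `ℝ`. -/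
noncomputable def shiftedInv (s h : ℝ) : ℝ := (max h 0 + s)⁻¹

theorem continuous_shiftedInv {s : ℝ} (hs : 0 < s) : Continuous (shiftedInv s) :=
  Continuous.inv₀ (by fun_prop) fun h => by positivity

theorem shiftedInv_of_nonneg (s : ℝ) {h : ℝ} (hh : 0 ≤ h) : shiftedInv s h = (h + s)⁻¹ := by
  rw [shiftedInv, max_eq_left hh]

theorem inverse_smul_add_eq_cfc {H : E →L[ℂ] E} (hH : 0 ≤ H) {s : ℝ} (hs : 0 < s) :
    Ring.inverse ((s : ℂ) • 1 + H) = cfc (shiftedInv s) H := by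
  have hsa : IsSelfAdjoint H := hH.isSelfAdjoint
  have h1 : ((s : ℂ) • 1 + H) = cfc (fun h : ℝ => s + h) H := by
    rw [cfc_const_add s (fun h : ℝ => h) H (by fun_prop), cfc_id' ℝ H,
      Algebra.algebraMap_eq_smul_one]
    rfl
  have h2 : ((s : ℂ) • 1 + H) * cfc (shiftedInv s) H = 1 := by
    rw [h1, ← cfc_mul _ _ H (by fun_prop) (continuous_shiftedInv hs).continuousOn, ← cfc_one ℝ H]
    refine cfc_congr fun h hh => ?_
    have := spectrum_nonneg_of_nonneg hH hh
    simp only [shiftedInv_of_nonneg s this, Pi.one_apply]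
    rw [add_comm]
    exact mul_inv_cancel₀ (by positivity)
  have h3 : cfc (shiftedInv s) H * ((s : ℂ) • 1 + H) = 1 := by
    rw [h1, cfc_commute_cfc, ← h1, h2]
  exact Ring.inverse_unit ⟨_, _, h2, h3⟩

/-- If `⟨ξ, (H + s)⁻¹ ξ⟩` stays bounded as `s ↓ 0`, then `ξ` lies in the range of `H^{1/2}`: the
vectors `ζ_s = H^{1/2} (H + s)⁻¹ ξ` are Cauchy because `‖ζ_s - ζ_t‖² ≤ D(s) - D(t)` for `s ≤ t`,
where `D(s)` is the matrix element above, and `H^{1/2} ζ_s = H (H + s)⁻¹ ξ` converges to `ξ`. -/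
theorem exists_sqrt_apply_eq {H : E →L[ℂ] E} (hH : 0 ≤ H) {ξ : E} {L : ℝ}
    (hL : Tendsto (fun s => (inner ℂ ξ (cfc (shiftedInv s) H ξ)).re) (𝓝[>] 0) (𝓝 L)) :
    ∃ ζ, cfc Real.sqrt H ζ = ξ := by
  set D : ℝ → ℝ := fun s => (inner ℂ ξ (cfc (shiftedInv s) H ξ)).re with hD
  set ζ : ℝ → E := fun s => cfc (fun h => √h * shiftedInv s h) H ξ with hζ
  have hcont : ∀ {s : ℝ}, 0 < s → Continuous fun h => √h * shiftedInv s h := fun hs =>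
    Real.continuous_sqrt.mul (continuous_shiftedInv hs)
  have hdiff : ∀ s t : ℝ, 0 < s → s ≤ t → ‖ζ s - ζ t‖ ^ 2 ≤ D s - D t := by
    intro s t hs hst
    have ht : 0 < t := hs.trans_le hst
    have h1 : ζ s - ζ t = cfc (fun h => √h * shiftedInv s h - √h * shiftedInv t h) H ξ := by
      rw [cfc_sub _ _ H (hcont hs).continuousOn (hcont ht).continuousOn]; rfl
    have h2 : D s - D t = (inner ℂ ξ (cfc (fun h => shiftedInv s h - shiftedInv t h) H ξ)).re := by
      rw [cfc_sub _ _ H (continuous_shiftedInv hs).continuousOn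
        (continuous_shiftedInv ht).continuousOn, sub_apply, inner_sub_right,
        Complex.sub_re]
    have c1 : Continuous fun h => √h * shiftedInv s h - √h * shiftedInv t h :=
      (hcont hs).sub (hcont ht)
    rw [h1, h2, norm_cfc_apply_sq H c1]
    refine re_inner_cfc_mono (c1.mul c1)
      ((continuous_shiftedInv hs).sub (continuous_shiftedInv ht)) (fun h hh => ?_) ξ
    have h0 : 0 ≤ h := spectrum_nonneg_of_nonneg hH hh
    simp only [Pi.mul_apply, Pi.sub_apply, shiftedInv_of_nonneg s h0, shiftedInv_of_nonneg t h0]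
    have e1 : (h + s)⁻¹ - (h + t)⁻¹ = (t - s) * ((h + s)⁻¹ * (h + t)⁻¹) := by
      field_simp; ring
    have e2 : (√h * (h + s)⁻¹ - √h * (h + t)⁻¹) * (√h * (h + s)⁻¹ - √h * (h + t)⁻¹)
        = (h * (t - s) * ((h + s)⁻¹ * (h + t)⁻¹)) * ((t - s) * ((h + s)⁻¹ * (h + t)⁻¹)) := by
      rw [← mul_sub, e1]
      linear_combination ((t - s) * ((h + s)⁻¹ * (h + t)⁻¹)) ^ 2 * Real.mul_self_sqrt h0
    rw [e2, e1]
    refine mul_le_of_le_one_left (mul_nonneg (by linarith) (by positivity)) ?_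
    rw [← mul_inv, ← div_eq_mul_inv, div_le_one (by positivity)]
    nlinarith [mul_nonneg h0 hs.le, mul_nonneg hs.le ht.le, mul_nonneg h0 h0]
  have hcauchy : Cauchy (map ζ (𝓝[>] 0)) := by
    rw [Metric.cauchy_iff]
    refine ⟨inferInstance, fun ε hε => ?_⟩
    obtain ⟨t, ht, htD⟩ := (Metric.cauchy_iff.1 hL.cauchy_map).2 (ε ^ 2) (by positivity)
    have hmem : (D ⁻¹' t ∩ Set.Ioi 0) ∈ 𝓝[>] (0 : ℝ) := inter_mem ht self_mem_nhdsWithin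
    refine ⟨ζ '' (D ⁻¹' t ∩ Set.Ioi 0), image_mem_map hmem, ?_⟩
    have key : ∀ s r : ℝ, s ∈ D ⁻¹' t ∩ Set.Ioi 0 → r ∈ D ⁻¹' t ∩ Set.Ioi 0 → s ≤ r →
        dist (ζ s) (ζ r) < ε := by
      intro s r hs hr hsr
      have h1 := hdiff s r hs.2 hsr
      have h2 := htD _ hs.1 _ hr.1
      rw [Real.dist_eq] at h2
      rw [dist_eq_norm]
      exact lt_of_pow_lt_pow_left₀ 2 hε.le (h1.trans_lt ((le_abs_self _).trans_lt h2))
    rintro _ ⟨s, hs, rfl⟩ _ ⟨r, hr, rfl⟩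
    rcases le_total s r with h | h
    · exact key s r hs hr h
    · rw [dist_comm]; exact key r s hr hs h
  obtain ⟨z, hz⟩ := CompleteSpace.complete hcauchy
  refine ⟨z, ?_⟩
  have h1 : Tendsto (fun s => cfc Real.sqrt H (ζ s)) (𝓝[>] 0) (𝓝 (cfc Real.sqrt H z)) :=
    ((cfc Real.sqrt H).continuous.tendsto z).comp hz
  refine tendsto_nhds_unique h1 ?_
  have h2 : ∀ᶠ s in 𝓝[>] (0 : ℝ), ‖cfc Real.sqrt H (ζ s) - ξ‖ ≤ √(s * D s) := by
    filter_upwards [self_mem_nhdsWithin] with s hs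
    have hs : 0 < s := hs
    apply Real.le_sqrt_of_sq_le
    have e1 : cfc Real.sqrt H (ζ s) - ξ = cfc (fun h => √h * (√h * shiftedInv s h) - 1) H ξ := by
      have c0 : Continuous fun h => √h * (√h * shiftedInv s h) :=
        Real.continuous_sqrt.mul (hcont hs)
      rw [cfc_sub _ _ H c0.continuousOn continuous_const.continuousOn,
        cfc_const_one ℝ H hH.isSelfAdjoint, hζ,
        cfc_apply_cfc_apply H Real.continuous_sqrt (hcont hs)]
      rfl
    have e2 : s * D s = (inner ℂ ξ (cfc (fun h => s * shiftedInv s h) H ξ)).re := by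
      rw [cfc_const_mul s _ H (continuous_shiftedInv hs).continuousOn,
        smul_apply, ← Complex.coe_smul, inner_smul_right]
      simp [D]
    have c1 : Continuous fun h => √h * (√h * shiftedInv s h) - 1 :=
      (Real.continuous_sqrt.mul (hcont hs)).sub continuous_const
    rw [e1, e2, norm_cfc_apply_sq H c1]
    refine re_inner_cfc_mono (c1.mul c1) (continuous_const.mul (continuous_shiftedInv hs))
      (fun h hh => ?_) ξ
    have h0 : 0 ≤ h := spectrum_nonneg_of_nonneg hH hh
    simp only [Pi.mul_apply, shiftedInv_of_nonneg s h0]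
    have e3 : √h * (√h * (h + s)⁻¹) - 1 = - (s * (h + s)⁻¹) := by
      rw [← mul_assoc, Real.mul_self_sqrt h0]; field_simp; ring
    rw [e3, neg_mul_neg]
    refine mul_le_of_le_one_left (by positivity) ?_
    rw [← div_eq_mul_inv, div_le_one (by positivity)]
    linarith
  have h3 : Tendsto (fun s => √(s * D s)) (𝓝[>] 0) (𝓝 0) := by
    have : Tendsto (fun s => s * D s) (𝓝[>] 0) (𝓝 (0 * L)) :=
      (tendsto_id.mono_left nhdsWithin_le_nhds).mul hL
    simpa [Function.comp_def] using (Real.continuous_sqrt.tendsto _).comp this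
  rw [tendsto_iff_norm_sub_tendsto_zero]
  exact squeeze_zero' (Eventually.of_forall fun _ => norm_nonneg _) h2 h3

theorem denseRange_of_injective {T : E →L[ℂ] E} (hT : IsSelfAdjoint T)
    (hinj : Function.Injective T) : DenseRange T := by
  have h : (LinearMap.range T.toLinearMap).topologicalClosure = ⊤ := by
    rw [Submodule.topologicalClosure_eq_top_iff, Submodule.eq_bot_iff]
    intro x hx
    apply hinj
    rw [map_zero]
    refine ext_inner_left ℂ fun y => ?_
    rw [inner_zero_right, ← ContinuousLinearMap.adjoint_inner_left,
      ← ContinuousLinearMap.star_eq_adjoint, hT.star_eq]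
    exact hx (T y) ⟨y, rfl⟩
  have h2 := (Submodule.dense_iff_topologicalClosure_eq_top).2 h
  exact h2

theorem sqrt_apply_sqrt_apply {H : E →L[ℂ] E} (hH : 0 ≤ H) (x : E) :
    cfc Real.sqrt H (cfc Real.sqrt H x) = H x := by
  rw [cfc_apply_cfc_apply H Real.continuous_sqrt Real.continuous_sqrt]
  conv_rhs => rw [← cfc_id' ℝ H]
  congr 1
  exact cfc_congr fun h hh => Real.mul_self_sqrt (spectrum_nonneg_of_nonneg hH hh)

theorem injective_sqrt {H : E →L[ℂ] E} (hH : 0 ≤ H) (hinj : Function.Injective H) :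
    Function.Injective (cfc Real.sqrt H : E →L[ℂ] E) := fun x y hxy => hinj <| by
  rw [← sqrt_apply_sqrt_apply hH, hxy, sqrt_apply_sqrt_apply hH]

/-- The matrix elements of `(H + s)⁻¹` between vectors in the range of `H^{1/2}` converge to those
of `H⁻¹` in the sense of quadratic forms, for `s (H + s)⁻¹` converges strongly to `0` when `H` is
injective. -/
theorem tendsto_inner_cfc_shiftedInv {H : E →L[ℂ] E} (hH : 0 ≤ H) (hinj : Function.Injective H)
    (x y : E) : Tendsto (fun s => inner ℂ (cfc Real.sqrt H x)
      (cfc (shiftedInv s) H (cfc Real.sqrt H y))) (𝓝[>] 0) (𝓝 (inner ℂ x y)) := by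
  have hcont : ∀ {s : ℝ}, 0 < s → Continuous fun h => s * shiftedInv s h := fun hs =>
    continuous_const.mul (continuous_shiftedInv hs)
  have hbd : ∀ᶠ s in 𝓝[>] (0 : ℝ), ‖cfc (fun h => s * shiftedInv s h) H - 0‖ ≤ 1 := by
    filter_upwards [self_mem_nhdsWithin] with s hs
    have hs : 0 < s := hs
    rw [sub_zero]
    refine norm_cfc_le zero_le_one fun h hh => ?_
    have h0 : 0 ≤ h := spectrum_nonneg_of_nonneg hH hh
    rw [shiftedInv_of_nonneg _ h0, Real.norm_of_nonneg (by positivity), ← div_eq_mul_inv,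
      div_le_one (by positivity)]
    linarith
  have hlim : Tendsto (fun s => cfc (fun h => s * shiftedInv s h) H y) (𝓝[>] 0) (𝓝 0) := by
    refine tendsto_of_dense_of_bounded (S := 0) zero_le_one hbd
      (denseRange_of_injective (T := cfc Real.sqrt H) (cfc_predicate Real.sqrt H)
        (injective_sqrt hH hinj)) ?_ y
    rintro _ ⟨z, rfl⟩
    rw [zero_apply]
    have h1 : ∀ᶠ s in 𝓝[>] (0 : ℝ),
        ‖cfc (fun h => s * shiftedInv s h) H (cfc Real.sqrt H z)‖ ≤ √s * ‖z‖ := by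
      filter_upwards [self_mem_nhdsWithin] with s hs
      have hs : 0 < s := hs
      rw [cfc_apply_cfc_apply H (hcont hs) Real.continuous_sqrt]
      refine ContinuousLinearMap.le_of_opNorm_le _ (norm_cfc_le (by positivity) fun h hh => ?_) z
      have h0 : 0 ≤ h := spectrum_nonneg_of_nonneg hH hh
      rw [shiftedInv_of_nonneg _ h0, Real.norm_of_nonneg (by positivity)]
      have e : s * (h + s)⁻¹ * √h = √s * (√s * √h / (h + s)) := by
        rw [← Real.mul_self_sqrt hs.le, Real.sqrt_mul_self (Real.sqrt_nonneg s)]; ring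
      rw [e]
      refine mul_le_of_le_one_right (Real.sqrt_nonneg _) ?_
      rw [div_le_one (by positivity)]
      nlinarith [Real.mul_self_sqrt hs.le, Real.mul_self_sqrt h0, sq_nonneg (√s - √h),
        Real.sqrt_nonneg s, Real.sqrt_nonneg h]
    refine squeeze_zero_norm' h1 ?_
    have : Tendsto (fun s => √s * ‖z‖) (𝓝[>] 0) (𝓝 (√0 * ‖z‖)) :=
      ((Real.continuous_sqrt.tendsto 0).mono_left nhdsWithin_le_nhds).mul_const _
    simpa using this
  have h1 : Tendsto (fun s => inner ℂ x (y - cfc (fun h => s * shiftedInv s h) H y)) (𝓝[>] 0)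
      (𝓝 (inner ℂ x (y - 0))) :=
    tendsto_const_nhds.inner (tendsto_const_nhds.sub hlim)
  rw [sub_zero] at h1
  refine h1.congr' ?_
  filter_upwards [self_mem_nhdsWithin] with s hs
  have hs : 0 < s := hs
  have c0 : Continuous fun h => shiftedInv s h * √h :=
    (continuous_shiftedInv hs).mul Real.continuous_sqrt
  rw [inner_cfc_left, cfc_apply_cfc_apply H (continuous_shiftedInv hs) Real.continuous_sqrt,
    cfc_apply_cfc_apply H Real.continuous_sqrt c0]
  congr 1
  have h2 : y - cfc (fun h => s * shiftedInv s h) H y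
      = cfc (fun h => 1 - s * shiftedInv s h) H y := by
    rw [cfc_sub _ _ H continuous_const.continuousOn (hcont hs).continuousOn, cfc_const_one ℝ H
      hH.isSelfAdjoint]
    rfl
  rw [h2]
  congr 1
  refine cfc_congr fun h hh => ?_
  have h0 : 0 ≤ h := spectrum_nonneg_of_nonneg hH hh
  simp only [shiftedInv_of_nonneg s h0]
  have : √h * ((h + s)⁻¹ * √h) = h * (h + s)⁻¹ := by
    linear_combination (h + s)⁻¹ * Real.mul_self_sqrt h0
  rw [this]
  field_simp
  ring

end HilbertOperators


/-! ### The Bose function -/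

section BoseFunction

/-- The function `h ↦ (e^{βh} - 1) / h`, with its value `β` at `h = 0`. -/
noncomputable def expSlope (β : ℝ) : ℝ → ℝ := dslope (fun h => Real.exp (β * h)) 0

theorem mul_expSlope (β h : ℝ) : h * expSlope β h = Real.exp (β * h) - 1 := by
  simpa [expSlope] using sub_smul_dslope (fun h => Real.exp (β * h)) 0 h

theorem expSlope_zero (β : ℝ) : expSlope β 0 = β := by
  have h : HasDerivAt (fun h => Real.exp (β * h)) (Real.exp (β * 0) * (β * 1)) 0 :=
    ((hasDerivAt_id (0 : ℝ)).const_mul β).exp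
  rw [expSlope, dslope_same, h.deriv]
  simp

theorem expSlope_pos {β : ℝ} (hβ : 0 < β) (h : ℝ) : 0 < expSlope β h := by
  have h1 := mul_expSlope β h
  rcases lt_trichotomy h 0 with hh | rfl | hh
  · have : Real.exp (β * h) < 1 := by
      rw [Real.exp_lt_one_iff]; nlinarith
    by_contra! hc
    nlinarith [mul_nonneg_of_nonpos_of_nonpos hh.le hc]
  · rwa [expSlope_zero]
  · have : 1 < Real.exp (β * h) := by
      rw [Real.one_lt_exp_iff]; positivity
    by_contra! hc
    nlinarith [mul_nonneg hh.le (neg_nonneg.2 hc)]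

theorem continuous_expSlope (β : ℝ) : Continuous (expSlope β) := by
  rw [← continuousOn_univ, expSlope, continuousOn_dslope univ_mem]
  exact ⟨by fun_prop, by fun_prop⟩

theorem differentiableAt_expSlope_zero (β : ℝ) : DifferentiableAt ℝ (expSlope β) 0 := by
  have h : AnalyticAt ℝ (fun h => Real.exp (β * h)) 0 := by fun_prop
  obtain ⟨p, hp⟩ := h
  exact (hp.has_fpower_series_dslope_fslope).differentiableAt

/-- The regular part of the Bose function: the continuous function `g` with
`1 / (e^{βh} - 1) = 1 / (βh) + g(h)` for `h ≠ 0`. -/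
noncomputable def boseReg (β : ℝ) : ℝ → ℝ := dslope (fun h => (expSlope β h)⁻¹) 0

theorem mul_boseReg (β h : ℝ) : h * boseReg β h = (expSlope β h)⁻¹ - β⁻¹ := by
  simpa [boseReg, expSlope_zero] using sub_smul_dslope (fun h => (expSlope β h)⁻¹) 0 h

theorem continuous_boseReg {β : ℝ} (hβ : 0 < β) : Continuous (boseReg β) := by
  rw [← continuousOn_univ, boseReg, continuousOn_dslope univ_mem, continuousOn_univ]
  exact ⟨(continuous_expSlope β).inv₀ fun h => (expSlope_pos hβ h).ne',
    (differentiableAt_expSlope_zero β).inv (expSlope_pos hβ 0).ne'⟩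

theorem inv_exp_sub_one_eq {β : ℝ} {h : ℝ} (hh : h ≠ 0) :
    (Real.exp (β * h) - 1)⁻¹ = β⁻¹ * h⁻¹ + boseReg β h := by
  rw [← mul_expSlope, mul_inv]
  have := mul_boseReg β h
  have h2 : boseReg β h = h⁻¹ * ((expSlope β h)⁻¹ - β⁻¹) := by
    rw [← this, inv_mul_cancel_left₀ hh]
  rw [h2]
  ring

variable {E : Type*} [NormedAddCommGroup E] [InnerProductSpace ℂ E] [CompleteSpace E]

theorem expSubOne_eq_cfc {T : E →L[ℂ] E} (hT : IsSelfAdjoint T) (β : ℝ) :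
    expSubOne β T = cfc (fun h => h * expSlope β h) T := by
  have h1 : IsSelfAdjoint (β • T) := by
    rw [← cfc_const_mul_id β T]
    exact cfc_predicate _ _
  have h2 : ((β : ℂ) • T) = β • T := Complex.coe_smul β T
  rw [expSubOne, h2, ← CFC.real_exp_eq_normedSpace_exp h1, ← cfc_comp_const_mul β Real.exp T,
    ← cfc_const_one ℝ T, ← cfc_sub _ _ T]
  simp only [mul_expSlope]

/-- For a strictly positive operator `T` the Bose function splits as
`(e^{βT} - 1)⁻¹ = (βT)⁻¹ + g(T)`, with `g` continuous on all of `ℝ`. -/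
theorem isUnit_expSubOne_and_inverse {T : E →L[ℂ] E} (hT : IsSelfAdjoint T) {c : ℝ} (hc : 0 < c)
    (h : ∀ x, c * ‖x‖ ^ 2 ≤ (inner ℂ x (T x)).re) {β : ℝ} (hβ : 0 < β) :
    IsUnit (expSubOne β T) ∧
      Ring.inverse (expSubOne β T) = (β⁻¹ : ℝ) • Ring.inverse T + cfc (boseReg β) T := by
  have hu := isUnit_of_le_re_inner hc h
  have hψ := continuous_expSlope β
  have hψi : Continuous fun h => (expSlope β h)⁻¹ := hψ.inv₀ fun h => (expSlope_pos hβ h).ne'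
  have hg := continuous_boseReg hβ
  have e1 : expSubOne β T = T * cfc (expSlope β) T := by
    rw [expSubOne_eq_cfc hT, cfc_mul _ _ T, cfc_id' ℝ T]
  have e1' : expSubOne β T = cfc (expSlope β) T * T := by
    simp_rw [expSubOne_eq_cfc hT, mul_comm _ (expSlope β _)]
    rw [cfc_mul _ _ T, cfc_id' ℝ T]
  have e2 : T * ((β⁻¹ : ℝ) • Ring.inverse T + cfc (boseReg β) T)
      = cfc (fun h => (expSlope β h)⁻¹) T := by
    have : (fun h => (expSlope β h)⁻¹) = fun h => β⁻¹ + h * boseReg β h := by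
      ext h; rw [mul_boseReg]; ring
    rw [this, cfc_const_add _ _ T, cfc_mul _ _ T, cfc_id' ℝ T, mul_add, mul_smul_comm,
      Ring.mul_inverse_cancel _ hu, Algebra.algebraMap_eq_smul_one]
  have e2' : ((β⁻¹ : ℝ) • Ring.inverse T + cfc (boseReg β) T) * T
      = cfc (fun h => (expSlope β h)⁻¹) T := by
    have : (fun h => (expSlope β h)⁻¹) = fun h => β⁻¹ + boseReg β h * h := by
      ext h; rw [mul_comm, mul_boseReg]; ring
    rw [this, cfc_const_add _ _ T, cfc_mul _ _ T, cfc_id' ℝ T, add_mul, smul_mul_assoc,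
      Ring.inverse_mul_cancel _ hu, Algebra.algebraMap_eq_smul_one]
  have e3 : cfc (expSlope β) T * cfc (fun h => (expSlope β h)⁻¹) T = 1 := by
    rw [← cfc_mul _ _ T hψ.continuousOn hψi.continuousOn, ← cfc_const_one ℝ T]
    exact cfc_congr fun h _ => mul_inv_cancel₀ (expSlope_pos hβ h).ne'
  have e4 : cfc (fun h => (expSlope β h)⁻¹) T * cfc (expSlope β) T = 1 := by
    rw [cfc_commute_cfc, e3]
  have r1 : expSubOne β T * ((β⁻¹ : ℝ) • Ring.inverse T + cfc (boseReg β) T) = 1 := by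
    rw [e1', mul_assoc, e2, e3]
  have r2 : ((β⁻¹ : ℝ) • Ring.inverse T + cfc (boseReg β) T) * expSubOne β T = 1 := by
    rw [e1, ← mul_assoc, e2', e4]
  exact ⟨⟨⟨_, _, r1, r2⟩, rfl⟩, Ring.inverse_unit ⟨_, _, r1, r2⟩⟩

theorem exists_invSqrt_eq {T : E →L[ℂ] E} (hT : 0 ≤ T) (hinj : Function.Injective T) {z ξ : E}
    (hz : cfc Real.sqrt T z = ξ) :
    ∃ h : ξ ∈ (invSqrt T).domain, invSqrt T ⟨ξ, h⟩ = z := by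
  have hker : LinearMap.ker (((opFun Real.sqrt T).toLinearMap.toPMap ⊤)).toFun = ⊥ := by
    rw [LinearMap.ker_eq_bot]
    intro x y hxy
    exact Subtype.ext (injective_sqrt hT hinj hxy)
  have hdom : ξ ∈ (invSqrt T).domain := by
    rw [invSqrt, LinearPMap.inverse_domain]
    exact ⟨⟨z, trivial⟩, hz⟩
  exact ⟨hdom, LinearPMap.inverse_apply_eq hker (x := ⟨z, trivial⟩) hz⟩

theorem expSubOne_nonneg {H : E →L[ℂ] E} (hH : 0 ≤ H) {β : ℝ} (hβ : 0 < β) :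
    0 ≤ expSubOne β H := by
  rw [expSubOne_eq_cfc hH.isSelfAdjoint]
  exact cfc_nonneg fun h hh =>
    mul_nonneg (spectrum_nonneg_of_nonneg hH hh) (expSlope_pos hβ h).le

theorem expSubOne_injective {H : E →L[ℂ] E} (hH : 0 ≤ H) (hinj : Function.Injective H)
    {β : ℝ} (hβ : 0 < β) : Function.Injective (expSubOne β H) := by
  have hψ := continuous_expSlope β
  have hψi : Continuous fun h => (expSlope β h)⁻¹ := hψ.inv₀ fun h => (expSlope_pos hβ h).ne'
  have h1 : cfc (fun h => (expSlope β h)⁻¹) H * expSubOne β H = H := by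
    have hsa := hH.isSelfAdjoint
    rw [expSubOne_eq_cfc hsa, ← cfc_mul _ _ H hψi.continuousOn (by fun_prop)]
    conv_rhs => rw [← cfc_id' ℝ H]
    refine cfc_congr fun h _ => ?_
    have := (expSlope_pos hβ h).ne'
    field_simp
  intro x y hxy
  apply hinj
  rw [← h1, mul_apply_eq_comp, mul_apply_eq_comp, hxy]

/-- The quadratic form of `(e^{βH} - 1)⁻¹` for a positive injective operator `H` that need not be
invertible. As `e^{βH} - 1 = H ψ(H)` with `ψ` continuous and positive, its square root is
`ψ(H)^{1/2} H^{1/2}`, and so it has the same range as `H^{1/2}`. -/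
theorem inner_invSqrt_expSubOne {H : E →L[ℂ] E} (hH : 0 ≤ H) (hinj : Function.Injective H)
    {β : ℝ} (hβ : 0 < β) {η ξ y z : E} (hy : cfc Real.sqrt H y = η) (hz : cfc Real.sqrt H z = ξ) :
    ∃ (hη : η ∈ (invSqrt (expSubOne β H)).domain) (hξ : ξ ∈ (invSqrt (expSubOne β H)).domain),
      inner ℂ (invSqrt (expSubOne β H) ⟨η, hη⟩) (invSqrt (expSubOne β H) ⟨ξ, hξ⟩)
        = ((β⁻¹ : ℝ) : ℂ) * inner ℂ y z + inner ℂ η (cfc (boseReg β) H ξ) := by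
  have hsa := hH.isSelfAdjoint
  have hψ := continuous_expSlope β
  have hg := continuous_boseReg hβ
  set r : ℝ → ℝ := fun h => (√(expSlope β h))⁻¹ with hr
  have hrc : Continuous r := (Real.continuous_sqrt.comp hψ).inv₀ fun h =>
    (Real.sqrt_pos.2 (expSlope_pos hβ h)).ne'
  have hfc : Continuous fun h => h * expSlope β h := continuous_id.mul hψ
  have key : ∀ {w ω : E}, cfc Real.sqrt H w = ω →
      cfc Real.sqrt (expSubOne β H) (cfc r H w) = ω := by
    intro w ω hw
    rw [expSubOne_eq_cfc hsa, ← cfc_comp Real.sqrt (fun h => h * expSlope β h) H,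
      cfc_apply_cfc_apply H (Real.continuous_sqrt.comp hfc) hrc, ← hw]
    congr 1
    refine cfc_congr fun h hh => ?_
    have h0 := spectrum_nonneg_of_nonneg hH hh
    simp only [Function.comp, hr, Real.sqrt_mul h0]
    rw [mul_assoc, mul_inv_cancel₀ (Real.sqrt_pos.2 (expSlope_pos hβ h)).ne', mul_one]
  obtain ⟨hη, e1⟩ := exists_invSqrt_eq (expSubOne_nonneg hH hβ) (expSubOne_injective hH hinj hβ)
    (key hy)
  obtain ⟨hξ, e2⟩ := exists_invSqrt_eq (expSubOne_nonneg hH hβ) (expSubOne_injective hH hinj hβ)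
    (key hz)
  refine ⟨hη, hξ, ?_⟩
  have hgs : Continuous fun h => boseReg β h * √h := hg.mul Real.continuous_sqrt
  have hm : Continuous fun h => √h * (boseReg β h * √h) := Real.continuous_sqrt.mul hgs
  rw [e1, e2, inner_cfc_left, cfc_apply_cfc_apply H hrc hrc, ← hy, ← hz, inner_cfc_left,
    cfc_apply_cfc_apply H hg Real.continuous_sqrt,
    cfc_apply_cfc_apply H Real.continuous_sqrt hgs]
  have e3 : cfc (fun h => r h * r h) H
      = (β⁻¹ : ℝ) • 1 + cfc (fun h => √h * (boseReg β h * √h)) H := by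
    rw [← Algebra.algebraMap_eq_smul_one, ← cfc_const_add _ _ H hm.continuousOn]
    refine cfc_congr fun h hh => ?_
    have h0 := spectrum_nonneg_of_nonneg hH hh
    simp only [hr, ← mul_inv, Real.mul_self_sqrt (expSlope_pos hβ h).le]
    have := mul_boseReg β h
    linear_combination -this - boseReg β h * Real.mul_self_sqrt h0
  rw [e3, add_apply, inner_add_right, smul_apply, ← Complex.coe_smul, inner_smul_right]
  rfl

end BoseFunction


/-! ### Adjacency operators -/

section Adjacency

variable {V : Type*}

theorem inner_delta_left (x : V) (f : Ell2 V) : inner ℂ (delta x) f = f x := by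
  classical
  have h := lp.inner_single_left (𝕜 := ℂ) (G := fun _ : V => ℂ) x (1 : ℂ) f
  have hd : delta x = lp.single (E := fun _ : V => ℂ) 2 x (1 : ℂ) := by
    unfold delta; congr!
  rw [hd, h]
  simp

theorem inner_delta_right (x : V) (f : Ell2 V) : inner ℂ f (delta x) = conj (f x) := by
  rw [← inner_conj_symm, inner_delta_left]

theorem delta_apply [DecidableEq V] (x y : V) : delta x y = if y = x then (1 : ℂ) else 0 := by
  have hd : delta x = lp.single (E := fun _ : V => ℂ) 2 x (1 : ℂ) := by
    unfold delta; congr!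
  rw [hd, lp.single_apply, Pi.single_apply]

theorem norm_delta (x : V) : ‖delta x‖ = 1 := by
  classical
  have hd : delta x = lp.single (E := fun _ : V => ℂ) 2 x (1 : ℂ) := by
    unfold delta; congr!
  rw [hd, lp.norm_single (by norm_num), norm_one]

theorem ext_delta {F : Type*} [NormedAddCommGroup F] [NormedSpace ℂ F] {S T : Ell2 V →L[ℂ] F}
    (h : ∀ x, S (delta x) = T (delta x)) : S = T := by
  classical
  refine lp.ext_continuousLinearMap (by simp) fun x => ?_
  ext
  have hd : delta x = lp.single (E := fun _ : V => ℂ) 2 x (1 : ℂ) := by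
    unfold delta; congr!
  have := h x
  rw [hd] at this
  simpa using this

theorem adjOp_delta_apply (G : SimpleGraph V) (hG : BoundedDegree G) [DecidableRel G.Adj]
    (x y : V) :
    adjOp G hG (delta y) x = if G.Adj x y then 1 else 0 := by
  classical
  simp [adjOp_apply, delta_apply]

theorem isSelfAdjoint_adjOp (G : SimpleGraph V) (hG : BoundedDegree G) :
    IsSelfAdjoint (adjOp G hG) := by
  classical
  rw [IsSelfAdjoint, ContinuousLinearMap.star_eq_adjoint]
  refine ext_delta fun y => ?_
  ext x
  rw [← inner_delta_left, ContinuousLinearMap.adjoint_inner_right, inner_delta_right,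
    adjOp_delta_apply, adjOp_delta_apply]
  simp [G.adj_comm]

theorem norm_sq_eq_tsum (f : Ell2 V) : ‖f‖ ^ 2 = ∑' x, ‖f x‖ ^ 2 := by
  simpa using lp.norm_rpow_eq_tsum (p := 2) (by simp) f

theorem summable_norm_sq (f : Ell2 V) : Summable fun x => ‖f x‖ ^ 2 := by
  simpa using (lp.memℓp f).summable (by simp)

theorem memlp_two_of_summable {f : V → ℂ} (h : Summable fun x => ‖f x‖ ^ 2) :
    Memℓp (E := fun _ : V => ℂ) f 2 := by
  apply memℓp_gen
  simpa using h

/-- The Schur test with a positive supersolution as weight. -/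
theorem norm_adjOp_le {G : SimpleGraph V} (hG : BoundedDegree G) {v : V → ℝ} (hv : ∀ x, 0 < v x)
    {L : ℝ} (hL : 0 ≤ L) (h : ∀ x, ∑ y ∈ (hG.finite x).toFinset, v y ≤ L * v x) :
    ‖adjOp G hG‖ ≤ L := by
  classical
  refine ContinuousLinearMap.opNorm_le_bound _ hL fun f => ?_
  have h1 : ∀ x, ‖adjOp G hG f x‖ ^ 2
      ≤ ∑ y ∈ (hG.finite x).toFinset, L * v x * (‖f y‖ ^ 2 / v y) := by
    intro x
    rw [adjOp_apply, ← Finset.mul_sum]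
    calc ‖∑ y ∈ (hG.finite x).toFinset, f y‖ ^ 2
        ≤ (∑ y ∈ (hG.finite x).toFinset, ‖f y‖) ^ 2 := by
          gcongr; exact norm_sum_le _ _
      _ ≤ (∑ y ∈ (hG.finite x).toFinset, v y) * ∑ y ∈ (hG.finite x).toFinset, ‖f y‖ ^ 2 / v y := by
          refine Finset.sum_sq_le_sum_mul_sum_of_sq_le_mul _ (fun y _ => (hv y).le)
            (fun y _ => div_nonneg (by positivity) (hv y).le) fun y _ => ?_
          rw [mul_div_cancel₀ _ (hv y).ne']
      _ ≤ _ := mul_le_mul_of_nonneg_right (h x)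
          (Finset.sum_nonneg fun y _ => div_nonneg (by positivity) (hv y).le)
  have h2 : ∑' x, ‖adjOp G hG f x‖ₑ ^ 2 ≤ ∑' y, ENNReal.ofReal (L ^ 2) * ‖f y‖ₑ ^ 2 := by
    calc ∑' x, ‖adjOp G hG f x‖ₑ ^ 2
        ≤ ∑' x, ∑' y, (if G.Adj x y then ENNReal.ofReal (L * v x * (‖f y‖ ^ 2 / v y)) else 0) := by
          refine ENNReal.tsum_le_tsum fun x => ?_
          rw [← ofReal_norm, ← ENNReal.ofReal_pow (norm_nonneg _)]
          refine (ENNReal.ofReal_le_ofReal (h1 x)).trans ?_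
          rw [ENNReal.ofReal_sum_of_nonneg fun y _ => mul_nonneg (mul_nonneg hL (hv x).le)
            (div_nonneg (by positivity) (hv y).le), tsum_eq_sum (s := (hG.finite x).toFinset)]
          · refine Finset.sum_le_sum fun y hy => ?_
            rw [Set.Finite.mem_toFinset, SimpleGraph.mem_neighborSet] at hy
            rw [if_pos hy]
          · intro y hy
            rw [Set.Finite.mem_toFinset, SimpleGraph.mem_neighborSet] at hy
            rw [if_neg hy]
      _ = ∑' y, ∑' x, (if G.Adj x y then ENNReal.ofReal (L * v x * (‖f y‖ ^ 2 / v y)) else 0) :=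
          ENNReal.tsum_comm
      _ ≤ _ := by
          refine ENNReal.tsum_le_tsum fun y => ?_
          rw [tsum_eq_sum (s := (hG.finite y).toFinset)]
          · calc ∑ x ∈ (hG.finite y).toFinset,
                  (if G.Adj x y then ENNReal.ofReal (L * v x * (‖f y‖ ^ 2 / v y)) else 0)
                ≤ ∑ x ∈ (hG.finite y).toFinset, ENNReal.ofReal (L * v x * (‖f y‖ ^ 2 / v y)) :=
                  Finset.sum_le_sum fun x _ => by split_ifs <;> simp
              _ = ENNReal.ofReal (∑ x ∈ (hG.finite y).toFinset, L * v x * (‖f y‖ ^ 2 / v y)) :=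
                  (ENNReal.ofReal_sum_of_nonneg fun x _ => mul_nonneg (mul_nonneg hL (hv x).le)
                    (div_nonneg (by positivity) (hv y).le)).symm
              _ ≤ ENNReal.ofReal (L ^ 2 * ‖f y‖ ^ 2) := by
                  apply ENNReal.ofReal_le_ofReal
                  rw [← Finset.sum_mul, ← Finset.mul_sum]
                  calc L * (∑ x ∈ (hG.finite y).toFinset, v x) * (‖f y‖ ^ 2 / v y)
                      ≤ L * (L * v y) * (‖f y‖ ^ 2 / v y) := by
                        have := h y
                        have := (hv y).le
                        gcongr
                    _ = L ^ 2 * ‖f y‖ ^ 2 := by have := (hv y).ne'; field_simp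
              _ = _ := by
                  rw [ENNReal.ofReal_mul (by positivity), ENNReal.ofReal_pow (norm_nonneg _),
                    ofReal_norm]
          · intro x hx
            rw [Set.Finite.mem_toFinset, SimpleGraph.mem_neighborSet] at hx
            rw [if_neg fun h => hx h.symm]
  rw [tsum_enorm_sq, ENNReal.tsum_mul_left, tsum_enorm_sq, ← ofReal_norm, ← ofReal_norm,
    ← ENNReal.ofReal_pow (norm_nonneg _), ← ENNReal.ofReal_pow (norm_nonneg _),
    ← ENNReal.ofReal_mul (by positivity), ENNReal.ofReal_le_ofReal_iff (by positivity),
    ← mul_pow] at h2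
  exact le_of_sq_le_sq h2 (by positivity)

/-- A nonnegative square summable subsolution bounds the norm from below. -/
theorem le_norm_adjOp {G : SimpleGraph V} (hG : BoundedDegree G) {u : V → ℝ} (hu : ∀ x, 0 ≤ u x)
    (hu2 : Summable fun x => u x ^ 2) {x₀ : V} (hx₀ : u x₀ ≠ 0) {L : ℝ} (hL : 0 ≤ L)
    (h : ∀ x, L * u x ≤ ∑ y ∈ (hG.finite x).toFinset, u y) : L ≤ ‖adjOp G hG‖ := by
  let f : Ell2 V := ⟨fun x => (u x : ℂ), memlp_two_of_summable (by simpa using hu2)⟩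
  have hf : ∀ x, f x = (u x : ℂ) := fun _ => rfl
  have hf0 : 0 < ‖f‖ := by
    rw [norm_pos_iff]
    intro h0
    apply hx₀
    have h3 := hf x₀
    rw [h0] at h3
    have h4 : (u x₀ : ℂ) = 0 := h3.symm
    exact_mod_cast h4
  have h1 : (L * ‖f‖) ^ 2 ≤ ‖adjOp G hG f‖ ^ 2 := by
    rw [mul_pow, norm_sq_eq_tsum, norm_sq_eq_tsum, ← tsum_mul_left]
    refine Summable.tsum_le_tsum (fun x => ?_) ((summable_norm_sq f).mul_left _)
      (summable_norm_sq _)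
    rw [adjOp_apply, ← mul_pow]
    refine pow_le_pow_left₀ (by positivity) ?_ 2
    simp only [hf]
    rw [← Complex.ofReal_sum, Complex.norm_of_nonneg (hu x),
      Complex.norm_of_nonneg (Finset.sum_nonneg fun y _ => hu y)]
    exact h x
  have h2 := (le_of_sq_le_sq h1 (norm_nonneg _)).trans ((adjOp G hG).le_opNorm f)
  exact le_of_mul_le_mul_right h2 hf0

end Adjacency

/-! ### Sums over neighbours -/

section Neighbours

theorem sum_combProduct {V W M : Type*} [AddCommMonoid M] [DecidableEq W] {G : SimpleGraph V}
    {H : SimpleGraph W} {o : W} {a : V} {b : W} {s : Finset (V × W)} {t : Finset W} {u : Finset V}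
    (hs : ∀ p, p ∈ s ↔ (combProduct G H o).Adj (a, b) p) (ht : ∀ c, c ∈ t ↔ H.Adj b c)
    (hu : ∀ c, c ∈ u ↔ G.Adj a c) (f : V × W → M) :
    ∑ p ∈ s, f p = ∑ c ∈ t, f (a, c) + if b = o then ∑ c ∈ u, f (c, o) else 0 := by
  classical
  have h1 : s = t.map (Function.Embedding.sectR a W)
      ∪ (if b = o then u.map (Function.Embedding.sectL V o) else ∅) := by
    ext ⟨x, y⟩
    rw [hs]
    simp only [combProduct, Finset.mem_union, Finset.mem_map, Function.Embedding.sectR_apply,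
      Prod.mk.injEq]
    constructor
    · rintro (⟨rfl, h⟩ | ⟨rfl, rfl, h⟩)
      · exact Or.inl ⟨y, (ht y).2 h, rfl, rfl⟩
      · right
        rw [if_pos rfl, Finset.mem_map]
        exact ⟨x, (hu x).2 h, rfl⟩
    · rintro (⟨c, hc, rfl, rfl⟩ | h)
      · exact Or.inl ⟨rfl, (ht c).1 hc⟩
      · split_ifs at h with hb
        · obtain ⟨c, hc, hc2⟩ := Finset.mem_map.1 h
          simp only [Function.Embedding.sectL_apply, Prod.mk.injEq] at hc2
          obtain ⟨rfl, rfl⟩ := hc2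
          exact Or.inr ⟨hb, rfl, (hu c).1 hc⟩
        · simp at h
  rw [h1, Finset.sum_union, Finset.sum_map]
  · split_ifs <;> simp
  · rw [Finset.disjoint_left]
    intro p hp hp2
    obtain ⟨c, hc, rfl⟩ := Finset.mem_map.1 hp
    split_ifs at hp2 with hb
    · obtain ⟨c', hc', h'⟩ := Finset.mem_map.1 hp2
      simp only [Function.Embedding.sectL_apply, Function.Embedding.sectR_apply,
        Prod.mk.injEq] at h'
      exact G.loopless.irrefl _ (h'.1 ▸ (hu c').1 hc')
    · simp at hp2

theorem sum_gridGraph {R M : Type*} [CommRing R] [AddCommMonoid M] (h1 : (1 : R) ≠ 0)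
    (h2 : (1 : R) ≠ -1) {d : ℕ} {x : Fin d → R} {s : Finset (Fin d → R)}
    (hs : ∀ y, y ∈ s ↔ (gridGraph R d).Adj x y) (f : (Fin d → R) → M) :
    ∑ y ∈ s, f y = ∑ l, (f (x + Pi.single l 1) + f (x - Pi.single l 1)) := by
  classical
  have e1 : ∑ l, (f (x + Pi.single l 1) + f (x - Pi.single l 1))
      = ∑ p : Fin d × Bool, f (x + if p.2 then Pi.single p.1 1 else -Pi.single p.1 1) := by
    rw [Fintype.sum_prod_type]
    refine Finset.sum_congr rfl fun l _ => ?_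
    simp [sub_eq_add_neg]
  rw [e1]
  symm
  refine Finset.sum_bij (fun p _ => x + if p.2 then Pi.single p.1 1 else -Pi.single p.1 1) ?_ ?_ ?_
    (fun _ _ => rfl)
  · rintro ⟨l, b⟩ -
    rw [hs]
    refine ⟨fun h => ?_, l, ?_, fun k hk => ?_⟩
    · have := congrFun h l
      cases b <;> simp [h1] at this
    · cases b <;> simp
    · cases b <;> simp [hk]
  · rintro ⟨l, b⟩ - ⟨l', b'⟩ - h
    have h3 := add_left_cancel h
    have hl : l = l' := by
      by_contra hne
      have := congrFun h3 l
      cases b <;> cases b' <;> simp [hne, h1] at this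
    subst hl
    have := congrFun h3 l
    cases b <;> cases b'
    · rfl
    · exact absurd (by simpa using this.symm) h2
    · exact absurd (by simpa using this) h2
    · rfl
  · intro y hy
    obtain ⟨-, l, h3, h4⟩ := (hs y).1 hy
    rcases h3 with h3 | h3
    · refine ⟨(l, false), Finset.mem_univ _, ?_⟩
      ext k
      by_cases hk : k = l
      · subst hk; simp [← h3]
      · simp [hk, h4 k hk]
    · refine ⟨(l, true), Finset.mem_univ _, ?_⟩
      ext k
      by_cases hk : k = l
      · subst hk; simp [← h3]
      · simp [hk, h4 k hk]

theorem sum_chainGraph {M : Type*} [AddCommMonoid M] {i : ℤ} {s : Finset ℤ}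
    (hs : ∀ y, y ∈ s ↔ chainGraph.Adj i y) (f : ℤ → M) :
    ∑ y ∈ s, f y = f (i - 1) + f (i + 1) := by
  have : s = {i - 1, i + 1} := by
    ext y
    rw [hs]
    simp only [chainGraph, Finset.mem_insert, Finset.mem_singleton]
    omega
  rw [this, Finset.sum_pair (by omega)]

theorem sum_combGraph {M : Type*} [AddCommMonoid M] {d : ℕ} (p : CombVertex d)
    (f : CombVertex d → M) :
    ∑ y ∈ ((combGraph_bounded d).finite p).toFinset, f y
      = f (p.1, p.2 - 1) + f (p.1, p.2 + 1)
        + if p.2 = 0 then ∑ l, (f (p.1 + Pi.single l 1, 0) + f (p.1 - Pi.single l 1, 0))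
          else 0 := by
  obtain ⟨a, b⟩ := p
  rw [sum_combProduct (G := gridGraph ℤ d) (H := chainGraph) (o := 0) (a := a) (b := b)
    (t := (chainGraph_bounded.finite b).toFinset)
    (u := ((gridGraph_bounded d).finite a).toFinset) (by simp [combGraph]) (by simp) (by simp),
    sum_chainGraph (i := b) (by simp), sum_gridGraph (by simp) (by decide) (x := a) (by simp)]

theorem chainAdj_apply (f : Ell2 ℤ) (i : ℤ) : chainAdj f i = f (i - 1) + f (i + 1) := by
  rw [chainAdj, adjOp_apply, sum_chainGraph (i := i) (by simp)]

theorem combAdj_apply {d : ℕ} (f : Ell2 (CombVertex d)) (p : CombVertex d) :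
    combAdj d f p = f (p.1, p.2 - 1) + f (p.1, p.2 + 1)
        + if p.2 = 0 then ∑ l, (f (p.1 + Pi.single l 1, 0) + f (p.1 - Pi.single l 1, 0))
          else 0 := by
  rw [combAdj, adjOp_apply, sum_combGraph]

end Neighbours


/-! ### Summability on lattices -/

section Lattice

theorem summable_prod_pi {g : ℤ → ℝ} (hg0 : ∀ a, 0 ≤ g a) (hg : Summable g) (d : ℕ) :
    Summable fun j : Fin d → ℤ => ∏ l, g (j l) := by
  induction d with
  | zero => exact Summable.of_finite
  | succ d ih =>
    rw [← (Fin.consEquiv (fun _ : Fin (d + 1) => ℤ)).summable_iff]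
    have := hg.mul_of_nonneg ih hg0 fun j => Finset.prod_nonneg fun l _ => hg0 _
    refine this.congr fun p => ?_
    simp [Fin.prod_univ_succ, Fin.consEquiv]

theorem summable_inv_one_add_norm_pow (d : ℕ) :
    Summable fun j : Fin d → ℤ => ((1 + ‖j‖) ^ (2 * d))⁻¹ := by
  have h1 : Summable fun a : ℤ => ((1 + ‖a‖) ^ 2)⁻¹ := by
    have h : Summable fun n : ℕ => ((1 + (n : ℝ)) ^ 2)⁻¹ := by
      have := (summable_nat_add_iff 1).2 (Real.summable_nat_pow_inv.2 (show 1 < 2 by norm_num))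
      simpa [add_comm] using this
    refine Summable.of_nat_of_neg ?_ ?_ <;> simpa using h
  refine (summable_prod_pi (fun a => by positivity) h1 d).of_nonneg_of_le
    (fun j => by positivity) fun j => ?_
  rw [Finset.prod_inv_distrib]
  refine inv_anti₀ (Finset.prod_pos fun l _ => by positivity) ?_
  calc ∏ l, (1 + ‖j l‖) ^ 2 ≤ ∏ _l : Fin d, (1 + ‖j‖) ^ 2 :=
        Finset.prod_le_prod (fun l _ => by positivity) fun l _ => by
          gcongr; exact norm_le_pi_norm j l
    _ = (1 + ‖j‖) ^ (2 * d) := by simp [pow_mul]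

end Lattice

/-! ### The norm of the comb and its Perron–Frobenius vector -/

section CombNorm

/-- The value `2√(d² + 1)` of the norm of the adjacency operator of `ℤ^d ⊣ ℤ`. -/
noncomputable def combTop (d : ℕ) : ℝ := 2 * √((d : ℝ) ^ 2 + 1)

/-- The decay rate `√(d² + 1) - d` of the Perron–Frobenius vector along the fibres. -/
noncomputable def combRate (d : ℕ) : ℝ := √((d : ℝ) ^ 2 + 1) - d

theorem combRate_pos (d : ℕ) : 0 < combRate d :=
  sub_pos.2 (Real.lt_sqrt_of_sq_lt (by linarith))

theorem combRate_lt_one {d : ℕ} (hd : 1 ≤ d) : combRate d < 1 := by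
  have : (1 : ℝ) ≤ d := by exact_mod_cast hd
  rw [combRate, sub_lt_iff_lt_add, Real.sqrt_lt' (by positivity)]
  nlinarith

theorem two_lt_combTop {d : ℕ} (hd : 1 ≤ d) : 2 < combTop d := by
  have : (1 : ℝ) ≤ d := by exact_mod_cast hd
  have h : 1 < √((d : ℝ) ^ 2 + 1) := Real.lt_sqrt_of_sq_lt (by nlinarith)
  rw [combTop]
  linarith

theorem one_add_combRate_sq (d : ℕ) : 1 + combRate d ^ 2 = combTop d * combRate d := by
  have h : √((d : ℝ) ^ 2 + 1) ^ 2 = (d : ℝ) ^ 2 + 1 := Real.sq_sqrt (by positivity)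
  rw [combRate, combTop]
  linear_combination -h

/-- The function `q^{|i|}` satisfies the eigenvalue equation of `ℤ` away from the origin, where the
defect `2d` is the one that the `2d` neighbours in the base make up for. -/
theorem combRate_pow_natAbs_add (d : ℕ) (i : ℤ) :
    combRate d ^ (i - 1).natAbs + combRate d ^ (i + 1).natAbs
      = combTop d * combRate d ^ i.natAbs - if i = 0 then 2 * (d : ℝ) else 0 := by
  have h := one_add_combRate_sq d
  have key : ∀ n : ℕ, combRate d ^ n + combRate d ^ (n + 2) = combTop d * combRate d ^ (n + 1) := by
    intro n
    linear_combination combRate d ^ n * h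
  split_ifs with hi
  · subst hi
    simp only [zero_sub, zero_add, Int.natAbs_neg, Int.natAbs_one, pow_one, Int.natAbs_zero,
      pow_zero]
    rw [combRate, combTop]
    ring
  · rw [sub_zero]
    rcases lt_or_gt_of_ne hi with hi | hi
    · obtain ⟨n, hn⟩ : ∃ n : ℕ, i = -(n + 1 : ℕ) := ⟨(-i - 1).toNat, by omega⟩
      rw [show (i - 1).natAbs = n + 2 by omega, show (i + 1).natAbs = n by omega,
        show i.natAbs = n + 1 by omega, add_comm, key]
    · obtain ⟨n, hn⟩ : ∃ n : ℕ, i = (n + 1 : ℕ) := ⟨(i - 1).toNat, by omega⟩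
      rw [show (i - 1).natAbs = n by omega, show (i + 1).natAbs = n + 2 by omega,
        show i.natAbs = n + 1 by omega, key]

theorem summable_combRate_pow_natAbs {d : ℕ} (hd : 1 ≤ d) :
    Summable fun i : ℤ => (combRate d ^ i.natAbs) ^ 2 := by
  have h : Summable fun n : ℕ => (combRate d ^ n) ^ 2 := by
    have := summable_geometric_of_lt_one (sq_nonneg (combRate d))
      (pow_lt_one₀ (combRate_pos d).le (combRate_lt_one hd) two_ne_zero)
    refine this.congr fun n => ?_
    rw [← pow_mul, ← pow_mul, mul_comm]
  refine Summable.of_nat_of_neg ?_ ?_ <;> simpa using h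

theorem norm_combAdj_le {d : ℕ} : ‖combAdj d‖ ≤ combTop d := by
  refine norm_adjOp_le (v := fun p : CombVertex d => combRate d ^ p.2.natAbs) _
    (fun p => pow_pos (combRate_pos d) _) (by unfold combTop; positivity) fun p => ?_
  rw [sum_combGraph]
  simp only [combRate_pow_natAbs_add]
  split_ifs with h
  · simp; linarith
  · simp

theorem norm_le_norm_add_single_add_one {d : ℕ} (j e : Fin d → ℤ) (he : ‖e‖ ≤ 1) :
    ‖j + e‖ ≤ ‖j‖ + 1 :=
  (norm_add_le _ _).trans (by linarith)

/-- The test functions `(R + ‖j‖)^{-d} q^{|i|}` are almost eigenfunctions for large `R`. -/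
theorem combTop_mul_le_norm_combAdj {d : ℕ} (hd : 1 ≤ d) {R : ℝ} (hR : 1 ≤ R) :
    (R / (R + 1)) ^ d * combTop d ≤ ‖combAdj d‖ := by
  have hR0 : 0 < R := by linarith
  have hq := combRate_pos d
  set b : (Fin d → ℤ) → ℝ := fun j => ((R + ‖j‖) ^ d)⁻¹ with hb
  have hb0 : ∀ j, 0 < b j := fun j => by positivity
  have hstep : ∀ j e : Fin d → ℤ, ‖e‖ ≤ 1 → (R / (R + 1)) ^ d * b j ≤ b (j + e) := by
    intro j e he
    have h1 : ‖j + e‖ ≤ ‖j‖ + 1 := norm_le_norm_add_single_add_one j e he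
    simp only [hb]
    rw [div_pow, div_mul_eq_mul_div, ← div_eq_mul_inv, div_div, div_le_iff₀ (by positivity),
      inv_mul_eq_div, le_div_iff₀ (by positivity), ← mul_pow, ← mul_pow]
    refine pow_le_pow_left₀ (by positivity) ?_ d
    nlinarith [norm_nonneg j]
  have hsingle : ∀ l : Fin d, ‖(Pi.single l 1 : Fin d → ℤ)‖ ≤ 1 := fun l => by
    rw [pi_norm_le_iff_of_nonneg zero_le_one]
    intro k
    by_cases hk : k = l
    · subst hk; simp
    · simp [hk]
  have hratio : (R / (R + 1)) ^ d ≤ 1 :=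
    pow_le_one₀ (by positivity) ((div_le_one (by positivity)).2 (by linarith))
  refine le_norm_adjOp (u := fun p : CombVertex d => b p.1 * combRate d ^ p.2.natAbs) _
    (fun p => by have := hb0 p.1; positivity) ?_ (x₀ := 0) ?_
    (by unfold combTop; positivity) fun p => ?_
  · have h1 : Summable fun j => b j ^ 2 := by
      refine (summable_inv_one_add_norm_pow d).of_nonneg_of_le (fun j => by positivity) fun j => ?_
      simp only [hb]
      rw [inv_pow, ← pow_mul, mul_comm d 2]
      gcongr
    have := h1.mul_of_nonneg (summable_combRate_pow_natAbs hd) (fun j => by positivity)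
      fun i => by positivity
    refine this.congr fun p => ?_
    rw [mul_pow]
  · have := hb0 0
    simp [this.ne']
  · rw [sum_combGraph, ← mul_add, combRate_pow_natAbs_add]
    have hbp := hb0 p.1
    split_ifs with h
    · rw [h]
      simp only [Int.natAbs_zero, pow_zero, mul_one]
      have h2 : ∑ _l : Fin d, 2 * ((R / (R + 1)) ^ d * b p.1)
          ≤ ∑ l, (b (p.1 + Pi.single l 1) + b (p.1 - Pi.single l 1)) := by
        refine Finset.sum_le_sum fun l _ => ?_
        have h3 := hstep p.1 (Pi.single l 1) (hsingle l)
        have h4 := hstep p.1 (-Pi.single l 1) (by rw [norm_neg]; exact hsingle l)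
        rw [← sub_eq_add_neg] at h4
        linarith
      rw [Finset.sum_const, Finset.card_univ, Fintype.card_fin, nsmul_eq_mul] at h2
      have h5 : 2 * (d : ℝ) ≤ combTop d := by
        have := combRate_pos d
        rw [combRate] at this
        rw [combTop]; linarith
      nlinarith [mul_nonneg (mul_nonneg (sub_nonneg.2 hratio) hbp.le) (sub_nonneg.2 h5)]
    · rw [add_zero, sub_zero]
      have : 0 ≤ b p.1 * (combTop d * combRate d ^ p.2.natAbs) := by
        have := two_lt_combTop hd
        positivity
      nlinarith [mul_nonneg (sub_nonneg.2 hratio) this]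

theorem norm_combAdj {d : ℕ} (hd : 1 ≤ d) : ‖combAdj d‖ = combTop d := by
  refine le_antisymm norm_combAdj_le ?_
  have h1 : Tendsto (fun R : ℝ => R / (R + 1)) atTop (𝓝 1) := by
    have h2 : Tendsto (fun R : ℝ => 1 - (R + 1)⁻¹) atTop (𝓝 (1 - 0)) :=
      tendsto_const_nhds.sub
        (tendsto_inv_atTop_zero.comp (tendsto_atTop_add_const_right _ _ tendsto_id))
    rw [sub_zero] at h2
    refine h2.congr' ?_
    filter_upwards [eventually_ge_atTop 1] with R hR
    field_simp
    ring
  have h3 : Tendsto (fun R : ℝ => (R / (R + 1)) ^ d * combTop d) atTop (𝓝 (1 ^ d * combTop d)) :=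
    (h1.pow d).mul_const _
  rw [one_pow, one_mul] at h3
  refine le_of_tendsto h3 ?_
  filter_upwards [eventually_ge_atTop 1] with R hR
  exact combTop_mul_le_norm_combAdj hd hR

theorem norm_chainAdj_le : ‖chainAdj‖ ≤ 2 := by
  refine norm_adjOp_le (v := fun _ => 1) _ (fun _ => one_pos) zero_le_two fun i => ?_
  rw [sum_chainGraph (i := i) (by simp)]
  norm_num

theorem re_inner_le_of_norm_le {E : Type*} [NormedAddCommGroup E] [InnerProductSpace ℂ E]
    {T : E →L[ℂ] E} {C : ℝ} (hT : ‖T‖ ≤ C) (x : E) : (inner ℂ x (T x)).re ≤ C * ‖x‖ ^ 2 :=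
  calc (inner ℂ x (T x)).re ≤ ‖x‖ * ‖T x‖ := (Complex.re_le_norm _).trans (norm_inner_le_norm _ _)
    _ ≤ ‖x‖ * (C * ‖x‖) := by gcongr; exact T.le_of_opNorm_le hT x
    _ = _ := by ring

theorem re_inner_smul_one_sub {E : Type*} [NormedAddCommGroup E] [InnerProductSpace ℂ E]
    {T : E →L[ℂ] E} {C : ℝ} (hT : ∀ x, (inner ℂ x (T x)).re ≤ C * ‖x‖ ^ 2) (c : ℝ) (x : E) :
    (c - C) * ‖x‖ ^ 2 ≤ (inner ℂ x (((c : ℂ) • (1 : E →L[ℂ] E) - T) x)).re := by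
  have h1 : (inner ℂ x x : ℂ) = ((‖x‖ ^ 2 : ℝ) : ℂ) := by
    rw [inner_self_eq_norm_sq_to_K]; norm_cast
  have h2 := hT x
  rw [sub_apply, smul_apply, one_apply_eq_self, inner_sub_right,
    inner_smul_right, h1, Complex.sub_re, ← Complex.ofReal_mul, Complex.ofReal_re]
  linarith

/-- The vector `i ↦ q^{|i|}` of `ℓ²(ℤ)`. -/
noncomputable def expVec {d : ℕ} (hd : 1 ≤ d) : Ell2 ℤ :=
  ⟨fun i => ((combRate d ^ i.natAbs : ℝ) : ℂ), memlp_two_of_summable <| by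
    refine (summable_combRate_pow_natAbs hd).congr fun i => ?_
    rw [Complex.norm_of_nonneg (pow_nonneg (combRate_pos d).le _)]⟩

theorem expVec_apply {d : ℕ} (hd : 1 ≤ d) (i : ℤ) :
    expVec hd i = ((combRate d ^ i.natAbs : ℝ) : ℂ) := rfl

theorem chainAdj_expVec {d : ℕ} (hd : 1 ≤ d) :
    chainAdj (expVec hd) = (combTop d : ℂ) • expVec hd - (2 * d : ℂ) • delta 0 := by
  ext i
  rw [chainAdj_apply]
  simp only [lp.coeFn_sub, lp.coeFn_smul, Pi.sub_apply, Pi.smul_apply, expVec_apply, delta_apply,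
    smul_eq_mul]
  rw [← Complex.ofReal_add, combRate_pow_natAbs_add]
  split_ifs <;> push_cast <;> ring

theorem resolvent_eq_inverse {E : Type*} [NormedAddCommGroup E] [InnerProductSpace ℂ E]
    (T : E →L[ℂ] E) (c : ℂ) : resolvent T c = Ring.inverse (c • 1 - T) := by
  rw [resolvent, Algebra.algebraMap_eq_smul_one]

theorem inverse_apply_eq_of_apply_eq {E : Type*} [NormedAddCommGroup E] [InnerProductSpace ℂ E]
    {T : E →L[ℂ] E} (hT : IsUnit T) {x y : E} (h : T x = y) : Ring.inverse T y = x := by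
  rw [← h, ← mul_apply_eq_comp, Ring.inverse_mul_cancel _ hT]
  rfl

theorem apply_inverse_apply {E : Type*} [NormedAddCommGroup E] [InnerProductSpace ℂ E]
    {T : E →L[ℂ] E} (hT : IsUnit T) (x : E) : T (Ring.inverse T x) = x := by
  rw [← mul_apply_eq_comp, Ring.mul_inverse_cancel _ hT]
  rfl

theorem isUnit_smul_one_sub_chainAdj {c : ℝ} (hc : 2 < c) :
    IsUnit ((c : ℂ) • (1 : Ell2 ℤ →L[ℂ] Ell2 ℤ) - chainAdj) :=
  isUnit_of_le_re_inner (sub_pos.2 hc)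
    (re_inner_smul_one_sub (re_inner_le_of_norm_le norm_chainAdj_le) c)

theorem fibreResolvent_eq {d : ℕ} (hd : 1 ≤ d) :
    fibreResolvent d = (2 * d : ℂ)⁻¹ • expVec hd := by
  have hd0 : (2 * d : ℂ) ≠ 0 := by
    have : (d : ℂ) ≠ 0 := by exact_mod_cast (by omega : d ≠ 0)
    simp [this]
  rw [fibreResolvent, norm_combAdj hd, resolvent_eq_inverse]
  refine inverse_apply_eq_of_apply_eq (isUnit_smul_one_sub_chainAdj (two_lt_combTop hd)) ?_
  rw [map_smul, sub_apply, smul_apply, one_apply_eq_self, chainAdj_expVec,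
    sub_sub_cancel, smul_smul, inv_mul_cancel₀ hd0, one_smul]

theorem norm_expVec_pos {d : ℕ} (hd : 1 ≤ d) : 0 < ‖expVec hd‖ := by
  rw [norm_pos_iff]
  intro h
  have := expVec_apply hd 0
  rw [h] at this
  simp at this

/-- The normalized ground state in `ℓ²(ℤ)`. -/
noncomputable def fibreGround {d : ℕ} (hd : 1 ≤ d) : Ell2 ℤ := (‖expVec hd‖ : ℂ)⁻¹ • expVec hd

theorem norm_fibreGround {d : ℕ} (hd : 1 ≤ d) : ‖fibreGround hd‖ = 1 := by
  rw [fibreGround, norm_smul, norm_inv, Complex.norm_of_nonneg (norm_nonneg _),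
    inv_mul_cancel₀ (norm_expVec_pos hd).ne']

theorem groundState_eq {d : ℕ} (hd : 1 ≤ d) (x : CombVertex d) :
    groundState d x = fibreGround hd x.2 := by
  have hd0 : (2 * d : ℂ) ≠ 0 := by
    have : (d : ℂ) ≠ 0 := by exact_mod_cast (by omega : d ≠ 0)
    simp [this]
  have h : ((‖(2 * d : ℂ)⁻¹‖ : ℝ) : ℂ) = (2 * d : ℂ)⁻¹ := by
    rw [norm_inv]
    simp
  rw [groundState, fibreResolvent_eq hd, norm_smul, Complex.ofReal_mul, h, fibreGround]
  simp only [lp.coeFn_smul, Pi.smul_apply, smul_eq_mul]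
  rw [mul_inv, mul_comm (2 * (d : ℂ))⁻¹⁻¹, mul_assoc, inv_mul_cancel_left₀ (inv_ne_zero hd0)]

theorem fibreGround_apply {d : ℕ} (hd : 1 ≤ d) (i : ℤ) :
    fibreGround hd i = ((‖expVec hd‖⁻¹ * combRate d ^ i.natAbs : ℝ) : ℂ) := by
  rw [fibreGround]
  simp only [lp.coeFn_smul, Pi.smul_apply, smul_eq_mul, expVec_apply]
  push_cast
  rfl

theorem isGeneralizedPF_groundState {d : ℕ} (hd : 1 ≤ d) :
    IsGeneralizedPF (combGraph d) (combGraph_bounded d) (groundState d) := by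
  have hpos := norm_expVec_pos hd
  have hq := combRate_pos d
  refine ⟨fun x => ⟨_, by positivity, (groundState_eq hd x).trans (fibreGround_apply hd x.2)⟩,
    fun x => ?_⟩
  change _ = (‖combAdj d‖ : ℂ) * _
  rw [norm_combAdj hd, sum_combGraph]
  simp only [groundState_eq hd, fibreGround_apply]
  have h := combRate_pow_natAbs_add d x.2
  rw [← Complex.ofReal_add, ← mul_add, h]
  split_ifs with h0
  · rw [h0]
    push_cast
    simp
    ring
  · push_cast
    ring

end CombNorm


/-! ### Characters of the torus -/

section Characters

variable {d n : ℕ}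

/-- The character `j ↦ exp(2πi k·j / (2n+1))` of the torus. -/
noncomputable def torusChar (k j : Fin d → ZMod (2 * n + 1)) : ℂ := ZMod.stdAddChar (k ⬝ᵥ j)

theorem torusChar_add (k j j' : Fin d → ZMod (2 * n + 1)) :
    torusChar k (j + j') = torusChar k j * torusChar k j' := by
  rw [torusChar, dotProduct_add, AddChar.map_add_eq_mul]; rfl

theorem torusChar_comm (k j : Fin d → ZMod (2 * n + 1)) : torusChar k j = torusChar j k := by
  rw [torusChar, torusChar, dotProduct_comm]

theorem norm_torusChar (k j : Fin d → ZMod (2 * n + 1)) : ‖torusChar k j‖ = 1 := by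
  rw [torusChar, ZMod.stdAddChar_apply, Circle.norm_coe]

theorem conj_torusChar (k j : Fin d → ZMod (2 * n + 1)) :
    conj (torusChar k j) = torusChar k (-j) := by
  rw [torusChar, torusChar, dotProduct_neg, AddChar.map_neg_eq_conj]

theorem torusChar_zero_left (j : Fin d → ZMod (2 * n + 1)) : torusChar 0 j = 1 := by
  rw [torusChar, zero_dotProduct, AddChar.map_zero_eq_one]

theorem torusChar_single (k : Fin d → ZMod (2 * n + 1)) (l : Fin d) :
    torusChar k (Pi.single l 1) = ZMod.stdAddChar (k l) := by
  rw [torusChar, dotProduct_single, mul_one]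

theorem torusChar_mul_conj (k j : Fin d → ZMod (2 * n + 1)) :
    torusChar k j * conj (torusChar k j) = 1 := by
  rw [Complex.mul_conj, Complex.normSq_eq_norm_sq, norm_torusChar]; simp

theorem sum_torusChar (j : Fin d → ZMod (2 * n + 1)) :
    ∑ k, torusChar k j = if j = 0 then ((2 * n + 1 : ℕ) : ℂ) ^ d else 0 := by
  classical
  let ψ : AddChar (Fin d → ZMod (2 * n + 1)) ℂ :=
    { toFun := fun k => torusChar k j
      map_zero_eq_one' := torusChar_zero_left j
      map_add_eq_mul' := fun a b => by
        rw [torusChar_comm, torusChar_add, torusChar_comm, torusChar_comm j b] }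
  have h := AddChar.sum_eq_ite ψ
  have h0 : ψ = 0 ↔ j = 0 := by
    constructor
    · intro h
      ext l
      have h1 : torusChar (Pi.single l 1) j = 1 := DFunLike.congr_fun h (Pi.single l 1)
      rw [torusChar_comm, torusChar_single,
        ← AddChar.map_zero_eq_one (ZMod.stdAddChar (N := 2 * n + 1))] at h1
      exact ZMod.injective_stdAddChar h1
    · rintro rfl
      ext k
      change torusChar k 0 = 1
      rw [torusChar_comm, torusChar_zero_left]
  change ∑ k, ψ k = _
  rw [h]
  simp only [h0]
  congr 1
  simp

/-- The eigenvalue of the adjacency operator of the torus on the character with frequency `k`. -/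
noncomputable def torusEigenvalue (k : Fin d → ZMod (2 * n + 1)) : ℝ :=
  ∑ l, 2 * (ZMod.stdAddChar (k l) : ℂ).re

theorem sum_torusChar_neighbours (k j : Fin d → ZMod (2 * n + 1)) :
    ∑ l, (torusChar k (j + Pi.single l 1) + torusChar k (j - Pi.single l 1))
      = (torusEigenvalue k : ℂ) * torusChar k j := by
  rw [torusEigenvalue, Complex.ofReal_sum, Finset.sum_mul]
  refine Finset.sum_congr rfl fun l _ => ?_
  rw [sub_eq_add_neg, torusChar_add, torusChar_add, ← conj_torusChar, torusChar_single, ← mul_add,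
    Complex.add_conj, mul_comm]

/-- The gap `2d - θ(k)` between the top of the spectrum of the torus and the eigenvalue `θ(k)`. -/
noncomputable def torusGap (k : Fin d → ZMod (2 * n + 1)) : ℝ := 2 * d - torusEigenvalue k

theorem torusGap_eq_sum (k : Fin d → ZMod (2 * n + 1)) :
    torusGap k = ∑ l, 2 * (1 - (ZMod.stdAddChar (k l) : ℂ).re) := by
  simp only [torusGap, torusEigenvalue, mul_sub, Finset.sum_sub_distrib]
  simp [mul_comm]

theorem abs_re_stdAddChar_le (a : ZMod (2 * n + 1)) : |(ZMod.stdAddChar a : ℂ).re| ≤ 1 := by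
  refine (Complex.abs_re_le_norm _).trans ?_
  rw [ZMod.stdAddChar_apply, Circle.norm_coe]

theorem torusGap_nonneg (k : Fin d → ZMod (2 * n + 1)) : 0 ≤ torusGap k := by
  rw [torusGap_eq_sum]
  exact Finset.sum_nonneg fun l _ => by have := (abs_le.1 (abs_re_stdAddChar_le (k l))).2; linarith

theorem torusGap_le (k : Fin d → ZMod (2 * n + 1)) : torusGap k ≤ 4 * d := by
  rw [torusGap_eq_sum]
  calc ∑ l, 2 * (1 - (ZMod.stdAddChar (k l) : ℂ).re) ≤ ∑ _l : Fin d, (4 : ℝ) :=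
        Finset.sum_le_sum fun l _ => by
          have := (abs_le.1 (abs_re_stdAddChar_le (k l))).1; linarith
    _ = 4 * d := by simp [mul_comm]

theorem torusEigenvalue_zero : torusEigenvalue (0 : Fin d → ZMod (2 * n + 1)) = 2 * d := by
  simp [torusEigenvalue, mul_comm]

/-- Near zero frequency the gap is of the order of the square of the frequency. -/
theorem le_torusGap (k : Fin d → ZMod (2 * n + 1)) (l : Fin d) :
    16 * ((k l).valMinAbs / (2 * n + 1) : ℝ) ^ 2 ≤ torusGap k := by
  have h1 : 2 * (1 - (ZMod.stdAddChar (k l) : ℂ).re) ≤ torusGap k := by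
    rw [torusGap_eq_sum]
    exact Finset.single_le_sum (f := fun l => 2 * (1 - (ZMod.stdAddChar (k l) : ℂ).re))
      (fun l _ => by have := (abs_le.1 (abs_re_stdAddChar_le (k l))).2; linarith)
      (Finset.mem_univ l)
  refine le_trans ?_ h1
  set a : ℤ := (k l).valMinAbs with ha
  have h2 : (ZMod.stdAddChar (k l) : ℂ).re = Real.cos (2 * (Real.pi * a / (2 * n + 1))) := by
    have : k l = ((a : ℤ) : ZMod (2 * n + 1)) := by rw [ha, ZMod.coe_valMinAbs]
    rw [this, ZMod.stdAddChar_coe, ← Complex.exp_ofReal_mul_I_re]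
    congr 2
    push_cast
    ring
  have hb : |(a : ℝ)| ≤ n := by
    have h3 := ZMod.natAbs_valMinAbs_le (k l)
    have h4 : a.natAbs ≤ n := h3.trans (by omega)
    rw [← Int.cast_abs, Int.abs_eq_natAbs]
    exact_mod_cast h4
  set x : ℝ := Real.pi * a / (2 * n + 1) with hx
  have hN : (0 : ℝ) < 2 * n + 1 := by positivity
  have hxa : |x| ≤ Real.pi / 2 := by
    rw [hx, abs_div, abs_mul, abs_of_pos Real.pi_pos, abs_of_pos hN, div_le_iff₀ hN]
    nlinarith [Real.pi_pos]
  have h5 : 2 / Real.pi * |x| ≤ |Real.sin x| := by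
    have := Real.mul_abs_le_abs_sin hxa
    exact this
  have h6 : 2 / Real.pi * |x| = 2 * |(a / (2 * n + 1) : ℝ)| := by
    rw [hx, mul_div_assoc, abs_mul, abs_of_pos Real.pi_pos]
    field_simp
  rw [h2, Real.cos_two_mul]
  have h7 : (2 * |(a / (2 * n + 1) : ℝ)|) ^ 2 ≤ |Real.sin x| ^ 2 :=
    pow_le_pow_left₀ (by positivity) (h6 ▸ h5) 2
  rw [mul_pow, sq_abs, sq_abs] at h7
  nlinarith [Real.sin_sq_add_cos_sq x]

end Characters

/-! ### Sums over neighbours in the finite comb -/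

section FiniteNeighbours

variable {d n : ℕ} {M : Type*} [AddCommMonoid M]

theorem sum_finiteCombGraph_of_notMem {x : CombVertex d} (hx : x ∉ Set.range (finiteEmb d n))
    (f : CombVertex d → M) :
    ∑ y ∈ ((finiteCombGraph_bounded d n).finite x).toFinset, f y = 0 := by
  refine Finset.sum_eq_zero fun y hy => ?_
  rw [Set.Finite.mem_toFinset, SimpleGraph.mem_neighborSet] at hy
  obtain ⟨a, b, -, rfl, -⟩ := (SimpleGraph.map_adj _ _ _ _).1 hy
  exact absurd ⟨a, rfl⟩ hx

theorem sum_finiteCombGraph_eq (p : FiniteCombVertex d n) [DecidableRel (finiteComb d n).Adj]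
    (f : CombVertex d → M) :
    ∑ y ∈ ((finiteCombGraph_bounded d n).finite (finiteEmb d n p)).toFinset, f y
      = ∑ q with (finiteComb d n).Adj p q, f (finiteEmb d n q) := by
  rw [← Finset.sum_map _ (finiteEmb d n) f]
  refine Finset.sum_congr ?_ fun _ _ => rfl
  ext y
  simp only [Set.Finite.mem_toFinset, SimpleGraph.mem_neighborSet, finiteCombGraph,
    SimpleGraph.map_adj, Finset.mem_map, Finset.mem_filter, Finset.mem_univ, true_and]
  constructor
  · rintro ⟨a, b, h, h1, h2⟩
    rw [EmbeddingLike.apply_eq_iff_eq] at h1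
    subst h1
    exact ⟨b, h, h2⟩
  · rintro ⟨b, h, h2⟩
    exact ⟨p, b, h, rfl, h2⟩

theorem sum_chain_induce {i : FiniteChain n} {t : Finset (FiniteChain n)}
    (ht : ∀ c, c ∈ t ↔ (chainGraph.induce (Set.Icc (-(n : ℤ)) (n : ℤ))).Adj i c) (g : ℤ → M)
    (hg : ∀ a, a ∉ Set.Icc (-(n : ℤ)) (n : ℤ) → g a = 0) :
    ∑ c ∈ t, g c = g (i - 1) + g (i + 1) := by
  have h : ∑ c ∈ t, g c = ∑ a ∈ {(i : ℤ) - 1, (i : ℤ) + 1}, g a := by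
    refine (Finset.sum_map t (Function.Embedding.subtype _) g).symm.trans ?_
    refine Finset.sum_subset ?_ fun a ha hat => hg a fun haI => hat ?_
    · intro a ha
      obtain ⟨c, hc, rfl⟩ := Finset.mem_map.1 ha
      have := (ht c).1 hc
      simp only [SimpleGraph.comap_adj, Function.Embedding.subtype_apply, chainGraph] at this
      simp only [Finset.mem_insert, Finset.mem_singleton, Function.Embedding.subtype_apply]
      omega
    · rw [Finset.mem_map]
      refine ⟨⟨a, haI⟩, (ht _).2 ?_, rfl⟩
      simp only [SimpleGraph.comap_adj, Function.Embedding.subtype_apply, chainGraph]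
      simp only [Finset.mem_insert, Finset.mem_singleton] at ha
      omega
  rw [h, Finset.sum_pair (by omega)]

/-- For `n ≥ 1` each base vertex of the torus has `2d` distinct neighbours. -/
theorem sum_finiteCombGraph (hn : 1 ≤ n) (p : FiniteCombVertex d n) (f : CombVertex d → M)
    (g : ℤ → M) (hg : ∀ a, a ∉ Set.Icc (-(n : ℤ)) (n : ℤ) → g a = 0)
    (hfg : ∀ c : FiniteChain n, g c = f (finiteEmb d n (p.1, c))) :
    ∑ y ∈ ((finiteCombGraph_bounded d n).finite (finiteEmb d n p)).toFinset, f y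
      = g (p.2 - 1) + g (p.2 + 1)
        + if (p.2 : ℤ) = 0 then ∑ l, (f (finiteEmb d n (p.1 + Pi.single l 1, chainOrigin n))
            + f (finiteEmb d n (p.1 - Pi.single l 1, chainOrigin n))) else 0 := by
  classical
  obtain ⟨a, b⟩ := p
  have : Fact (1 < 2 * n + 1) := ⟨by omega⟩
  have h2 : (1 : ZMod (2 * n + 1)) ≠ -1 := by
    intro h
    have h3 : ((2 : ℕ) : ZMod (2 * n + 1)) = 0 := by
      push_cast
      linear_combination h
    rw [ZMod.natCast_eq_zero_iff] at h3
    have := Nat.le_of_dvd (by norm_num) h3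
    omega
  have hb : b = chainOrigin n ↔ (b : ℤ) = 0 := by rw [Subtype.ext_iff]; rfl
  rw [sum_finiteCombGraph_eq, sum_combProduct (G := gridGraph (ZMod (2 * n + 1)) d)
    (H := chainGraph.induce (Set.Icc (-(n : ℤ)) (n : ℤ))) (o := chainOrigin n) (a := a) (b := b)
    (t := {c | (chainGraph.induce (Set.Icc (-(n : ℤ)) (n : ℤ))).Adj b c})
    (u := {c | (gridGraph (ZMod (2 * n + 1)) d).Adj a c})
    (fun q => by simp only [Finset.mem_filter, Finset.mem_univ, true_and]; rfl)
    (by simp) (by simp)]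
  rw [sum_gridGraph one_ne_zero h2 (x := a) (by simp)]
  simp only [hb]
  congr 1
  rw [← sum_chain_induce (i := b)
    (t := {c | (chainGraph.induce (Set.Icc (-(n : ℤ)) (n : ℤ))).Adj b c}) (by simp) g hg]
  exact Finset.sum_congr rfl fun c _ => (hfg c).symm

/-- For `n = 0` the finite comb is a single vertex: the torus `(ℤ/1)^d` has no edges, so the `2d`
neighbours of the general case are absent. -/
theorem finiteCombAdj_zero (d : ℕ) : finiteCombAdj d 0 = 0 := by
  classical
  ext f x
  rw [finiteCombAdj, adjOp_apply]
  by_cases hx : x ∈ Set.range (finiteEmb d 0)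
  · obtain ⟨p, rfl⟩ := hx
    have h1 : Subsingleton (ZMod (2 * 0 + 1)) := inferInstanceAs (Subsingleton (ZMod 1))
    have h2 : Subsingleton (FiniteChain 0) := ⟨fun a b => by
      have ha := a.2
      have hb := b.2
      simp only [Set.mem_Icc] at ha hb
      exact Subtype.ext (by omega)⟩
    rw [sum_finiteCombGraph_eq, Finset.filter_false_of_mem, Finset.sum_empty]
    · rfl
    · intro q _ h
      exact h.ne (Subsingleton.elim p q)
  · rw [sum_finiteCombGraph_of_notMem hx]
    rfl

/-- The Perron–Frobenius vector of `G^d` is a supersolution on the finite comb, because the periodic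
boundary condition keeps the number `2d` of base neighbours and the cut fibres lose some. -/
theorem norm_finiteCombAdj_le (d n : ℕ) : ‖finiteCombAdj d n‖ ≤ combTop d := by
  classical
  have hL : 0 ≤ combTop d := by unfold combTop; positivity
  have hq := combRate_pos d
  rcases Nat.eq_zero_or_pos n with rfl | hn
  · rw [finiteCombAdj_zero, norm_zero]; exact hL
  refine norm_adjOp_le (v := fun p : CombVertex d => combRate d ^ p.2.natAbs) _
    (fun p => pow_pos hq _) hL fun x => ?_
  by_cases hx : x ∈ Set.range (finiteEmb d n)
  · obtain ⟨p, rfl⟩ := hx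
    set g : ℤ → ℝ := fun a => if a ∈ Set.Icc (-(n : ℤ)) (n : ℤ) then combRate d ^ a.natAbs else 0
      with hg
    have hgle : ∀ a, g a ≤ combRate d ^ a.natAbs := fun a => by
      simp only [hg]
      split_ifs
      · rfl
      · positivity
    rw [sum_finiteCombGraph hn p _ g (fun a ha => if_neg ha) (fun c => if_pos c.2)]
    have h1 := hgle (p.2 - 1)
    have h2 := hgle (p.2 + 1)
    have h3 := combRate_pow_natAbs_add d p.2
    have e : ((finiteEmb d n p).2) = (p.2 : ℤ) := rfl
    have e2 : ∀ j, ((finiteEmb d n (j, chainOrigin n)).2) = 0 := fun j => rfl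
    rw [e]
    simp only [e2]
    split_ifs at h3 ⊢
    · simp
      linarith
    · linarith
  · rw [sum_finiteCombGraph_of_notMem hx]
    positivity

end FiniteNeighbours


/-! ### Fourier decomposition of the finite comb -/

section Modes

theorem norm_le_norm_of_forall_le {V W : Type*} {f : Ell2 V} {g : Ell2 W} (e : V → W)
    (he : ∀ x, ‖f x‖ ≤ ‖g (e x)‖) (hinj : Function.Injective e) : ‖f‖ ≤ ‖g‖ := by
  refine le_of_sq_le_sq ?_ (norm_nonneg _)
  rw [norm_sq_eq_tsum, norm_sq_eq_tsum]
  calc ∑' x, ‖f x‖ ^ 2 ≤ ∑' x, ‖g (e x)‖ ^ 2 :=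
        (summable_norm_sq f).tsum_le_tsum (fun x => by have := he x; gcongr)
          ((summable_norm_sq g).comp_injective hinj)
    _ ≤ ∑' y, ‖g y‖ ^ 2 :=
        tsum_comp_le_tsum_of_inj (summable_norm_sq g) (fun y => by positivity) hinj

variable (d n : ℕ)

/-- The projection of `ℓ²(ℤ)` onto the vectors supported in `[-n, n]`. -/
noncomputable def cutoff : Ell2 ℤ →L[ℂ] Ell2 ℤ :=
  ∑ i ∈ Finset.Icc (-(n : ℤ)) n, InnerProductSpace.rankOne ℂ (delta i) (delta i)

variable {d n}

theorem cutoff_apply (f : Ell2 ℤ) (i : ℤ) :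
    cutoff n f i = if i ∈ Set.Icc (-(n : ℤ)) n then f i else 0 := by
  classical
  rw [cutoff, sum_apply, lp.coeFn_sum, Finset.sum_apply]
  simp only [InnerProductSpace.rankOne_apply, inner_delta_left, lp.coeFn_smul, Pi.smul_apply,
    delta_apply, smul_eq_mul, mul_ite, mul_one, mul_zero, Finset.sum_ite_eq, Finset.mem_Icc,
    Set.mem_Icc]

theorem norm_cutoff_apply_le (f : Ell2 ℤ) : ‖cutoff n f‖ ≤ ‖f‖ := by
  refine norm_le_norm_of_forall_le id (fun i => ?_) Function.injective_id
  rw [cutoff_apply]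
  split_ifs <;> simp

theorem norm_cutoff_le : ‖cutoff n‖ ≤ 1 :=
  ContinuousLinearMap.opNorm_le_bound _ zero_le_one fun f => by
    rw [one_mul]; exact norm_cutoff_apply_le f

theorem adjoint_cutoff : ContinuousLinearMap.adjoint (cutoff n) = cutoff n := by
  simp [cutoff, map_sum]

variable (n)

/-- The operator `A_{Y_n} + θ |δ₀⟩⟨δ₀|` on `ℓ²(ℤ)`, where `A_{Y_n}` is the adjacency operator of the
finite chain `[-n, n]`. -/
noncomputable def fibreAdj (θ : ℝ) : Ell2 ℤ →L[ℂ] Ell2 ℤ :=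
  cutoff n ∘L chainAdj ∘L cutoff n + (θ : ℂ) • InnerProductSpace.rankOne ℂ (delta 0) (delta 0)

variable {n}

theorem fibreAdj_apply (θ : ℝ) (f : Ell2 ℤ) (i : ℤ) :
    fibreAdj n θ f i = (if i ∈ Set.Icc (-(n : ℤ)) n then
      cutoff n f (i - 1) + cutoff n f (i + 1) else 0) + if i = 0 then θ * f 0 else 0 := by
  rw [fibreAdj, add_apply, lp.coeFn_add, Pi.add_apply, ContinuousLinearMap.comp_apply,
    ContinuousLinearMap.comp_apply, cutoff_apply, chainAdj_apply, smul_apply, lp.coeFn_smul,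
    Pi.smul_apply, InnerProductSpace.rankOne_apply, inner_delta_left, lp.coeFn_smul, Pi.smul_apply,
    delta_apply]
  congr 1
  split_ifs <;> simp

theorem isSelfAdjoint_fibreAdj (θ : ℝ) : IsSelfAdjoint (fibreAdj n θ) := by
  have h := isSelfAdjoint_adjOp chainGraph chainGraph_bounded
  rw [IsSelfAdjoint, ContinuousLinearMap.star_eq_adjoint] at h ⊢
  rw [fibreAdj, map_add, ContinuousLinearMap.adjoint_comp, ContinuousLinearMap.adjoint_comp,
    adjoint_cutoff, chainAdj, h, ContinuousLinearMap.comp_assoc, map_smulₛₗ, Complex.conj_ofReal,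
    InnerProductSpace.adjoint_rankOne]

theorem cutoff_fibreAdj (θ : ℝ) (f : Ell2 ℤ) : cutoff n (fibreAdj n θ f) = fibreAdj n θ f := by
  ext i
  rw [cutoff_apply]
  split_ifs with h
  · rfl
  · rw [fibreAdj_apply, if_neg h, if_neg, add_zero]
    rintro rfl
    simp at h

variable (d n) in
/-- The normalization `(2n+1)^{-d/2}` of the Fourier modes. -/
noncomputable def modeNorm : ℝ := (√((2 * (n : ℝ) + 1) ^ d))⁻¹

theorem modeNorm_pos : 0 < modeNorm d n := by unfold modeNorm; positivity

theorem modeNorm_sq : modeNorm d n ^ 2 = ((2 * (n : ℝ) + 1) ^ d)⁻¹ := by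
  rw [modeNorm, inv_pow, Real.sq_sqrt (by positivity)]

/-- The embedding of `ℓ²([-n, n])` into `ℓ²(G^d)` as the Fourier mode with frequency `k`, extended
by zero to `ℓ²(ℤ)`. -/
noncomputable def modeEmb (k : Fin d → ZMod (2 * n + 1)) : Ell2 ℤ →L[ℂ] Ell2 (CombVertex d) :=
  ∑ p : FiniteCombVertex d n, (modeNorm d n * torusChar k p.1 : ℂ) •
    InnerProductSpace.rankOne ℂ (delta (finiteEmb d n p)) (delta (p.2 : ℤ))

/-- The Fourier coefficient with frequency `k`, the adjoint of `modeEmb k`. -/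
noncomputable def modeCoeff (k : Fin d → ZMod (2 * n + 1)) : Ell2 (CombVertex d) →L[ℂ] Ell2 ℤ :=
  ContinuousLinearMap.adjoint (modeEmb k)

theorem modeEmb_apply_emb (k : Fin d → ZMod (2 * n + 1)) (f : Ell2 ℤ) (p : FiniteCombVertex d n) :
    modeEmb k f (finiteEmb d n p) = modeNorm d n * torusChar k p.1 * f p.2 := by
  classical
  rw [modeEmb, sum_apply, lp.coeFn_sum, Finset.sum_apply]
  simp only [smul_apply, InnerProductSpace.rankOne_apply, inner_delta_left, lp.coeFn_smul,
    Pi.smul_apply, delta_apply, smul_eq_mul, mul_ite, mul_one, mul_zero,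
    EmbeddingLike.apply_eq_iff_eq, Finset.sum_ite_eq, Finset.mem_univ, if_true]

theorem modeEmb_apply_of_notMem (k : Fin d → ZMod (2 * n + 1)) (f : Ell2 ℤ) {x : CombVertex d}
    (hx : x ∉ Set.range (finiteEmb d n)) : modeEmb k f x = 0 := by
  classical
  rw [modeEmb, sum_apply, lp.coeFn_sum, Finset.sum_apply]
  refine Finset.sum_eq_zero fun p _ => ?_
  rw [smul_apply, InnerProductSpace.rankOne_apply, lp.coeFn_smul, Pi.smul_apply, lp.coeFn_smul,
    Pi.smul_apply, delta_apply, if_neg fun h => hx ⟨p, h.symm⟩]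
  simp

theorem modeCoeff_eq (k : Fin d → ZMod (2 * n + 1)) :
    modeCoeff k = ∑ p : FiniteCombVertex d n, (modeNorm d n * conj (torusChar k p.1) : ℂ) •
      InnerProductSpace.rankOne ℂ (delta (p.2 : ℤ)) (delta (finiteEmb d n p)) := by
  rw [modeCoeff, modeEmb, map_sum]
  refine Finset.sum_congr rfl fun p _ => ?_
  rw [map_smulₛₗ, InnerProductSpace.adjoint_rankOne, map_mul, Complex.conj_ofReal]

theorem modeCoeff_apply (k : Fin d → ZMod (2 * n + 1)) (ξ : Ell2 (CombVertex d))
    (i : FiniteChain n) : modeCoeff k ξ i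
      = ∑ j, modeNorm d n * conj (torusChar k j) * ξ (finiteEmb d n (j, i)) := by
  classical
  rw [modeCoeff_eq, sum_apply, lp.coeFn_sum, Finset.sum_apply,
    Fintype.sum_prod_type]
  refine Finset.sum_congr rfl fun j _ => ?_
  simp only [smul_apply, InnerProductSpace.rankOne_apply, inner_delta_left, lp.coeFn_smul,
    Pi.smul_apply, delta_apply, smul_eq_mul, mul_ite, mul_one, mul_zero, ← Subtype.ext_iff,
    Finset.sum_ite_eq, Finset.mem_univ, if_true]

theorem modeCoeff_apply_of_notMem (k : Fin d → ZMod (2 * n + 1)) (ξ : Ell2 (CombVertex d))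
    {i : ℤ} (hi : i ∉ Set.Icc (-(n : ℤ)) n) : modeCoeff k ξ i = 0 := by
  classical
  rw [modeCoeff_eq, sum_apply, lp.coeFn_sum, Finset.sum_apply]
  refine Finset.sum_eq_zero fun p _ => ?_
  rw [smul_apply, InnerProductSpace.rankOne_apply, lp.coeFn_smul, Pi.smul_apply, lp.coeFn_smul,
    Pi.smul_apply, delta_apply, if_neg fun h => hi (by rw [h]; exact p.2.2)]
  simp

theorem inner_modeEmb_left (k : Fin d → ZMod (2 * n + 1)) (f : Ell2 ℤ) (ξ : Ell2 (CombVertex d)) :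
    inner ℂ (modeEmb k f) ξ = inner ℂ f (modeCoeff k ξ) := by
  rw [modeCoeff, ContinuousLinearMap.adjoint_inner_right]

theorem inner_modeEmb_right (k : Fin d → ZMod (2 * n + 1)) (f : Ell2 ℤ) (ξ : Ell2 (CombVertex d)) :
    inner ℂ ξ (modeEmb k f) = inner ℂ (modeCoeff k ξ) f := by
  rw [modeCoeff, ContinuousLinearMap.adjoint_inner_left]

theorem modeNorm_mul_modeNorm_mul_pow :
    (modeNorm d n : ℂ) * modeNorm d n * ((2 * n + 1 : ℕ) : ℂ) ^ d = 1 := by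
  have h : (modeNorm d n * modeNorm d n * (2 * (n : ℝ) + 1) ^ d : ℝ) = 1 := by
    rw [← sq, modeNorm_sq, inv_mul_cancel₀ (by positivity)]
  have h2 := congrArg (fun x : ℝ => (x : ℂ)) h
  push_cast at h2 ⊢
  exact h2

theorem modeCoeff_modeEmb (k : Fin d → ZMod (2 * n + 1)) (f : Ell2 ℤ) :
    modeCoeff k (modeEmb k f) = cutoff n f := by
  ext i
  rw [cutoff_apply]
  split_ifs with h
  · have h1 := modeCoeff_apply k (modeEmb k f) ⟨i, h⟩
    simp only at h1
    rw [h1]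
    simp only [modeEmb_apply_emb]
    have h2 : ∀ j, (modeNorm d n : ℂ) * conj (torusChar k j) * (modeNorm d n * torusChar k j * f i)
        = modeNorm d n * modeNorm d n * f i := fun j => by
      linear_combination (modeNorm d n * modeNorm d n * f i : ℂ) * torusChar_mul_conj k j
    rw [Finset.sum_congr rfl fun j _ => h2 j, Finset.sum_const, nsmul_eq_mul, Finset.card_univ,
      Fintype.card_fun, ZMod.card, Fintype.card_fin]
    have := modeNorm_mul_modeNorm_mul_pow (d := d) (n := n)
    push_cast at this ⊢
    linear_combination f i * this
  · rw [modeCoeff_apply_of_notMem _ _ h]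

theorem norm_modeEmb_le (k : Fin d → ZMod (2 * n + 1)) (f : Ell2 ℤ) : ‖modeEmb k f‖ ≤ ‖f‖ := by
  refine le_of_sq_le_sq ?_ (norm_nonneg _)
  rw [← inner_self_eq_norm_sq (𝕜 := ℂ), inner_modeEmb_left, modeCoeff_modeEmb]
  exact (Complex.re_le_norm _).trans ((norm_inner_le_norm _ _).trans
    (by rw [sq]; gcongr; exact norm_cutoff_apply_le f))

theorem finiteCombAdj_modeEmb (hn : 1 ≤ n) (k : Fin d → ZMod (2 * n + 1)) (f : Ell2 ℤ) :
    finiteCombAdj d n (modeEmb k f) = modeEmb k (fibreAdj n (torusEigenvalue k) f) := by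
  ext x
  rw [finiteCombAdj, adjOp_apply]
  by_cases hx : x ∈ Set.range (finiteEmb d n)
  · obtain ⟨p, rfl⟩ := hx
    rw [sum_finiteCombGraph hn p _ (fun a => modeNorm d n * torusChar k p.1 * cutoff n f a)
      (fun a ha => by rw [cutoff_apply, if_neg ha, mul_zero])
      (fun c => by rw [cutoff_apply, if_pos c.2, modeEmb_apply_emb])]
    simp only [modeEmb_apply_emb, fibreAdj_apply, if_pos p.2.2]
    have h0 : ((chainOrigin n : FiniteChain n) : ℤ) = 0 := rfl
    have h := sum_torusChar_neighbours k p.1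
    rw [h0, mul_add, mul_add]
    congr 1
    split_ifs with hp
    · simp only [← add_mul, ← mul_add, ← Finset.sum_mul, ← Finset.mul_sum]
      rw [h]
      ring
    · simp
  · rw [sum_finiteCombGraph_of_notMem hx, modeEmb_apply_of_notMem _ _ hx]

theorem isSelfAdjoint_finiteCombAdj (d n : ℕ) : IsSelfAdjoint (finiteCombAdj d n) :=
  isSelfAdjoint_adjOp _ _

theorem inner_finiteCombAdj_left (x y : Ell2 (CombVertex d)) :
    inner ℂ (finiteCombAdj d n x) y = inner ℂ x (finiteCombAdj d n y) := by
  have h := isSelfAdjoint_finiteCombAdj d n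
  rw [← ContinuousLinearMap.adjoint_inner_right, ← ContinuousLinearMap.star_eq_adjoint, h.star_eq]

theorem inner_fibreAdj_left (θ : ℝ) (x y : Ell2 ℤ) :
    inner ℂ (fibreAdj n θ x) y = inner ℂ x (fibreAdj n θ y) := by
  have h := isSelfAdjoint_fibreAdj (n := n) θ
  rw [← ContinuousLinearMap.adjoint_inner_right, ← ContinuousLinearMap.star_eq_adjoint, h.star_eq]

/-- The Fourier coefficients reduce the adjacency operator of the finite comb to rank one
perturbations of the finite chain. -/
theorem modeCoeff_finiteCombAdj (hn : 1 ≤ n) (k : Fin d → ZMod (2 * n + 1))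
    (ξ : Ell2 (CombVertex d)) :
    modeCoeff k (finiteCombAdj d n ξ) = fibreAdj n (torusEigenvalue k) (modeCoeff k ξ) := by
  refine ext_inner_left ℂ fun f => ?_
  rw [← inner_modeEmb_left, ← inner_finiteCombAdj_left, finiteCombAdj_modeEmb hn,
    inner_modeEmb_left, inner_fibreAdj_left]

variable (d n) in
/-- The projection of `ℓ²(G^d)` onto the vectors supported in `Λ_n`. -/
noncomputable def boxProj : Ell2 (CombVertex d) →L[ℂ] Ell2 (CombVertex d) :=
  ∑ p : FiniteCombVertex d n, InnerProductSpace.rankOne ℂ (delta (finiteEmb d n p))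
    (delta (finiteEmb d n p))

theorem boxProj_apply_emb (ξ : Ell2 (CombVertex d)) (p : FiniteCombVertex d n) :
    boxProj d n ξ (finiteEmb d n p) = ξ (finiteEmb d n p) := by
  classical
  rw [boxProj, sum_apply, lp.coeFn_sum, Finset.sum_apply]
  simp [inner_delta_left, delta_apply]

theorem boxProj_apply_of_notMem (ξ : Ell2 (CombVertex d)) {x : CombVertex d}
    (hx : x ∉ Set.range (finiteEmb d n)) : boxProj d n ξ x = 0 := by
  classical
  rw [boxProj, sum_apply, lp.coeFn_sum, Finset.sum_apply]
  refine Finset.sum_eq_zero fun p _ => ?_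
  rw [InnerProductSpace.rankOne_apply, lp.coeFn_smul, Pi.smul_apply, delta_apply,
    if_neg fun h => hx ⟨p, h.symm⟩, smul_zero]

/-- Fourier inversion. -/
theorem sum_modeEmb_modeCoeff (ξ : Ell2 (CombVertex d)) :
    ∑ k : Fin d → ZMod (2 * n + 1), modeEmb k (modeCoeff k ξ) = boxProj d n ξ := by
  classical
  ext x
  rw [lp.coeFn_sum, Finset.sum_apply]
  by_cases hx : x ∈ Set.range (finiteEmb d n)
  · obtain ⟨p, rfl⟩ := hx
    rw [boxProj_apply_emb]
    simp only [modeEmb_apply_emb, modeCoeff_apply, Finset.mul_sum]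
    rw [Finset.sum_comm]
    have h : ∀ j, ∑ k, modeNorm d n * torusChar k p.1
        * (modeNorm d n * conj (torusChar k j) * ξ (finiteEmb d n (j, p.2)))
        = if j = p.1 then ξ (finiteEmb d n (j, p.2)) else 0 := by
      intro j
      have h1 : ∀ k : Fin d → ZMod (2 * n + 1), modeNorm d n * torusChar k p.1
          * (modeNorm d n * conj (torusChar k j) * ξ (finiteEmb d n (j, p.2)))
          = modeNorm d n * modeNorm d n * ξ (finiteEmb d n (j, p.2)) * torusChar k (p.1 + -j) := by
        intro k
        rw [torusChar_add, conj_torusChar]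
        ring
      rw [Finset.sum_congr rfl fun k _ => h1 k, ← Finset.mul_sum, sum_torusChar]
      by_cases hj : j = p.1
      · rw [if_pos (by rw [hj, add_neg_cancel]), if_pos hj]
        linear_combination ξ (finiteEmb d n (j, p.2))
          * modeNorm_mul_modeNorm_mul_pow (d := d) (n := n)
      · rw [if_neg fun h => hj (by rw [← sub_eq_add_neg, sub_eq_zero] at h; exact h.symm),
          if_neg hj, mul_zero]
    rw [Finset.sum_congr rfl fun j _ => h j]
    simp
  · rw [boxProj_apply_of_notMem _ hx]
    exact Finset.sum_eq_zero fun k _ => modeEmb_apply_of_notMem _ _ hx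

theorem norm_sub_boxProj_le (ξ : Ell2 (CombVertex d)) : ‖ξ - boxProj d n ξ‖ ≤ ‖ξ‖ := by
  refine norm_le_norm_of_forall_le id (fun x => ?_) Function.injective_id
  rw [lp.coeFn_sub, Pi.sub_apply]
  by_cases hx : x ∈ Set.range (finiteEmb d n)
  · obtain ⟨p, rfl⟩ := hx
    rw [boxProj_apply_emb]; simp
  · rw [boxProj_apply_of_notMem _ hx, sub_zero]; rfl

theorem boxProj_finiteCombAdj (ξ : Ell2 (CombVertex d)) :
    boxProj d n (finiteCombAdj d n ξ) = finiteCombAdj d n ξ := by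
  ext x
  by_cases hx : x ∈ Set.range (finiteEmb d n)
  · obtain ⟨p, rfl⟩ := hx
    rw [boxProj_apply_emb]
  · rw [boxProj_apply_of_notMem _ hx, finiteCombAdj, adjOp_apply, sum_finiteCombGraph_of_notMem hx]

theorem inner_eq_inner_sub_boxProj_add_sum (η ξ : Ell2 (CombVertex d)) :
    inner ℂ η ξ = inner ℂ η (ξ - boxProj d n ξ)
      + ∑ k : Fin d → ZMod (2 * n + 1), inner ℂ (modeCoeff k η) (modeCoeff k ξ) := by
  simp_rw [← inner_modeEmb_right]
  rw [← inner_sum, sum_modeEmb_modeCoeff, ← inner_add_right, sub_add_cancel]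

/-! ### Lower bounds for the Fourier modes -/

theorem norm_cutoff_comp_chainAdj_le : ‖cutoff n ∘L chainAdj ∘L cutoff n‖ ≤ 2 :=
  ContinuousLinearMap.opNorm_le_bound _ zero_le_two fun f =>
    calc ‖cutoff n (chainAdj (cutoff n f))‖ ≤ ‖chainAdj (cutoff n f)‖ := norm_cutoff_apply_le _
      _ ≤ 2 * ‖cutoff n f‖ := chainAdj.le_of_opNorm_le norm_chainAdj_le _
      _ ≤ 2 * ‖f‖ := by gcongr; exact norm_cutoff_apply_le f

theorem re_inner_fibreAdj (θ : ℝ) (f : Ell2 ℤ) : (inner ℂ f (fibreAdj n θ f)).re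
    = (inner ℂ f ((cutoff n ∘L chainAdj ∘L cutoff n) f)).re + θ * ‖f 0‖ ^ 2 := by
  have h : (inner ℂ f (delta 0) * inner ℂ (delta 0) f : ℂ) = ((‖f 0‖ ^ 2 : ℝ) : ℂ) := by
    rw [inner_delta_left, inner_delta_right, mul_comm, Complex.mul_conj,
      Complex.normSq_eq_norm_sq]
  rw [fibreAdj, add_apply, inner_add_right, Complex.add_re, smul_apply,
    InnerProductSpace.rankOne_apply, inner_smul_right, inner_smul_right,
    mul_comm (inner ℂ (delta 0) f), h, ← Complex.ofReal_mul, Complex.ofReal_re]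

/-- The bound on the operator with `θ = 2d` is inherited from the finite comb, whose zero mode it
is. -/
theorem re_inner_fibreAdj_top_le (hd : 1 ≤ d) (hn : 1 ≤ n) (f : Ell2 ℤ) :
    (inner ℂ f (fibreAdj n (2 * d) f)).re ≤ combTop d * ‖f‖ ^ 2 := by
  have h1 : inner ℂ f (fibreAdj n (2 * d) f)
      = inner ℂ (modeEmb (d := d) (n := n) 0 f) (finiteCombAdj d n (modeEmb (n := n) 0 f)) := by
    rw [finiteCombAdj_modeEmb hn, inner_modeEmb_left, modeCoeff_modeEmb, torusEigenvalue_zero,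
      cutoff_fibreAdj]
  rw [h1]
  have := two_lt_combTop hd
  refine (re_inner_le_of_norm_le (norm_finiteCombAdj_le d n) _).trans ?_
  gcongr
  exact norm_modeEmb_le _ _

/-- The constant relating the gap of the Fourier modes of the comb to the gap of the torus. -/
noncomputable def gapConst (d : ℕ) : ℝ := (combTop d - 2) / (4 * d)

theorem gapConst_pos (hd : 1 ≤ d) : 0 < gapConst d := by
  have := two_lt_combTop hd
  have : (0 : ℝ) < d := by exact_mod_cast hd
  unfold gapConst
  apply div_pos <;> linarith

/-- By convexity in `θ`, the top of the spectrum of `A_{Y_n} + θ|δ₀⟩⟨δ₀|` lies below `combTop d` by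
a multiple of `2d - θ`. -/
theorem re_inner_fibreAdj_le (hd : 1 ≤ d) (hn : 1 ≤ n) (k : Fin d → ZMod (2 * n + 1)) (f : Ell2 ℤ) :
    (inner ℂ f (fibreAdj n (torusEigenvalue k) f)).re
      ≤ (combTop d - gapConst d * torusGap k) * ‖f‖ ^ 2 := by
  have h1 := re_inner_fibreAdj_top_le hd hn f
  have h2 := re_inner_le_of_norm_le (norm_cutoff_comp_chainAdj_le (n := n)) f
  rw [re_inner_fibreAdj] at h1 ⊢
  set X := (inner ℂ f ((cutoff n ∘L chainAdj ∘L cutoff n) f)).re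
  have hd0 : (0 : ℝ) < d := by exact_mod_cast hd
  -- The value `θ = 2d - 4d t` interpolates between `2d`, where the top is `combTop d`, and `-2d`,
  -- where it is at most `2`.
  set t := torusGap k / (4 * d) with ht
  have ht0 : 0 ≤ t := div_nonneg (torusGap_nonneg k) (by positivity)
  have ht1 : t ≤ 1 := (div_le_one (by positivity)).2 (torusGap_le k)
  have e1 : torusEigenvalue k = 2 * d - 4 * d * t := by
    rw [ht, mul_div_cancel₀ _ (by positivity), torusGap]; ring
  have e2 : gapConst d * torusGap k = t * (combTop d - 2) := by
    rw [ht, gapConst]; ring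
  rw [e1, e2]
  have h3 := mul_le_mul_of_nonneg_left h1 (sub_nonneg.2 ht1)
  have h4 : X - 2 * d * ‖f 0‖ ^ 2 ≤ 2 * ‖f‖ ^ 2 := by
    have : 0 ≤ 2 * (d : ℝ) * ‖f 0‖ ^ 2 := by positivity
    linarith
  have h5 := mul_le_mul_of_nonneg_left h4 ht0
  linarith

theorem le_re_inner_fibre (hd : 1 ≤ d) (hn : 1 ≤ n) (k : Fin d → ZMod (2 * n + 1)) (s : ℝ)
    (f : Ell2 ℤ) : (s + gapConst d * torusGap k) * ‖f‖ ^ 2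
      ≤ (inner ℂ f ((((combTop d + s : ℝ) : ℂ) • (1 : Ell2 ℤ →L[ℂ] Ell2 ℤ)
        - fibreAdj n (torusEigenvalue k)) f)).re := by
  have h := re_inner_smul_one_sub (re_inner_fibreAdj_le hd hn k) (combTop d + s) f
  refine le_trans (le_of_eq ?_) h
  ring

end Modes


/-! ### Sums over the nonzero frequencies -/

section FrequencySums

variable {d n : ℕ}

/-- The sup norm of a frequency, with coordinates represented in `[-n, n]`. -/
def freqNorm (k : Fin d → ZMod (2 * n + 1)) : ℕ := Finset.univ.sup fun l => (k l).valMinAbs.natAbs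

theorem card_natAbs_valMinAbs_eq_le (a : ℕ) :
    (Finset.univ.filter fun z : ZMod (2 * n + 1) => z.valMinAbs.natAbs = a).card ≤ 2 := by
  refine (Finset.card_le_card_of_injOn (t := {(a : ℤ), -(a : ℤ)}) ZMod.valMinAbs ?_
    (fun x _ y _ h => ZMod.injective_valMinAbs h)).trans Finset.card_le_two
  intro z hz
  have := (Finset.mem_filter.1 hz).2
  simp only [Finset.coe_insert, Finset.coe_singleton, Set.mem_insert_iff, Set.mem_singleton_iff]
  omega

theorem card_natAbs_valMinAbs_le_le (a : ℕ) :
    (Finset.univ.filter fun z : ZMod (2 * n + 1) => z.valMinAbs.natAbs ≤ a).card ≤ 2 * a + 1 := by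
  refine (Finset.card_le_card_of_injOn (t := Finset.Icc (-(a : ℤ)) a) ZMod.valMinAbs ?_
    (fun x _ y _ h => ZMod.injective_valMinAbs h)).trans (le_of_eq ?_)
  · intro z hz
    have := (Finset.mem_filter.1 hz).2
    simp only [Finset.coe_Icc, Set.mem_Icc]
    omega
  · rw [Int.card_Icc]; omega

theorem freqNorm_pos {k : Fin d → ZMod (2 * n + 1)} (hk : k ≠ 0) : 1 ≤ freqNorm k := by
  obtain ⟨l, hl⟩ := Function.ne_iff.1 hk
  have h1 : (k l).valMinAbs.natAbs ≤ freqNorm k :=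
    Finset.le_sup (f := fun l => (k l).valMinAbs.natAbs) (Finset.mem_univ l)
  refine le_trans ?_ h1
  rw [Nat.one_le_iff_ne_zero, Ne, Int.natAbs_eq_zero, ZMod.valMinAbs_eq_zero]
  exact hl

theorem freqNorm_le (k : Fin d → ZMod (2 * n + 1)) : freqNorm k ≤ n :=
  Finset.sup_le fun l _ => (ZMod.natAbs_valMinAbs_le (k l)).trans (by omega)

theorem exists_freqNorm_eq {k : Fin d → ZMod (2 * n + 1)} (hk : k ≠ 0) :
    ∃ l, (k l).valMinAbs.natAbs = freqNorm k := by
  obtain ⟨l, -⟩ := Function.ne_iff.1 hk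
  obtain ⟨l, -, hl⟩ := Finset.exists_mem_eq_sup Finset.univ ⟨l, Finset.mem_univ l⟩
    fun l => (k l).valMinAbs.natAbs
  exact ⟨l, hl.symm⟩

theorem sq_freqNorm_le_torusGap {k : Fin d → ZMod (2 * n + 1)} (hk : k ≠ 0) :
    16 * (freqNorm k / (2 * n + 1) : ℝ) ^ 2 ≤ torusGap k := by
  obtain ⟨l, hl⟩ := exists_freqNorm_eq hk
  refine le_trans (le_of_eq ?_) (le_torusGap k l)
  rw [← hl, div_pow, div_pow, ← sq_abs ((k l).valMinAbs : ℝ), ← Int.cast_abs, Int.abs_eq_natAbs,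
    Int.cast_natCast]

theorem card_freqNorm_eq_le (a : ℕ) :
    (Finset.univ.filter fun k : Fin d → ZMod (2 * n + 1) => k ≠ 0 ∧ freqNorm k = a).card
      ≤ d * (2 * (2 * a + 1) ^ (d - 1)) := by
  classical
  let S : Fin d → Finset (Fin d → ZMod (2 * n + 1)) := fun l =>
    Fintype.piFinset fun l' => if l' = l then
      Finset.univ.filter fun z : ZMod (2 * n + 1) => z.valMinAbs.natAbs = a
    else Finset.univ.filter fun z : ZMod (2 * n + 1) => z.valMinAbs.natAbs ≤ a
  have h1 : (Finset.univ.filter fun k : Fin d → ZMod (2 * n + 1) => k ≠ 0 ∧ freqNorm k = a)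
      ⊆ Finset.univ.biUnion S := by
    intro k hk
    obtain ⟨hk0, hka⟩ := (Finset.mem_filter.1 hk).2
    obtain ⟨l, hl⟩ := exists_freqNorm_eq hk0
    rw [Finset.mem_biUnion]
    refine ⟨l, Finset.mem_univ l, Fintype.mem_piFinset.2 fun l' => ?_⟩
    split_ifs with h
    · subst h
      simpa [hka] using hl
    · rw [Finset.mem_filter]
      refine ⟨Finset.mem_univ _, ?_⟩
      rw [← hka]
      exact Finset.le_sup (f := fun l => (k l).valMinAbs.natAbs) (Finset.mem_univ l')
  have h2 : ∀ l, (S l).card ≤ 2 * (2 * a + 1) ^ (d - 1) := by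
    intro l
    rw [Fintype.card_piFinset, ← Finset.mul_prod_erase _ _ (Finset.mem_univ l), if_pos rfl]
    refine Nat.mul_le_mul (card_natAbs_valMinAbs_eq_le a) ?_
    calc _ ≤ ∏ _l' ∈ Finset.univ.erase l, (2 * a + 1) := by
          refine Finset.prod_le_prod' fun l' hl' => ?_
          rw [if_neg (Finset.ne_of_mem_erase hl')]
          exact card_natAbs_valMinAbs_le_le a
      _ = _ := by
          rw [Finset.prod_const, Finset.card_erase_of_mem (Finset.mem_univ l), Finset.card_univ,
            Fintype.card_fin]
  calc _ ≤ (Finset.univ.biUnion S).card := Finset.card_le_card h1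
    _ ≤ ∑ l, (S l).card := Finset.card_biUnion_le
    _ ≤ ∑ _l : Fin d, 2 * (2 * a + 1) ^ (d - 1) := Finset.sum_le_sum fun l _ => h2 l
    _ = _ := by simp

/-- Comparison of a radial sum over the nonzero frequencies with a one-dimensional Riemann sum; in
dimension at least `3` the volume of the shells gains a factor `x²`. -/
theorem sum_freqNorm_le (hd : 3 ≤ d) (hn : 1 ≤ n) {F : ℕ → ℝ} (hF : ∀ a, 0 ≤ F a) :
    modeNorm d n ^ 2 * ∑ k : Fin d → ZMod (2 * n + 1) with k ≠ 0, F (freqNorm k)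
      ≤ 2 * d * 3 ^ (d - 1) * ((2 * (n : ℝ) + 1)⁻¹
        * ∑ a ∈ Finset.Icc 1 n, (a / (2 * n + 1) : ℝ) ^ 2 * F a) := by
  classical
  have hN : (0 : ℝ) < 2 * n + 1 := by positivity
  have h1 : ∑ k : Fin d → ZMod (2 * n + 1) with k ≠ 0, F (freqNorm k)
      ≤ ∑ a ∈ Finset.Icc 1 n, (d * (2 * (2 * a + 1) ^ (d - 1)) : ℝ) * F a := by
    rw [← Finset.sum_fiberwise_of_maps_to (t := Finset.Icc 1 n) (g := freqNorm)]
    · refine Finset.sum_le_sum fun a _ => ?_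
      rw [Finset.sum_congr rfl (g := fun _ => F a)
        fun k hk => by rw [(Finset.mem_filter.1 hk).2], Finset.sum_const, nsmul_eq_mul,
        Finset.filter_filter]
      refine mul_le_mul_of_nonneg_right ?_ (hF a)
      exact_mod_cast card_freqNorm_eq_le (d := d) (n := n) a
    · intro k hk
      exact Finset.mem_Icc.2 ⟨freqNorm_pos (Finset.mem_filter.1 hk).2, freqNorm_le k⟩
  calc _ ≤ modeNorm d n ^ 2
        * ∑ a ∈ Finset.Icc 1 n, (d * (2 * (2 * a + 1) ^ (d - 1)) : ℝ) * F a := by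
        gcongr
    _ = ∑ a ∈ Finset.Icc 1 n, (2 * d : ℝ) * (modeNorm d n ^ 2 * (2 * a + 1) ^ (d - 1)) * F a := by
        rw [Finset.mul_sum]
        refine Finset.sum_congr rfl fun a _ => by ring
    _ ≤ ∑ a ∈ Finset.Icc 1 n, (2 * d : ℝ) * (3 ^ (d - 1) * ((2 * (n : ℝ) + 1)⁻¹
          * (a / (2 * n + 1) : ℝ) ^ 2)) * F a := by
        refine Finset.sum_le_sum fun a ha => ?_
        obtain ⟨ha1, han⟩ := Finset.mem_Icc.1 ha
        have ha1' : (1 : ℝ) ≤ a := by exact_mod_cast ha1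
        have han' : (a : ℝ) ≤ n := by exact_mod_cast han
        refine mul_le_mul_of_nonneg_right (mul_le_mul_of_nonneg_left ?_ (by positivity)) (hF a)
        obtain ⟨e, rfl⟩ : ∃ e, d = e + 3 := ⟨d - 3, by omega⟩
        rw [modeNorm_sq, show e + 3 - 1 = e + 2 by omega]
        set x : ℝ := a / (2 * n + 1) with hx
        have hx0 : 0 ≤ x := by positivity
        have hx1 : x ≤ 1 := (div_le_one hN).2 (by linarith)
        have hax : (a : ℝ) = x * (2 * n + 1) := by rw [hx]; field_simp
        calc ((2 * (n : ℝ) + 1) ^ (e + 3))⁻¹ * (2 * a + 1) ^ (e + 2)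
            ≤ ((2 * (n : ℝ) + 1) ^ (e + 3))⁻¹ * (3 * a) ^ (e + 2) := by
              gcongr; linarith
          _ = 3 ^ (e + 2) * ((2 * (n : ℝ) + 1)⁻¹ * (x ^ 2 * x ^ e)) := by
              rw [hax, mul_pow, mul_pow]
              field_simp
              ring
          _ ≤ _ := by
              gcongr
              exact mul_le_of_le_one_right (by positivity) (pow_le_one₀ hx0 hx1)
    _ = _ := by
        rw [Finset.mul_sum, Finset.mul_sum]
        refine Finset.sum_congr rfl fun a _ => by ring

theorem sum_inv_sqrt_le (n : ℕ) : ∑ a ∈ Finset.Icc 1 n, (√(a : ℝ))⁻¹ ≤ 2 * √(n : ℝ) := by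
  induction n with
  | zero => simp
  | succ n ih =>
    rw [Finset.sum_Icc_succ_top (by omega)]
    have h1 : 0 < √((n + 1 : ℕ) : ℝ) := Real.sqrt_pos.2 (by positivity)
    have h2 : √((n + 1 : ℕ) : ℝ) ^ 2 = n + 1 := by
      rw [Real.sq_sqrt (by positivity)]; push_cast; ring
    have h3 : √(n : ℝ) ^ 2 = n := Real.sq_sqrt (by positivity)
    have h4 : (√((n + 1 : ℕ) : ℝ))⁻¹ ≤ 2 * √((n + 1 : ℕ) : ℝ) - 2 * √(n : ℝ) := by
      rw [inv_le_iff_one_le_mul₀ h1]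
      nlinarith [sq_nonneg (√((n + 1 : ℕ) : ℝ) - √(n : ℝ))]
    linarith

theorem torusGap_pos {k : Fin d → ZMod (2 * n + 1)} (hk : k ≠ 0) : 0 < torusGap k := by
  have h := freqNorm_pos hk
  have h' : (1 : ℝ) ≤ freqNorm k := by exact_mod_cast h
  exact lt_of_lt_of_le (by positivity) (sq_freqNorm_le_torusGap hk)

/-- The averaged inverse gap is bounded uniformly in `n`: in dimension at least `3` the singularity
`|k|⁻²` is integrable. -/
theorem sum_inv_torusGap_le (hd : 3 ≤ d) (hn : 1 ≤ n) :
    modeNorm d n ^ 2 * ∑ k : Fin d → ZMod (2 * n + 1) with k ≠ 0, (torusGap k)⁻¹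
      ≤ 2 * d * 3 ^ (d - 1) := by
  have hN : (0 : ℝ) < 2 * n + 1 := by positivity
  calc _ ≤ modeNorm d n ^ 2 * ∑ k : Fin d → ZMod (2 * n + 1) with k ≠ 0,
        (16 * (freqNorm k / (2 * n + 1) : ℝ) ^ 2)⁻¹ := by
        refine mul_le_mul_of_nonneg_left (Finset.sum_le_sum fun k hk => ?_) (by positivity)
        have hk := (Finset.mem_filter.1 hk).2
        have h' : (1 : ℝ) ≤ freqNorm k := by exact_mod_cast freqNorm_pos hk
        exact inv_anti₀ (by positivity) (sq_freqNorm_le_torusGap hk)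
    _ ≤ 2 * d * 3 ^ (d - 1) * ((2 * (n : ℝ) + 1)⁻¹
        * ∑ a ∈ Finset.Icc 1 n, (a / (2 * n + 1) : ℝ) ^ 2 * (16 * (a / (2 * n + 1) : ℝ) ^ 2)⁻¹) :=
        sum_freqNorm_le hd hn (F := fun a => (16 * (a / (2 * n + 1) : ℝ) ^ 2)⁻¹)
          fun a => by positivity
    _ ≤ 2 * d * 3 ^ (d - 1) * ((2 * (n : ℝ) + 1)⁻¹ * ∑ _a ∈ Finset.Icc 1 n, (1 : ℝ)) := by
        gcongr with a ha
        have ha1 : (1 : ℝ) ≤ a := by exact_mod_cast (Finset.mem_Icc.1 ha).1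
        rw [← div_eq_mul_inv]
        exact (div_le_one (by positivity)).2 (by nlinarith [sq_nonneg (a / (2 * n + 1) : ℝ)])
    _ ≤ 2 * d * 3 ^ (d - 1) * 1 := by
        gcongr
        rw [Finset.sum_const, Nat.card_Icc, nsmul_eq_mul, inv_mul_le_iff₀ hN]
        push_cast
        simp
        linarith
    _ = _ := mul_one _

/-- A bound that is small in `s`, with an exponent so low that the singularity in `y` which it adds
remains summable. -/
theorem div_add_le_sqrt_sqrt {s y : ℝ} (hs : 0 < s) (hy : 0 < y) : s / (s + y) ≤ √√(s / y) := by
  have h1 : s / (s + y) ≤ 1 := (div_le_one (by positivity)).2 (by linarith)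
  have h0 : 0 ≤ s / (s + y) := by positivity
  have h2 : s / (s + y) ≤ s / y := div_le_div_of_nonneg_left hs.le hy (by linarith)
  refine Real.le_sqrt_of_sq_le (Real.le_sqrt_of_sq_le ?_)
  calc ((s / (s + y)) ^ 2) ^ 2 = (s / (s + y)) * (s / (s + y)) ^ 3 := by ring
    _ ≤ (s / (s + y)) * 1 := by gcongr; exact pow_le_one₀ h0 h1
    _ ≤ s / y := by rwa [mul_one]

/-- The modulus of continuity at zero energy of the contribution of the nonzero frequencies to the
resolvent. -/
noncomputable def freqModulus (d : ℕ) (s : ℝ) : ℝ :=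
  2 * d * 3 ^ (d - 1) * ((gapConst d * 16)⁻¹ * (√√(s / (gapConst d * 16)) * 2))

theorem tendsto_freqModulus (d : ℕ) : Tendsto (freqModulus d) (𝓝 0) (𝓝 0) := by
  have h : Continuous (freqModulus d) := by unfold freqModulus; fun_prop
  have := h.tendsto 0
  simpa [freqModulus] using this

/-- The nonzero frequencies contribute uniformly little to the change of the resolvent between the
energies `0` and `s`. -/
theorem sum_torusGap_modulus_le (hd : 3 ≤ d) (hn : 1 ≤ n) {s : ℝ} (hs : 0 < s) :
    modeNorm d n ^ 2 * ∑ k : Fin d → ZMod (2 * n + 1) with k ≠ 0,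
      s / ((s + gapConst d * torusGap k) * (gapConst d * torusGap k)) ≤ freqModulus d s := by
  have hN : (0 : ℝ) < 2 * n + 1 := by positivity
  have hκ := gapConst_pos (show 1 ≤ d by omega)
  set y : ℕ → ℝ := fun a => gapConst d * (16 * (a / (2 * n + 1) : ℝ) ^ 2) with hy
  have hy0 : ∀ a : ℕ, 0 ≤ y a := fun a => by positivity
  calc _ ≤ modeNorm d n ^ 2 * ∑ k : Fin d → ZMod (2 * n + 1) with k ≠ 0,
        s / ((s + y (freqNorm k)) * y (freqNorm k)) := by
        refine mul_le_mul_of_nonneg_left (Finset.sum_le_sum fun k hk => ?_) (by positivity)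
        have hk := (Finset.mem_filter.1 hk).2
        have h' : (1 : ℝ) ≤ freqNorm k := by exact_mod_cast freqNorm_pos hk
        have h1 : 0 < y (freqNorm k) := by simp only [hy]; positivity
        have h2 : y (freqNorm k) ≤ gapConst d * torusGap k := by
          simp only [hy]; gcongr; exact sq_freqNorm_le_torusGap hk
        have h3 : 0 < gapConst d * torusGap k := h1.trans_le h2
        gcongr
    _ ≤ 2 * d * 3 ^ (d - 1) * ((2 * (n : ℝ) + 1)⁻¹
        * ∑ a ∈ Finset.Icc 1 n, (a / (2 * n + 1) : ℝ) ^ 2 * (s / ((s + y a) * y a))) :=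
        sum_freqNorm_le hd hn (F := fun a => s / ((s + y a) * y a))
          fun a => by have := hy0 a; positivity
    -- The bound with the exponent `1/4` leaves the sum over `a` of `(a / (2n + 1))^{-1/2}`.
    _ ≤ 2 * d * 3 ^ (d - 1) * ((2 * (n : ℝ) + 1)⁻¹ * ∑ a ∈ Finset.Icc 1 n,
        (gapConst d * 16)⁻¹
          * (√√(s / (gapConst d * 16)) * (√(2 * (n : ℝ) + 1) * (√(a : ℝ))⁻¹))) := by
        refine mul_le_mul_of_nonneg_left (mul_le_mul_of_nonneg_left
          (Finset.sum_le_sum fun a ha => ?_) (by positivity)) (by positivity)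
        have ha1 : (1 : ℝ) ≤ a := by exact_mod_cast (Finset.mem_Icc.1 ha).1
        have hya : 0 < y a := by simp only [hy]; positivity
        have e1 : (a / (2 * n + 1) : ℝ) ^ 2 * (s / ((s + y a) * y a))
            = (gapConst d * 16)⁻¹ * (s / (s + y a)) := by
          have : y a = (gapConst d * 16) * (a / (2 * n + 1) : ℝ) ^ 2 := by simp only [hy]; ring
          have h3 : (a / (2 * n + 1) : ℝ) ^ 2 = (gapConst d * 16)⁻¹ * y a := by
            rw [this, inv_mul_cancel_left₀ (by positivity)]
          rw [h3]
          field_simp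
        rw [e1]
        gcongr
        refine (div_add_le_sqrt_sqrt hs hya).trans (le_of_eq ?_)
        have e2 : s / y a = s / (gapConst d * 16) * ((2 * (n : ℝ) + 1) / a) ^ 2 := by
          simp only [hy]; field_simp
        rw [e2, Real.sqrt_mul (by positivity), Real.sqrt_sq (by positivity),
          Real.sqrt_mul (Real.sqrt_nonneg _), Real.sqrt_div hN.le,
          div_eq_mul_inv (√(2 * (n : ℝ) + 1))]
    _ = 2 * d * 3 ^ (d - 1) * ((gapConst d * 16)⁻¹ * (√√(s / (gapConst d * 16))
        * ((2 * (n : ℝ) + 1)⁻¹ * √(2 * (n : ℝ) + 1) * ∑ a ∈ Finset.Icc 1 n, (√(a : ℝ))⁻¹))) := by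
        simp only [← Finset.mul_sum]
        ring
    _ ≤ freqModulus d s := by
        unfold freqModulus
        gcongr
        have h1 : 0 < √(2 * (n : ℝ) + 1) := Real.sqrt_pos.2 hN
        have h2 : √(2 * (n : ℝ) + 1) * √(2 * (n : ℝ) + 1) = 2 * n + 1 :=
          Real.mul_self_sqrt hN.le
        have h3 : √(n : ℝ) ≤ √(2 * (n : ℝ) + 1) := Real.sqrt_le_sqrt (by linarith)
        calc (2 * (n : ℝ) + 1)⁻¹ * √(2 * (n : ℝ) + 1) * ∑ a ∈ Finset.Icc 1 n, (√(a : ℝ))⁻¹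
            ≤ (2 * (n : ℝ) + 1)⁻¹ * √(2 * (n : ℝ) + 1) * (2 * √(2 * (n : ℝ) + 1)) := by
              gcongr
              exact (sum_inv_sqrt_le n).trans (by linarith)
          _ = 2 * ((2 * (n : ℝ) + 1)⁻¹ * (√(2 * (n : ℝ) + 1) * √(2 * (n : ℝ) + 1))) := by ring
          _ = 2 := by rw [h2, inv_mul_cancel₀ hN.ne', mul_one]

end FrequencySums


/-! ### Functions of self-adjoint operators -/

section OpFun

variable {E : Type*} [NormedAddCommGroup E] [InnerProductSpace ℂ E] [CompleteSpace E]

theorem inner_opFun_left (T : E →L[ℂ] E) (f : ℝ → ℝ) (x y : E) :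
    inner ℂ (opFun f T x) y = inner ℂ x (opFun f T y) := inner_cfc_left f x y

theorem opFun_sqrt_opFun_sqrt {H : E →L[ℂ] E} (hH : 0 ≤ H) (x : E) :
    opFun Real.sqrt H (opFun Real.sqrt H x) = H x := sqrt_apply_sqrt_apply hH x

theorem inverse_smul_add_eq_opFun {H : E →L[ℂ] E} (hH : 0 ≤ H) {s : ℝ} (hs : 0 < s) :
    Ring.inverse ((s : ℂ) • 1 + H) = opFun (shiftedInv s) H := inverse_smul_add_eq_cfc hH hs

theorem exists_opFun_sqrt_apply_eq {H : E →L[ℂ] E} (hH : 0 ≤ H) {ξ : E} {L : ℝ}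
    (hL : Tendsto (fun s => (inner ℂ ξ (opFun (shiftedInv s) H ξ)).re) (𝓝[>] 0) (𝓝 L)) :
    ∃ ζ, opFun Real.sqrt H ζ = ξ := exists_sqrt_apply_eq hH hL

theorem tendsto_inner_opFun_shiftedInv {H : E →L[ℂ] E} (hH : 0 ≤ H)
    (hinj : Function.Injective H) (x y : E) :
    Tendsto (fun s => inner ℂ (opFun Real.sqrt H x)
      (opFun (shiftedInv s) H (opFun Real.sqrt H y))) (𝓝[>] 0) (𝓝 (inner ℂ x y)) :=
  tendsto_inner_cfc_shiftedInv hH hinj x y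

end OpFun

/-! ### Infinite volume limits of the hopping operators -/

section StrongLimits

variable {d n : ℕ}

theorem dense_span_delta {V : Type*} :
    Dense (Submodule.span ℂ (Set.range (delta : V → Ell2 V)) : Set (Ell2 V)) := by
  rw [Submodule.dense_iff_topologicalClosure_eq_top, Submodule.topologicalClosure_eq_top_iff,
    Submodule.eq_bot_iff]
  intro f hf
  ext x
  rw [← inner_delta_left]
  exact hf (delta x) (Submodule.subset_span ⟨x, rfl⟩)

theorem tendsto_of_tendsto_delta {V : Type*} {T : ℕ → Ell2 V →L[ℂ] Ell2 V}
    {S : Ell2 V →L[ℂ] Ell2 V} {C : ℝ} (hT : ∀ n, ‖T n‖ ≤ C)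
    (h : ∀ x, Tendsto (fun n => T n (delta x)) atTop (𝓝 (S (delta x)))) (f : Ell2 V) :
    Tendsto (fun n => T n f) atTop (𝓝 (S f)) := by
  refine tendsto_of_dense_of_bounded (C := C + ‖S‖)
    (add_nonneg ((norm_nonneg _).trans (hT 0)) (norm_nonneg _))
    (Eventually.of_forall fun n => (norm_sub_le _ _).trans (add_le_add_left (hT n) _))
    dense_span_delta (fun g hg => ?_) f
  induction hg using Submodule.span_induction with
  | mem g hg => obtain ⟨x, rfl⟩ := hg; exact h x
  | zero => simp
  | add a b _ _ ha hb => simpa using ha.add hb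
  | smul c a _ ha => simpa using ha.const_smul c

theorem valMinAbs_intCast_of_abs_le {a : ℤ} (ha : |a| ≤ n) :
    ((a : ℤ) : ZMod (2 * n + 1)).valMinAbs = a := by
  rw [ZMod.valMinAbs_spec]
  refine ⟨rfl, ?_⟩
  rw [abs_le] at ha
  rw [Set.mem_Ioc]
  push_cast
  omega

theorem finiteEmb_intCast {x : CombVertex d} (hx1 : ∀ l, |x.1 l| ≤ n)
    (hx2 : x.2 ∈ Set.Icc (-(n : ℤ)) n) :
    finiteEmb d n (fun l => (x.1 l : ZMod (2 * n + 1)), ⟨x.2, hx2⟩) = x :=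
  Prod.ext (funext fun l => valMinAbs_intCast_of_abs_le (hx1 l)) rfl

/-- In the interior of `Λ_n` the hopping operators of `Λ_n` and of `G^d` agree. -/
theorem finiteCombAdj_apply_of_lt (f : Ell2 (CombVertex d)) {x : CombVertex d}
    (hx1 : ∀ l, |x.1 l| < n) (hx2 : |x.2| < n) : finiteCombAdj d n f x = combAdj d f x := by
  have hn : 1 ≤ n := by have := abs_nonneg x.2; omega
  have hI : ∀ a : ℤ, |a| ≤ n → a ∈ Set.Icc (-(n : ℤ)) n := fun a ha => abs_le.1 ha
  set p : FiniteCombVertex d n := (fun l => (x.1 l : ZMod (2 * n + 1)), ⟨x.2, hI _ hx2.le⟩) with hp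
  have hpx : finiteEmb d n p = x := finiteEmb_intCast (fun l => (hx1 l).le) (hI _ hx2.le)
  set g : ℤ → ℂ := fun a => if a ∈ Set.Icc (-(n : ℤ)) n then f (x.1, a) else 0 with hg
  have hshift : ∀ (l : Fin d) (e : ℤ), |e| ≤ 1 →
      finiteEmb d n (p.1 + Pi.single l (e : ZMod (2 * n + 1)), chainOrigin n)
        = (x.1 + Pi.single l e, 0) := by
    intro l e he
    have h1 : ∀ l', |(x.1 + Pi.single l e : Fin d → ℤ) l'| ≤ (n : ℤ) := by
      intro l'
      have := hx1 l'
      rw [Pi.add_apply]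
      by_cases hl : l' = l
      · subst hl
        rw [Pi.single_eq_same]
        have := abs_add_le (x.1 l') e
        omega
      · rw [Pi.single_eq_of_ne hl, add_zero]; exact this.le
    have h2 := finiteEmb_intCast (x := ((x.1 + Pi.single l e, 0) : CombVertex d)) h1
      (hI 0 (by simp))
    rw [← h2]
    congr 2
    ext l'
    simp only [hp, Pi.add_apply]
    by_cases hl : l' = l
    · subst hl; simp
    · simp [hl]
  have h1 : ∀ l, finiteEmb d n (p.1 + Pi.single l 1, chainOrigin n) = (x.1 + Pi.single l 1, 0) :=
    fun l => by simpa using hshift l 1 (by simp)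
  have h2 : ∀ l, finiteEmb d n (p.1 - Pi.single l 1, chainOrigin n) = (x.1 - Pi.single l 1, 0) :=
    fun l => by simpa [sub_eq_add_neg, Pi.single_neg] using hshift l (-1) (by simp)
  rw [combAdj_apply, finiteCombAdj, adjOp_apply]
  conv_lhs => rw [← hpx]
  rw [sum_finiteCombGraph hn p _ g (fun a ha => if_neg ha) (fun c => by
    rw [hg]
    simp only [if_pos c.2]
    exact congrArg f (Prod.ext (congrArg Prod.fst hpx).symm rfl))]
  simp only [h1, h2]
  have hx2' := abs_lt.1 hx2
  have e1 : g (x.2 - 1) = f (x.1, x.2 - 1) := if_pos ⟨by omega, by omega⟩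
  have e2 : g (x.2 + 1) = f (x.1, x.2 + 1) := if_pos ⟨by omega, by omega⟩
  change g (x.2 - 1) + g (x.2 + 1) + (if x.2 = 0 then _ else _) = _
  rw [e1, e2]

theorem eventually_interior (x : CombVertex d) :
    ∀ᶠ n : ℕ in atTop, (∀ l, |x.1 l| < n) ∧ |x.2| < n := by
  have h : ∀ a : ℤ, ∀ᶠ n : ℕ in atTop, |a| < n := fun a => by
    filter_upwards [eventually_gt_atTop a.natAbs] with n hn
    rw [Int.abs_eq_natAbs]
    exact_mod_cast hn
  exact (eventually_all.2 fun l => h (x.1 l)).and (h x.2)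

theorem isSelfAdjoint_combAdj (d : ℕ) : IsSelfAdjoint (combAdj d) := isSelfAdjoint_adjOp _ _

theorem tendsto_finiteCombAdj (f : Ell2 (CombVertex d)) :
    Tendsto (fun n => finiteCombAdj d n f) atTop (𝓝 (combAdj d f)) := by
  refine tendsto_of_tendsto_delta (norm_finiteCombAdj_le d) (fun x => ?_) f
  refine tendsto_const_nhds.congr' ?_
  filter_upwards [eventually_interior x] with n hn
  ext y
  have h1 : finiteCombAdj d n (delta x) y = conj (finiteCombAdj d n (delta y) x) := by
    rw [← inner_delta_left, ← inner_finiteCombAdj_left, inner_delta_right]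
  have h2 : combAdj d (delta x) y = conj (combAdj d (delta y) x) := by
    rw [← inner_delta_left, ← ContinuousLinearMap.adjoint_inner_left,
      ← ContinuousLinearMap.star_eq_adjoint, (isSelfAdjoint_combAdj d).star_eq, inner_delta_right]
  rw [h1, h2, finiteCombAdj_apply_of_lt _ hn.1 hn.2]

theorem tendsto_cutoff (f : Ell2 ℤ) : Tendsto (fun n => cutoff n f) atTop (𝓝 f) := by
  refine tendsto_of_tendsto_delta (S := 1) (fun n => norm_cutoff_le) (fun i => ?_) f
  refine tendsto_const_nhds.congr' ?_
  filter_upwards [eventually_ge_atTop i.natAbs] with n hn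
  classical
  ext j
  rw [cutoff_apply]
  split_ifs with h
  · rfl
  · rw [Set.mem_Icc] at h
    rw [one_apply_eq_self, delta_apply, if_neg]
    omega

end StrongLimits

/-! ### Resolvents of the finite comb -/

section FiniteResolvent

variable {d n : ℕ}

theorem finiteHam_neg (hd : 1 ≤ d) (s : ℝ) : finiteHam d n (-s)
    = ((combTop d + s : ℝ) : ℂ) • (1 : Ell2 (CombVertex d) →L[ℂ] _) - finiteCombAdj d n := by
  rw [finiteHam, norm_combAdj hd, sub_neg_eq_add]

theorem le_re_inner_finiteHam (hd : 1 ≤ d) (s : ℝ) (x : Ell2 (CombVertex d)) :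
    s * ‖x‖ ^ 2 ≤ (inner ℂ x (finiteHam d n (-s) x)).re := by
  rw [finiteHam_neg hd]
  refine le_trans (le_of_eq ?_) (re_inner_smul_one_sub
    (re_inner_le_of_norm_le (norm_finiteCombAdj_le d n)) (combTop d + s) x)
  ring

theorem isSelfAdjoint_real_smul_one_sub {E : Type*} [NormedAddCommGroup E] [InnerProductSpace ℂ E]
    [CompleteSpace E] {T : E →L[ℂ] E} (hT : IsSelfAdjoint T) (c : ℝ) :
    IsSelfAdjoint ((c : ℂ) • (1 : E →L[ℂ] E) - T) := by
  refine IsSelfAdjoint.sub ?_ hT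
  rw [IsSelfAdjoint, star_smul, star_one, Complex.star_def, Complex.conj_ofReal]

theorem smul_one_sub_nonneg {E : Type*} [NormedAddCommGroup E] [InnerProductSpace ℂ E]
    [CompleteSpace E] {T : E →L[ℂ] E} (hT : IsSelfAdjoint T) {C : ℝ} (hC : ‖T‖ ≤ C) :
    0 ≤ (C : ℂ) • (1 : E →L[ℂ] E) - T := by
  rw [ContinuousLinearMap.nonneg_iff_isPositive, ContinuousLinearMap.isPositive_def']
  refine ⟨isSelfAdjoint_real_smul_one_sub hT C, fun x => ?_⟩
  have h := re_inner_smul_one_sub (re_inner_le_of_norm_le hC) C x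
  rw [sub_self, zero_mul] at h
  rw [ContinuousLinearMap.reApplyInnerSelf_apply, inner_re_symm]
  exact h

theorem isSelfAdjoint_finiteHam (μ : ℝ) : IsSelfAdjoint (finiteHam d n μ) :=
  isSelfAdjoint_real_smul_one_sub (isSelfAdjoint_finiteCombAdj d n) _

theorem isUnit_finiteHam (hd : 1 ≤ d) {s : ℝ} (hs : 0 < s) : IsUnit (finiteHam d n (-s)) :=
  isUnit_of_le_re_inner hs (le_re_inner_finiteHam hd s)

variable (d n) in
/-- The resolvent `(‖A‖ + s - A_{Λ_n})⁻¹`. -/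
noncomputable def finiteRes (s : ℝ) : Ell2 (CombVertex d) →L[ℂ] Ell2 (CombVertex d) :=
  Ring.inverse (finiteHam d n (-s))

theorem finiteHam_finiteRes (hd : 1 ≤ d) {s : ℝ} (hs : 0 < s) (ξ : Ell2 (CombVertex d)) :
    finiteHam d n (-s) (finiteRes d n s ξ) = ξ :=
  apply_inverse_apply (isUnit_finiteHam hd hs) ξ

theorem norm_finiteRes_le (hd : 1 ≤ d) {s : ℝ} (hs : 0 < s) (ξ : Ell2 (CombVertex d)) :
    ‖finiteRes d n s ξ‖ ≤ ‖ξ‖ / s :=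
  norm_inverse_apply_le hs (le_re_inner_finiteHam hd s) ξ

theorem finiteRes_sub_finiteRes (hd : 1 ≤ d) {s t : ℝ} (hs : 0 < s) (ht : 0 < t)
    (ξ : Ell2 (CombVertex d)) : finiteRes d n s ξ - finiteRes d n t ξ
      = ((t - s : ℝ) : ℂ) • finiteRes d n s (finiteRes d n t ξ) := by
  set y := finiteRes d n t ξ with hy
  have h1 : ξ = finiteHam d n (-s) y + ((t - s : ℝ) : ℂ) • y := by
    conv_lhs => rw [← finiteHam_finiteRes (n := n) hd ht ξ]
    rw [finiteHam_neg hd, finiteHam_neg hd, ← hy]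
    simp only [sub_apply, smul_apply, one_apply_eq_self]
    push_cast
    module
  conv_lhs => rw [h1]
  rw [map_add, map_smul, finiteRes, inverse_apply_eq_of_apply_eq (isUnit_finiteHam hd hs) rfl]
  abel

theorem modeCoeff_finiteHam (hd : 1 ≤ d) (hn : 1 ≤ n) (s : ℝ) (k : Fin d → ZMod (2 * n + 1))
    (ξ : Ell2 (CombVertex d)) : modeCoeff k (finiteHam d n (-s) ξ)
      = (((combTop d + s : ℝ) : ℂ) • (1 : Ell2 ℤ →L[ℂ] Ell2 ℤ) - fibreAdj n (torusEigenvalue k))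
        (modeCoeff k ξ) := by
  rw [finiteHam_neg hd]
  simp only [sub_apply, smul_apply, one_apply_eq_self, map_sub, map_smul,
    modeCoeff_finiteCombAdj hn]

theorem norm_modeCoeff_finiteRes_le (hd : 1 ≤ d) (hn : 1 ≤ n) {s : ℝ} (hs : 0 < s)
    (k : Fin d → ZMod (2 * n + 1)) (ξ : Ell2 (CombVertex d)) :
    ‖modeCoeff k (finiteRes d n s ξ)‖ ≤ ‖modeCoeff k ξ‖ / (s + gapConst d * torusGap k) := by
  have hpos : 0 < s + gapConst d * torusGap k :=
    add_pos_of_pos_of_nonneg hs (mul_nonneg (gapConst_pos hd).le (torusGap_nonneg k))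
  have h := mul_norm_le_norm_apply (le_re_inner_fibre hd hn k s) (modeCoeff k (finiteRes d n s ξ))
  rw [← modeCoeff_finiteHam hd hn, finiteHam_finiteRes hd hs] at h
  rw [le_div_iff₀ hpos]
  linarith

/-- Outside the box the resolvent is multiplication by `(‖A‖ + s)⁻¹ ≤ 1`. -/
theorem norm_finiteRes_sub_boxProj_le (hd : 1 ≤ d) {s : ℝ} (hs : 0 < s)
    (ξ : Ell2 (CombVertex d)) :
    ‖finiteRes d n s ξ - boxProj d n (finiteRes d n s ξ)‖ ≤ ‖ξ - boxProj d n ξ‖ := by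
  set y := finiteRes d n s ξ with hy
  have h1 : ξ - boxProj d n ξ = ((combTop d + s : ℝ) : ℂ) • (y - boxProj d n y) := by
    conv_lhs => rw [← finiteHam_finiteRes (n := n) hd hs ξ]
    rw [finiteHam_neg hd, ← hy]
    simp only [sub_apply, smul_apply, one_apply_eq_self, map_sub, map_smul, boxProj_finiteCombAdj]
    module
  have := two_lt_combTop hd
  rw [h1, norm_smul, Complex.norm_of_nonneg (by linarith)]
  exact le_mul_of_one_le_left (norm_nonneg _) (by linarith)

/-! ### Rapidly decreasing vectors -/

/-- The sum of the fibre norms. -/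
noncomputable def fibreSum (ξ : Ell2 (CombVertex d)) : ℝ := ∑' j, ‖fibre ξ j‖

theorem summable_norm_fibre {ξ : Ell2 (CombVertex d)} (hξ : ξ ∈ rapidSpace d) :
    Summable fun j => ‖fibre ξ j‖ := by
  obtain ⟨C, hC⟩ := hξ (2 * d)
  refine ((summable_inv_one_add_norm_pow d).mul_left C).of_nonneg_of_le (fun j => norm_nonneg _)
    fun j => ?_
  rw [← div_eq_mul_inv, le_div_iff₀ (by positivity), mul_comm]
  exact hC j

theorem fibreSum_nonneg (ξ : Ell2 (CombVertex d)) : 0 ≤ fibreSum ξ :=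
  tsum_nonneg fun _ => norm_nonneg _

/-- The representative in `[-n, n]^d` of a point of the torus. -/
def baseEmb (j : Fin d → ZMod (2 * n + 1)) : Fin d → ℤ := fun i => (j i).valMinAbs

theorem baseEmb_injective : Function.Injective (baseEmb : (Fin d → ZMod (2 * n + 1)) → _) :=
  fun _ _ h => funext fun i => ZMod.injective_valMinAbs (congrFun h i)

theorem modeCoeff_eq_sum_fibre (k : Fin d → ZMod (2 * n + 1)) (ξ : Ell2 (CombVertex d)) :
    modeCoeff k ξ = (modeNorm d n : ℂ) • ∑ j, conj (torusChar k j) •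
      cutoff n (fibre ξ (baseEmb j)) := by
  ext i
  rw [lp.coeFn_smul, Pi.smul_apply, lp.coeFn_sum, Finset.sum_apply]
  simp only [lp.coeFn_smul, Pi.smul_apply, cutoff_apply, smul_eq_mul]
  by_cases hi : i ∈ Set.Icc (-(n : ℤ)) n
  · have := modeCoeff_apply k ξ ⟨i, hi⟩
    simp only at this
    rw [this, Finset.mul_sum]
    refine Finset.sum_congr rfl fun j _ => ?_
    rw [if_pos hi, mul_assoc]
    rfl
  · rw [modeCoeff_apply_of_notMem k ξ hi]
    simp [hi]

theorem norm_modeCoeff_le (k : Fin d → ZMod (2 * n + 1)) {ξ : Ell2 (CombVertex d)}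
    (hξ : ξ ∈ rapidSpace d) : ‖modeCoeff k ξ‖ ≤ modeNorm d n * fibreSum ξ := by
  rw [modeCoeff_eq_sum_fibre, norm_smul, Complex.norm_of_nonneg modeNorm_pos.le]
  have h := summable_norm_fibre hξ
  gcongr
  · exact modeNorm_pos.le
  calc ‖∑ j, conj (torusChar k j) • cutoff n (fibre ξ (baseEmb j))‖
      ≤ ∑ j, ‖fibre ξ (baseEmb j)‖ := norm_sum_le_of_le _ fun j _ => by
        rw [norm_smul, RCLike.norm_conj, norm_torusChar, one_mul]
        exact norm_cutoff_apply_le _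
    _ = ∑' j, ‖fibre ξ (baseEmb j)‖ := (tsum_fintype _).symm
    _ ≤ fibreSum ξ := tsum_comp_le_tsum_of_inj h (fun _ => norm_nonneg _) baseEmb_injective

/-! ### The contribution of the nonzero frequencies -/

variable (n) in
/-- The matrix element of the resolvent without the contribution of the zero frequency. -/
noncomputable def regularPart (η ξ : Ell2 (CombVertex d)) (s : ℝ) : ℂ :=
  inner ℂ η (finiteRes d n s ξ)
    - inner ℂ (modeCoeff (n := n) 0 η) (modeCoeff (n := n) 0 (finiteRes d n s ξ))

/-- The common modulus of continuity at zero energy of the regular parts. -/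
noncomputable def regularModulus (η ξ : Ell2 (CombVertex d)) (s : ℝ) : ℝ :=
  s * (‖η‖ * ‖ξ‖) + fibreSum η * fibreSum ξ * freqModulus d s

theorem tendsto_regularModulus (η ξ : Ell2 (CombVertex d)) :
    Tendsto (regularModulus η ξ) (𝓝 0) (𝓝 0) := by
  have h := (tendsto_id (α := ℝ) (x := 𝓝 0)).mul_const (‖η‖ * ‖ξ‖)
  have h2 := (tendsto_freqModulus d).const_mul (fibreSum η * fibreSum ξ)
  have h3 := h.add h2
  simp only [zero_mul, mul_zero, add_zero] at h3
  exact h3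

/-- The regular parts are equicontinuous at zero energy, uniformly in the volume. This is the step
which needs the base to have dimension at least `3`. -/
theorem norm_regularPart_sub_le (hd : 3 ≤ d) (hn : 1 ≤ n) {η ξ : Ell2 (CombVertex d)}
    (hη : η ∈ rapidSpace d) (hξ : ξ ∈ rapidSpace d) {s t : ℝ} (hs : 0 < s) (hst : s ≤ t) :
    ‖regularPart n η ξ s - regularPart n η ξ t‖ ≤ regularModulus η ξ t := by
  classical
  have hd1 : 1 ≤ d := by omega
  have ht : 0 < t := hs.trans_le hst
  have hκ := gapConst_pos hd1
  set z := finiteRes d n s (finiteRes d n t ξ) with hz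
  have h1 : regularPart n η ξ s - regularPart n η ξ t = ((t - s : ℝ) : ℂ)
      * (inner ℂ η (z - boxProj d n z) + ∑ k : Fin d → ZMod (2 * n + 1) with k ≠ 0,
        inner ℂ (modeCoeff k η) (modeCoeff k z)) := by
    have h2 : regularPart n η ξ s - regularPart n η ξ t
        = inner ℂ η (finiteRes d n s ξ - finiteRes d n t ξ)
          - inner ℂ (modeCoeff (n := n) 0 η)
            (modeCoeff (n := n) 0 (finiteRes d n s ξ - finiteRes d n t ξ)) := by
      simp only [regularPart, map_sub, inner_sub_right]; ring
    rw [h2, finiteRes_sub_finiteRes hd1 hs ht, map_smul, inner_smul_right, inner_smul_right,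
      inner_eq_inner_sub_boxProj_add_sum (n := n) η z,
      ← Finset.sum_filter_add_sum_filter_not Finset.univ (fun k => k ≠ 0)]
    have h3 : (Finset.univ.filter fun k : Fin d → ZMod (2 * n + 1) => ¬ k ≠ 0) = {0} := by
      ext k; simp
    rw [h3, Finset.sum_singleton]
    ring
  have h2 : ‖z - boxProj d n z‖ ≤ ‖ξ‖ :=
    (norm_finiteRes_sub_boxProj_le hd1 hs _).trans ((norm_finiteRes_sub_boxProj_le hd1 ht _).trans
      (norm_sub_boxProj_le ξ))
  have h3 : ∀ k : Fin d → ZMod (2 * n + 1), k ≠ 0 →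
      (t - s) * ‖(inner ℂ (modeCoeff k η) (modeCoeff k z) : ℂ)‖ ≤ fibreSum η * fibreSum ξ
        * (modeNorm d n ^ 2
          * (t / ((t + gapConst d * torusGap k) * (gapConst d * torusGap k)))) := by
    intro k hk
    have hε := mul_pos hκ (torusGap_pos hk)
    have e1 := norm_modeCoeff_le k hη
    have e2 := norm_modeCoeff_le k hξ
    have e3 : ‖modeCoeff k z‖ ≤ modeNorm d n * fibreSum ξ / (t + gapConst d * torusGap k)
        / (gapConst d * torusGap k) := by
      refine (norm_modeCoeff_finiteRes_le hd1 hn hs k _).trans ?_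
      have e4 : ‖modeCoeff k (finiteRes d n t ξ)‖
          ≤ modeNorm d n * fibreSum ξ / (t + gapConst d * torusGap k) :=
        (norm_modeCoeff_finiteRes_le hd1 hn ht k ξ).trans (by gcongr)
      have e5 : 0 ≤ ‖modeCoeff k (finiteRes d n t ξ)‖ := norm_nonneg _
      exact div_le_div₀ (e5.trans e4) e4 hε (by linarith)
    have e4 : 0 ≤ modeNorm d n * fibreSum η := (norm_nonneg _).trans e1
    calc (t - s) * ‖(inner ℂ (modeCoeff k η) (modeCoeff k z) : ℂ)‖
        ≤ t * ((modeNorm d n * fibreSum η) * (modeNorm d n * fibreSum ξ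
          / (t + gapConst d * torusGap k) / (gapConst d * torusGap k))) := by
          refine mul_le_mul (by linarith) ?_ (norm_nonneg _) ht.le
          exact (norm_inner_le_norm _ _).trans (mul_le_mul e1 e3 (norm_nonneg _) e4)
      _ = _ := by rw [div_div]; ring
  rw [h1, norm_mul, Complex.norm_of_nonneg (by linarith)]
  calc (t - s) * ‖inner ℂ η (z - boxProj d n z) + ∑ k : Fin d → ZMod (2 * n + 1) with k ≠ 0,
        inner ℂ (modeCoeff k η) (modeCoeff k z)‖
      ≤ (t - s) * (‖η‖ * ‖ξ‖ + ∑ k : Fin d → ZMod (2 * n + 1) with k ≠ 0,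
        ‖(inner ℂ (modeCoeff k η) (modeCoeff k z) : ℂ)‖) := by
        refine mul_le_mul_of_nonneg_left ?_ (by linarith)
        refine (norm_add_le _ _).trans (add_le_add ?_ (norm_sum_le _ _))
        exact (norm_inner_le_norm _ _).trans (by gcongr)
    _ = (t - s) * (‖η‖ * ‖ξ‖) + ∑ k : Fin d → ZMod (2 * n + 1) with k ≠ 0,
        (t - s) * ‖(inner ℂ (modeCoeff k η) (modeCoeff k z) : ℂ)‖ := by
        rw [mul_add, Finset.mul_sum]
    _ ≤ t * (‖η‖ * ‖ξ‖) + ∑ k : Fin d → ZMod (2 * n + 1) with k ≠ 0, fibreSum η * fibreSum ξ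
        * (modeNorm d n ^ 2
          * (t / ((t + gapConst d * torusGap k) * (gapConst d * torusGap k)))) := by
        refine add_le_add ?_ (Finset.sum_le_sum fun k hk => h3 k (Finset.mem_filter.1 hk).2)
        gcongr
        linarith
    _ ≤ regularModulus η ξ t := by
        rw [← Finset.mul_sum, ← Finset.mul_sum, regularModulus]
        have := sum_torusGap_modulus_le hd hn ht
        have := fibreSum_nonneg η
        have := fibreSum_nonneg ξ
        gcongr

/-- At a fixed energy `s` the zero mode is negligible in large volume. -/
theorem norm_zeroMode_le (hd : 1 ≤ d) (hn : 1 ≤ n) {η ξ : Ell2 (CombVertex d)}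
    (hη : η ∈ rapidSpace d) (hξ : ξ ∈ rapidSpace d) {s : ℝ} (hs : 0 < s) :
    ‖(inner ℂ (modeCoeff (n := n) 0 η) (modeCoeff (n := n) 0 (finiteRes d n s ξ)) : ℂ)‖
      ≤ modeNorm d n ^ 2 * (fibreSum η * fibreSum ξ / s) := by
  have e1 := norm_modeCoeff_le (n := n) 0 hη
  have e2 := norm_modeCoeff_le (n := n) 0 hξ
  have e3 := norm_modeCoeff_finiteRes_le hd hn hs 0 ξ
  have e0 : torusGap (0 : Fin d → ZMod (2 * n + 1)) = 0 := by
    rw [torusGap, torusEigenvalue_zero, sub_self]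
  rw [e0, mul_zero, add_zero] at e3
  calc _ ≤ (modeNorm d n * fibreSum η) * (modeNorm d n * fibreSum ξ / s) :=
        (norm_inner_le_norm _ _).trans (mul_le_mul e1 (e3.trans (by gcongr)) (norm_nonneg _)
          ((norm_nonneg _).trans e1))
    _ = _ := by ring

theorem tendsto_modeNorm_sq (hd : 1 ≤ d) :
    Tendsto (fun n => modeNorm d n ^ 2) atTop (𝓝 0) := by
  simp only [modeNorm_sq]
  refine tendsto_inv_atTop_zero.comp ((tendsto_pow_atTop (by omega)).comp ?_)
  exact tendsto_atTop_add_const_right _ _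
    (tendsto_natCast_atTop_atTop.const_mul_atTop (by norm_num))

theorem combHam_eq (hd : 1 ≤ d) : combHam d
    = (combTop d : ℂ) • (1 : Ell2 (CombVertex d) →L[ℂ] _) - combAdj d := by
  rw [combHam, norm_combAdj hd]

theorem combHam_nonneg (hd : 1 ≤ d) : 0 ≤ combHam d := by
  rw [combHam_eq hd]
  exact smul_one_sub_nonneg (isSelfAdjoint_combAdj d) norm_combAdj_le

/-- Strong resolvent convergence at a fixed positive energy, by the second resolvent identity. -/
theorem tendsto_finiteRes (hd : 1 ≤ d) {s : ℝ} (hs : 0 < s) (ξ : Ell2 (CombVertex d)) :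
    Tendsto (fun n => finiteRes d n s ξ) atTop (𝓝 (opFun (shiftedInv s) (combHam d) ξ)) := by
  rw [← inverse_smul_add_eq_opFun (combHam_nonneg hd) hs]
  have e : (s : ℂ) • (1 : Ell2 (CombVertex d) →L[ℂ] _) + combHam d
      = ((combTop d + s : ℝ) : ℂ) • (1 : Ell2 (CombVertex d) →L[ℂ] _) - combAdj d := by
    rw [combHam_eq hd]; push_cast; module
  rw [e]
  set K : Ell2 (CombVertex d) →L[ℂ] Ell2 (CombVertex d) :=
    ((combTop d + s : ℝ) : ℂ) • 1 - combAdj d with hK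
  have hlow : ∀ x, s * ‖x‖ ^ 2 ≤ (inner ℂ x (K x)).re := fun x =>
    le_trans (le_of_eq (by ring)) (re_inner_smul_one_sub
      (re_inner_le_of_norm_le (norm_combAdj_le (d := d))) (combTop d + s) x)
  set y := Ring.inverse K ξ with hy
  have hξ : K y = ξ := apply_inverse_apply (isUnit_of_le_re_inner hs hlow) ξ
  have h1 : ∀ n, finiteRes d n s ξ - y = finiteRes d n s (finiteCombAdj d n y - combAdj d y) := by
    intro n
    have h2 : finiteRes d n s (finiteHam d n (-s) y) = y :=
      inverse_apply_eq_of_apply_eq (isUnit_finiteHam hd hs) rfl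
    conv_lhs => rw [← h2]
    rw [← map_sub, ← hξ, hK, finiteHam_neg hd]
    congr 1
    simp only [sub_apply]
    abel
  rw [tendsto_iff_norm_sub_tendsto_zero]
  have h3 := (tendsto_iff_norm_sub_tendsto_zero.1 (tendsto_finiteCombAdj y)).div_const s
  rw [zero_div] at h3
  refine squeeze_zero (fun _ => norm_nonneg _) (fun n => ?_) h3
  rw [h1]
  exact norm_finiteRes_le hd hs _

theorem tendsto_regularPart (hd : 1 ≤ d) {η ξ : Ell2 (CombVertex d)}
    (hη : η ∈ rapidSpace d) (hξ : ξ ∈ rapidSpace d) {s : ℝ} (hs : 0 < s) :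
    Tendsto (fun n => regularPart n η ξ s) atTop
      (𝓝 (inner ℂ η (opFun (shiftedInv s) (combHam d) ξ))) := by
  have h1 : Tendsto (fun n => inner ℂ η (finiteRes d n s ξ)) atTop
      (𝓝 (inner ℂ η (opFun (shiftedInv s) (combHam d) ξ))) :=
    tendsto_const_nhds.inner (tendsto_finiteRes hd hs ξ)
  have h2 : Tendsto (fun n => (inner ℂ (modeCoeff (n := n) 0 η)
      (modeCoeff (n := n) 0 (finiteRes d n s ξ)) : ℂ)) atTop (𝓝 0) := by
    have h3 := (tendsto_modeNorm_sq hd).mul_const (fibreSum η * fibreSum ξ / s)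
    rw [zero_mul] at h3
    refine squeeze_zero_norm' ?_ h3
    filter_upwards [eventually_ge_atTop 1] with n hn
    exact norm_zeroMode_le hd hn hη hξ hs
  simpa [regularPart] using h1.sub h2

/-- The bound on the regular parts survives the infinite volume limit, in which the zero mode
disappears. -/
theorem norm_inner_shiftedInv_sub_le (hd : 3 ≤ d) {η ξ : Ell2 (CombVertex d)}
    (hη : η ∈ rapidSpace d) (hξ : ξ ∈ rapidSpace d) {s t : ℝ} (hs : 0 < s) (hst : s ≤ t) :
    ‖(inner ℂ η (opFun (shiftedInv s) (combHam d) ξ) : ℂ)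
      - inner ℂ η (opFun (shiftedInv t) (combHam d) ξ)‖ ≤ regularModulus η ξ t := by
  have h1 := (tendsto_regularPart (by omega) hη hξ hs).sub
    (tendsto_regularPart (by omega) hη hξ (hs.trans_le hst))
  refine le_of_tendsto h1.norm ?_
  filter_upwards [eventually_ge_atTop 1] with n hn
  exact norm_regularPart_sub_le hd hn hη hξ hs hst

/-- The matrix elements of the resolvent between rapidly decreasing vectors converge at the bottom
of the spectrum, because the dimension is at least `3`. -/
theorem exists_tendsto_inner_shiftedInv (hd : 3 ≤ d) {η ξ : Ell2 (CombVertex d)}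
    (hη : η ∈ rapidSpace d) (hξ : ξ ∈ rapidSpace d) :
    ∃ L, Tendsto (fun s => (inner ℂ η (opFun (shiftedInv s) (combHam d) ξ) : ℂ)) (𝓝[>] 0)
      (𝓝 L) := by
  rw [← cauchy_map_iff_exists_tendsto, Metric.cauchy_iff]
  refine ⟨inferInstance, fun ε hε => ?_⟩
  have h1 : ∀ᶠ s in 𝓝[>] (0 : ℝ), regularModulus η ξ s < ε ∧ 0 < s :=
    (((tendsto_regularModulus η ξ).mono_left nhdsWithin_le_nhds).eventually (gt_mem_nhds hε)).and
      self_mem_nhdsWithin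
  refine ⟨_, image_mem_map h1, ?_⟩
  rintro _ ⟨s, hs, rfl⟩ _ ⟨t, ht, rfl⟩
  rcases le_total s t with h | h
  · rw [dist_eq_norm]
    exact (norm_inner_shiftedInv_sub_le hd hη hξ hs.2 h).trans_lt ht.1
  · rw [dist_comm, dist_eq_norm]
    exact (norm_inner_shiftedInv_sub_le hd hη hξ ht.2 h).trans_lt hs.1

theorem exists_sqrt_combHam_apply_eq (hd : 3 ≤ d) {ξ : Ell2 (CombVertex d)}
    (hξ : ξ ∈ rapidSpace d) : ∃ ζ, opFun Real.sqrt (combHam d) ζ = ξ := by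
  obtain ⟨L, hL⟩ := exists_tendsto_inner_shiftedInv hd hξ hξ
  exact exists_opFun_sqrt_apply_eq (combHam_nonneg (by omega))
    ((Complex.continuous_re.tendsto L).comp hL)

theorem delta_mem_rapidSpace (x : CombVertex d) : delta x ∈ rapidSpace d := by
  classical
  intro k
  refine ⟨(1 + ‖x.1‖) ^ k * ‖fibre (delta x) x.1‖, fun j => ?_⟩
  by_cases hj : j = x.1
  · rw [hj]
  · have : fibre (delta x) j = 0 := by
      ext i
      change delta x (j, i) = 0
      rw [delta_apply, if_neg fun h => hj (by rw [← h])]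
    rw [this, norm_zero, mul_zero]
    positivity

/-- A vector in the kernel of `H` is orthogonal to the range of `H^{1/2}`, which contains every
`δ_x`. -/
theorem injective_combHam (hd : 3 ≤ d) : Function.Injective (combHam d) := by
  have hH := combHam_nonneg (d := d) (by omega)
  rw [injective_iff_map_eq_zero]
  intro f hf
  have h1 : opFun Real.sqrt (combHam d) f = 0 := by
    rw [← inner_self_eq_zero (𝕜 := ℂ), inner_opFun_left _, opFun_sqrt_opFun_sqrt hH, hf,
      inner_zero_right]
  ext x
  obtain ⟨ζ, hζ⟩ := exists_sqrt_combHam_apply_eq hd (delta_mem_rapidSpace x)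
  rw [← inner_delta_left, ← hζ, inner_opFun_left _, h1, inner_zero_right]
  rfl

/-- The regular parts at energies `s_n → 0` converge to the matrix element of `H⁻¹`. -/
theorem tendsto_regularPart_of_tendsto_zero (hd : 3 ≤ d) {η ξ y z : Ell2 (CombVertex d)}
    (hη : η ∈ rapidSpace d) (hξ : ξ ∈ rapidSpace d) (hy : opFun Real.sqrt (combHam d) y = η)
    (hz : opFun Real.sqrt (combHam d) z = ξ) {s : ℕ → ℝ} (hs : ∀ n, 0 < s n)
    (hs0 : Tendsto s atTop (𝓝 0)) :
    Tendsto (fun n => regularPart n η ξ (s n)) atTop (𝓝 (inner ℂ y z)) := by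
  have hL := tendsto_inner_opFun_shiftedInv (combHam_nonneg (d := d) (by omega))
    (injective_combHam hd) y z
  rw [hy, hz] at hL
  rw [Metric.tendsto_nhds]
  intro ε hε
  obtain ⟨δ, hδ, hδε⟩ := Metric.eventually_nhds_iff.1
    ((tendsto_regularModulus η ξ).eventually (gt_mem_nhds (show 0 < ε / 4 by positivity)))
  have hmod : ∀ t, 0 < t → t < δ → regularModulus η ξ t < ε / 4 := fun t ht htδ =>
    hδε (by rw [Real.dist_eq, sub_zero, abs_of_pos ht]; exact htδ)
  set t := δ / 2 with ht
  have ht0 : 0 < t := by positivity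
  have htδ : t < δ := by rw [ht]; linarith
  have h1 : ‖(inner ℂ y z : ℂ) - inner ℂ η (opFun (shiftedInv t) (combHam d) ξ)‖ ≤ ε / 4 := by
    refine le_of_tendsto (hL.sub_const _).norm ?_
    filter_upwards [Ioc_mem_nhdsGT ht0] with r hr
    exact (norm_inner_shiftedInv_sub_le hd hη hξ hr.1 hr.2).trans (hmod t ht0 htδ).le
  filter_upwards [Metric.tendsto_nhds.1 (tendsto_regularPart (by omega) hη hξ ht0) (ε / 4)
    (by positivity), hs0.eventually (gt_mem_nhds hδ), eventually_ge_atTop 1] with n h2 h3 hn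
  have h4 : ‖regularPart n η ξ (s n) - regularPart n η ξ t‖ ≤ ε / 4 := by
    rcases le_total (s n) t with h | h
    · exact (norm_regularPart_sub_le hd hn hη hξ (hs n) h).trans (hmod t ht0 htδ).le
    · rw [norm_sub_rev]
      exact (norm_regularPart_sub_le hd hn hη hξ ht0 h).trans (hmod _ (hs n) h3).le
  rw [dist_eq_norm] at h2 ⊢
  calc ‖regularPart n η ξ (s n) - inner ℂ y z‖
      = ‖(regularPart n η ξ (s n) - regularPart n η ξ t)
        + (regularPart n η ξ t - inner ℂ η (opFun (shiftedInv t) (combHam d) ξ))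
        - (inner ℂ y z - inner ℂ η (opFun (shiftedInv t) (combHam d) ξ))‖ := by congr 1; ring
    _ ≤ _ := (norm_sub_le _ _).trans (add_le_add_left (norm_add_le _ _) _)
    _ < ε := by linarith

end FiniteResolvent


/-! ### The zero mode -/

section ZeroMode

variable {d n : ℕ}

/-- The operator `A_ℤ + 2d |δ₀⟩⟨δ₀|`, the restriction of the adjacency operator of `G^d` to the
functions that are constant along the base. -/
noncomputable def zeroModeAdj (d : ℕ) : Ell2 ℤ →L[ℂ] Ell2 ℤ :=
  chainAdj + ((2 * d : ℝ) : ℂ) • InnerProductSpace.rankOne ℂ (delta 0) (delta 0)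

theorem zeroModeAdj_apply (f : Ell2 ℤ) :
    zeroModeAdj d f = chainAdj f + (((2 * d : ℝ) : ℂ) * f 0) • delta 0 := by
  rw [zeroModeAdj, add_apply, smul_apply, InnerProductSpace.rankOne_apply, inner_delta_left,
    smul_smul]

theorem fibreAdj_eq (θ : ℝ) (f : Ell2 ℤ) :
    fibreAdj n θ f = cutoff n (chainAdj (cutoff n f)) + ((θ : ℂ) * f 0) • delta 0 := by
  rw [fibreAdj, add_apply, smul_apply, InnerProductSpace.rankOne_apply, inner_delta_left,
    smul_smul]
  rfl

theorem isSelfAdjoint_zeroModeAdj (d : ℕ) : IsSelfAdjoint (zeroModeAdj d) := by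
  have h := isSelfAdjoint_adjOp chainGraph chainGraph_bounded
  rw [IsSelfAdjoint, ContinuousLinearMap.star_eq_adjoint] at h ⊢
  rw [zeroModeAdj, map_add, chainAdj, h, map_smulₛₗ, Complex.conj_ofReal,
    InnerProductSpace.adjoint_rankOne]

theorem zeroModeAdj_fibreGround (hd : 1 ≤ d) :
    zeroModeAdj d (fibreGround hd) = (combTop d : ℂ) • fibreGround hd := by
  rw [zeroModeAdj_apply, fibreGround, map_smul, chainAdj_expVec, lp.coeFn_smul, Pi.smul_apply,
    expVec_apply]
  simp only [Int.natAbs_zero, pow_zero, Complex.ofReal_one, smul_eq_mul, mul_one]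
  push_cast
  module

/-- The eigenspace at the top of the spectrum is spanned by the exponentially decreasing vector:
away from the origin an eigenvector solves the free equation on `ℤ`. -/
theorem eq_smul_fibreGround_of_zeroModeAdj_eq (hd : 1 ≤ d) {f : Ell2 ℤ}
    (hf : zeroModeAdj d f = (combTop d : ℂ) • f) : ∃ a : ℂ, f = a • fibreGround hd := by
  have hinj : Function.Injective ((combTop d : ℂ) • (1 : Ell2 ℤ →L[ℂ] Ell2 ℤ) - chainAdj) :=
    Function.LeftInverse.injective (g := (Ring.inverse
      ((combTop d : ℂ) • (1 : Ell2 ℤ →L[ℂ] Ell2 ℤ) - chainAdj) : Ell2 ℤ →L[ℂ] Ell2 ℤ)) fun x =>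
      inverse_apply_eq_of_apply_eq (isUnit_smul_one_sub_chainAdj (two_lt_combTop hd)) rfl
  have h1 : f = f 0 • expVec hd := by
    apply hinj
    rw [zeroModeAdj_apply] at hf
    simp only [sub_apply, smul_apply, one_apply_eq_self, map_smul]
    rw [← hf, chainAdj_expVec]
    push_cast
    module
  refine ⟨f 0 * ‖expVec hd‖, ?_⟩
  have : (‖expVec hd‖ : ℂ) ≠ 0 := by exact_mod_cast (norm_expVec_pos hd).ne'
  rw [fibreGround, smul_smul, mul_assoc, mul_inv_cancel₀ this, mul_one]
  exact h1

theorem tendsto_fibreAdj (f : Ell2 ℤ) :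
    Tendsto (fun n => fibreAdj n (2 * d) f) atTop (𝓝 (zeroModeAdj d f)) := by
  simp only [fibreAdj_eq, zeroModeAdj_apply]
  refine Tendsto.add_const _ ?_
  have h1 : Tendsto (fun n => cutoff n (chainAdj (cutoff n f) - chainAdj f)) atTop (𝓝 0) := by
    have h2 := ((chainAdj.continuous.tendsto f).comp (tendsto_cutoff f)).sub_const (chainAdj f)
    rw [sub_self] at h2
    exact squeeze_zero_norm (fun n => norm_cutoff_apply_le _)
      (tendsto_zero_iff_norm_tendsto_zero.1 h2)
  simpa using h1.add (tendsto_cutoff (chainAdj f))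

theorem summable_pow_natAbs {r : ℝ} (hr0 : 0 ≤ r) (hr1 : r < 1) :
    Summable fun i : ℤ => r ^ i.natAbs := by
  have h := summable_geometric_of_lt_one hr0 hr1
  exact Summable.of_nat_of_neg (by simpa using h) (by simpa using h)

theorem norm_expVec_sub_cutoff_le (hd : 1 ≤ d) (n : ℕ) : ‖expVec hd - cutoff n (expVec hd)‖
    ≤ √(combRate d) ^ n * √(∑' i : ℤ, combRate d ^ i.natAbs) := by
  have hq := combRate_pos d
  have hs := summable_pow_natAbs hq.le (combRate_lt_one hd)
  have h1 : ‖expVec hd - cutoff n (expVec hd)‖ ^ 2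
      ≤ combRate d ^ n * ∑' i : ℤ, combRate d ^ i.natAbs := by
    rw [norm_sq_eq_tsum, ← tsum_mul_left]
    refine Summable.tsum_le_tsum (fun i => ?_) (summable_norm_sq _) (hs.mul_left _)
    rw [lp.coeFn_sub, Pi.sub_apply, cutoff_apply]
    split_ifs with h
    · rw [sub_self, norm_zero, zero_pow two_ne_zero]; positivity
    · have hi : n ≤ i.natAbs := by rw [Set.mem_Icc] at h; omega
      rw [sub_zero, expVec_apply, Complex.norm_of_nonneg (by positivity), sq]
      exact mul_le_mul_of_nonneg_right
        (pow_le_pow_of_le_one hq.le (combRate_lt_one hd).le hi) (by positivity)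
  rw [← Real.sqrt_le_sqrt_iff (by positivity), Real.sqrt_sq (norm_nonneg _)] at h1
  rwa [Real.sqrt_mul (by positivity), Real.sqrt_eq_iff_mul_self_eq_of_pos (x := combRate d ^ n)
    (y := √(combRate d) ^ n) (by positivity) |>.2 (by
      rw [← mul_pow, Real.mul_self_sqrt hq.le])] at h1

theorem norm_zeroModeAdj_sub_fibreAdj_le (hd : 1 ≤ d) (n : ℕ) :
    ‖zeroModeAdj d (expVec hd) - fibreAdj n (2 * d) (expVec hd)‖
      ≤ (combTop d + 2) * ‖expVec hd - cutoff n (expVec hd)‖ := by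
  have hL := two_lt_combTop hd
  have h0 : cutoff n (delta (0 : ℤ)) = delta 0 := by
    classical
    ext i
    rw [cutoff_apply]
    split_ifs with h
    · rfl
    · rw [delta_apply, if_neg]
      rintro rfl
      simp at h
  have h1 : zeroModeAdj d (expVec hd) - fibreAdj n (2 * d) (expVec hd)
      = (combTop d : ℂ) • (expVec hd - cutoff n (expVec hd))
        + cutoff n (chainAdj (expVec hd - cutoff n (expVec hd))) := by
    rw [zeroModeAdj_apply, fibreAdj_eq, map_sub, map_sub, chainAdj_expVec, map_sub, map_smul,
      map_smul, h0]
    push_cast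
    module
  rw [h1, add_mul]
  refine (norm_add_le _ _).trans (add_le_add (le_of_eq ?_) ?_)
  · rw [norm_smul, Complex.norm_of_nonneg (by linarith)]
  · exact (norm_cutoff_apply_le _).trans (chainAdj.le_of_opNorm_le norm_chainAdj_le _)

variable (d n) in
/-- The resolvent `(‖A‖ + s - A_{Y_n} - θ |δ₀⟩⟨δ₀|)⁻¹` on `ℓ²(ℤ)`. -/
noncomputable def fibreRes (θ s : ℝ) : Ell2 ℤ →L[ℂ] Ell2 ℤ :=
  Ring.inverse (((combTop d + s : ℝ) : ℂ) • (1 : Ell2 ℤ →L[ℂ] Ell2 ℤ) - fibreAdj n θ)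

theorem le_re_inner_zeroMode (hd : 1 ≤ d) (hn : 1 ≤ n) (s : ℝ) (f : Ell2 ℤ) :
    s * ‖f‖ ^ 2 ≤ (inner ℂ f ((((combTop d + s : ℝ) : ℂ) • (1 : Ell2 ℤ →L[ℂ] Ell2 ℤ)
        - fibreAdj n (2 * d)) f)).re := by
  have h := le_re_inner_fibre hd hn 0 s f
  rwa [torusGap, torusEigenvalue_zero, sub_self, mul_zero, add_zero] at h

theorem norm_smul_fibreRes_le (hd : 1 ≤ d) (hn : 1 ≤ n) {s : ℝ} (hs : 0 < s) (f : Ell2 ℤ) :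
    ‖(s : ℂ) • fibreRes d n (2 * d) s f‖ ≤ ‖f‖ := by
  have h := norm_inverse_apply_le hs (le_re_inner_zeroMode hd hn s) f
  rw [le_div_iff₀ hs] at h
  rw [norm_smul, Complex.norm_of_nonneg hs.le, mul_comm]
  exact h

theorem fibreRes_zeroMode_apply (hd : 1 ≤ d) (hn : 1 ≤ n) {s : ℝ} (hs : 0 < s) (f : Ell2 ℤ) :
    fibreRes d n (2 * d) s (((combTop d + s : ℝ) : ℂ) • f - fibreAdj n (2 * d) f) = f :=
  inverse_apply_eq_of_apply_eq (isUnit_of_le_re_inner hs (le_re_inner_zeroMode hd hn s)) rfl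

theorem isUnit_fibre (hd : 1 ≤ d) (hn : 1 ≤ n) {s : ℝ} (hs : 0 < s)
    (k : Fin d → ZMod (2 * n + 1)) : IsUnit (((combTop d + s : ℝ) : ℂ) •
      (1 : Ell2 ℤ →L[ℂ] Ell2 ℤ) - fibreAdj n (torusEigenvalue k)) :=
  isUnit_of_le_re_inner (add_pos_of_pos_of_nonneg hs (mul_nonneg (gapConst_pos hd).le
    (torusGap_nonneg k))) (le_re_inner_fibre hd hn k s)

/-- The resolvent of the finite comb acts on each Fourier mode as the resolvent of a fibre. -/
theorem modeCoeff_finiteRes (hd : 1 ≤ d) (hn : 1 ≤ n) {s : ℝ} (hs : 0 < s)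
    (k : Fin d → ZMod (2 * n + 1)) (ξ : Ell2 (CombVertex d)) :
    modeCoeff k (finiteRes d n s ξ) = fibreRes d n (torusEigenvalue k) s (modeCoeff k ξ) := by
  have h := modeCoeff_finiteHam hd hn s k (finiteRes d n s ξ)
  rw [finiteHam_finiteRes hd hs] at h
  exact (inverse_apply_eq_of_apply_eq (isUnit_fibre hd hn hs k) h.symm).symm

theorem modeCoeff_zero_finiteRes (hd : 1 ≤ d) (hn : 1 ≤ n) {s : ℝ} (hs : 0 < s)
    (ξ : Ell2 (CombVertex d)) : modeCoeff (n := n) 0 (finiteRes d n s ξ)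
      = fibreRes d n (2 * d) s (modeCoeff (n := n) 0 ξ) := by
  rw [modeCoeff_finiteRes hd hn hs, torusEigenvalue_zero]

theorem tendsto_pow_mul_norm_expVec_sub_cutoff (hd : 1 ≤ d) :
    Tendsto (fun n : ℕ => (2 * (n : ℝ) + 1) ^ d * ‖expVec hd - cutoff n (expVec hd)‖) atTop
      (𝓝 0) := by
  have hq : |√(combRate d)| < 1 := by
    rw [abs_of_nonneg (Real.sqrt_nonneg _), Real.sqrt_lt' one_pos, one_pow]
    exact combRate_lt_one hd
  have h1 := (tendsto_pow_const_mul_const_pow_of_abs_lt_one d hq).const_mul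
    (3 ^ d * √(∑' i : ℤ, combRate d ^ i.natAbs))
  rw [mul_zero] at h1
  refine squeeze_zero' (Eventually.of_forall fun n => by positivity) ?_ h1
  filter_upwards [eventually_ge_atTop 1] with n hn
  have hn' : (1 : ℝ) ≤ n := by exact_mod_cast hn
  calc (2 * (n : ℝ) + 1) ^ d * ‖expVec hd - cutoff n (expVec hd)‖
      ≤ (3 * n) ^ d * (√(combRate d) ^ n * √(∑' i : ℤ, combRate d ^ i.natAbs)) := by
        gcongr
        · linarith
        · exact norm_expVec_sub_cutoff_le hd n
    _ = _ := by rw [mul_pow]; ring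

/-- The ground state of the fibre and the range of `‖A‖ - A_ℤ - 2d |δ₀⟩⟨δ₀|` span a dense
subspace, so that strong convergence may be tested on them. -/
theorem dense_range_sup_span (hd : 1 ≤ d) :
    Dense ((LinearMap.range ((combTop d : ℂ) • (1 : Ell2 ℤ →L[ℂ] Ell2 ℤ)
      - zeroModeAdj d).toLinearMap ⊔ Submodule.span ℂ {fibreGround hd} : Submodule ℂ (Ell2 ℤ)) :
        Set (Ell2 ℤ)) := by
  rw [Submodule.dense_iff_topologicalClosure_eq_top, Submodule.topologicalClosure_eq_top_iff,
    Submodule.eq_bot_iff]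
  intro f hf
  have hsa := isSelfAdjoint_real_smul_one_sub (isSelfAdjoint_zeroModeAdj d) (combTop d)
  have h1 : ((combTop d : ℂ) • (1 : Ell2 ℤ →L[ℂ] Ell2 ℤ) - zeroModeAdj d) f = 0 := by
    refine ext_inner_left ℂ fun y => ?_
    rw [inner_zero_right, ← ContinuousLinearMap.adjoint_inner_left,
      ← ContinuousLinearMap.star_eq_adjoint, hsa.star_eq]
    exact hf _ (Submodule.mem_sup_left ⟨y, rfl⟩)
  have h2 : zeroModeAdj d f = (combTop d : ℂ) • f := by
    simp only [sub_apply, smul_apply, one_apply_eq_self] at h1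
    exact (sub_eq_zero.1 h1).symm
  obtain ⟨a, rfl⟩ := eq_smul_fibreGround_of_zeroModeAdj_eq hd h2
  have h3 := hf _ (Submodule.mem_sup_right (Submodule.mem_span_singleton_self (fibreGround hd)))
  rw [inner_smul_right, inner_self_eq_norm_sq_to_K, norm_fibreGround] at h3
  have h4 : a = 0 := by simpa using h3
  rw [h4, zero_smul]

/-- The rescaled resolvents of the zero mode converge strongly to the projection onto the ground
state of the fibre; the cutoff shifts the eigenvalue by an exponentially small amount only, which
the scale `s_n ~ (2n+1)^{-d}` does not resolve. -/
theorem tendsto_smul_fibreRes (hd : 1 ≤ d) {s : ℕ → ℝ} (hs : ∀ n, 0 < s n)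
    (hs0 : Tendsto s atTop (𝓝 0)) {c : ℝ}
    (hc : Tendsto (fun n : ℕ => 1 / (s n * (2 * (n : ℝ) + 1) ^ d)) atTop (𝓝 c)) (x : Ell2 ℤ) :
    Tendsto (fun n => (s n : ℂ) • fibreRes d n (2 * d) (s n) x) atTop
      (𝓝 (inner ℂ (fibreGround hd) x • fibreGround hd)) := by
  set w := fibreGround hd with hw
  have hs0' : Tendsto (fun n => (s n : ℂ)) atTop (𝓝 0) := by
    have := (Complex.continuous_ofReal.tendsto 0).comp hs0
    rwa [Complex.ofReal_zero] at this
  have hone : ∀ᶠ n : ℕ in atTop, 1 ≤ n := eventually_ge_atTop 1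
  -- On the ground state `w` the resolvent is `s_n⁻¹` up to the effect of the cutoff.
  have hgw : Tendsto (fun n => (s n : ℂ) • fibreRes d n (2 * d) (s n) w) atTop (𝓝 w) := by
    have h1 : Tendsto (fun n : ℕ => (1 / (s n * (2 * (n : ℝ) + 1) ^ d))
        * (‖expVec hd‖⁻¹ * (combTop d + 2)
          * ((2 * (n : ℝ) + 1) ^ d * ‖expVec hd - cutoff n (expVec hd)‖))) atTop (𝓝 0) := by
      have := hc.mul ((tendsto_pow_mul_norm_expVec_sub_cutoff hd).const_mul
        (‖expVec hd‖⁻¹ * (combTop d + 2)))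
      simpa using this
    rw [tendsto_iff_norm_sub_tendsto_zero]
    refine squeeze_zero' (Eventually.of_forall fun _ => norm_nonneg _) ?_ h1
    filter_upwards [hone] with n hn
    have h2 : (s n : ℂ) • fibreRes d n (2 * d) (s n) w - w
        = fibreRes d n (2 * d) (s n) (fibreAdj n (2 * d) w - zeroModeAdj d w) := by
      conv_lhs => rw [← fibreRes_zeroMode_apply hd hn (hs n) w]
      rw [fibreRes_zeroMode_apply hd hn (hs n) w, hw, zeroModeAdj_fibreGround, ← hw, ← map_smul]
      nth_rw 2 [← fibreRes_zeroMode_apply hd hn (hs n) w]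
      rw [← map_sub]
      congr 1
      push_cast
      module
    have h3 : fibreAdj n (2 * d) w - zeroModeAdj d w = -((‖expVec hd‖ : ℂ)⁻¹ •
        (zeroModeAdj d (expVec hd) - fibreAdj n (2 * d) (expVec hd))) := by
      rw [hw, fibreGround, map_smul, map_smul]; module
    have h4 := norm_smul_fibreRes_le hd hn (hs n) (fibreAdj n (2 * d) w - zeroModeAdj d w)
    rw [norm_smul, Complex.norm_of_nonneg (hs n).le, h3, norm_neg, norm_smul, norm_inv,
      Complex.norm_of_nonneg (norm_nonneg _), ← h3] at h4
    have h5 := norm_zeroModeAdj_sub_fibreAdj_le hd n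
    have h6 : (0 : ℝ) < (2 * (n : ℝ) + 1) ^ d := by positivity
    have hsn := hs n
    rw [h2]
    calc ‖fibreRes d n (2 * d) (s n) (fibreAdj n (2 * d) w - zeroModeAdj d w)‖
        ≤ (‖expVec hd‖⁻¹ * ((combTop d + 2) * ‖expVec hd - cutoff n (expVec hd)‖)) / s n := by
          rw [le_div_iff₀ hsn, mul_comm]
          exact h4.trans (by gcongr)
      _ = _ := by field_simp
  -- On the range of `‖A‖ - A_ℤ - 2d |δ₀⟩⟨δ₀|` the rescaled resolvents tend to `0`. Here the cutoff
  -- only enters through strong convergence, without a rate.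
  have hran : ∀ y, Tendsto (fun n => (s n : ℂ) • fibreRes d n (2 * d) (s n)
      ((combTop d : ℂ) • y - zeroModeAdj d y)) atTop (𝓝 0) := by
    intro y
    have h1 : Tendsto (fun n => (s n : ℂ) • y
        + (s n : ℂ) • (-((s n : ℂ) • fibreRes d n (2 * d) (s n) y))
        + (s n : ℂ) • fibreRes d n (2 * d) (s n) (fibreAdj n (2 * d) y - zeroModeAdj d y)) atTop
        (𝓝 0) := by
      have e1 : Tendsto (fun n => (s n : ℂ) • y) atTop (𝓝 0) := by simpa using hs0'.smul_const y
      have e2 : Tendsto (fun n => (s n : ℂ) • (-((s n : ℂ) • fibreRes d n (2 * d) (s n) y))) atTop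
          (𝓝 0) := by
        have : Tendsto (fun n => ‖(s n : ℂ)‖ * ‖y‖) atTop (𝓝 0) := by
          simpa using (tendsto_zero_iff_norm_tendsto_zero.1 hs0').mul_const ‖y‖
        refine squeeze_zero_norm' ?_ this
        filter_upwards [hone] with n hn
        rw [norm_smul, norm_neg]
        gcongr
        exact norm_smul_fibreRes_le hd hn (hs n) y
      have e3 : Tendsto (fun n => (s n : ℂ) • fibreRes d n (2 * d) (s n)
          (fibreAdj n (2 * d) y - zeroModeAdj d y)) atTop (𝓝 0) := by
        have := tendsto_iff_norm_sub_tendsto_zero.1 (tendsto_fibreAdj (d := d) y)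
        refine squeeze_zero_norm' ?_ this
        filter_upwards [hone] with n hn
        exact norm_smul_fibreRes_le hd hn (hs n) _
      simpa using (e1.add e2).add e3
    refine h1.congr' ?_
    filter_upwards [hone] with n hn
    have e : (combTop d : ℂ) • y - zeroModeAdj d y = (((combTop d + s n : ℝ) : ℂ) • y
        - fibreAdj n (2 * d) y) - (s n : ℂ) • y + (fibreAdj n (2 * d) y - zeroModeAdj d y) := by
      push_cast; module
    rw [e, map_add, map_sub (fibreRes d n (2 * d) (s n)) (((combTop d + s n : ℝ) : ℂ) • y
        - fibreAdj n (2 * d) y), fibreRes_zeroMode_apply hd hn (hs n), map_smul]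
    module
  have hS : ∀ y, (InnerProductSpace.rankOne ℂ w w) y = inner ℂ w y • w := fun y =>
    InnerProductSpace.rankOne_apply ..
  have hww : (inner ℂ w w : ℂ) = 1 := by
    rw [inner_self_eq_norm_sq_to_K, hw, norm_fibreGround]; simp
  rw [← hS]
  refine tendsto_of_dense_of_bounded (C := 2)
    (T := fun n => (s n : ℂ) • fibreRes d n (2 * d) (s n)) zero_le_two ?_
    (dense_range_sup_span hd) ?_ x
  · filter_upwards [hone] with n hn
    refine (norm_sub_le _ _).trans ?_
    have e1 : ‖(s n : ℂ) • fibreRes d n (2 * d) (s n)‖ ≤ 1 :=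
      ContinuousLinearMap.opNorm_le_bound _ zero_le_one fun f => by
        rw [one_mul]; exact norm_smul_fibreRes_le hd hn (hs n) f
    have e2 : ‖InnerProductSpace.rankOne ℂ w w‖ = 1 := by
      rw [InnerProductSpace.norm_rankOne, hw, norm_fibreGround, mul_one]
    rw [e2]
    linarith
  · intro z hz
    obtain ⟨_, ⟨y, rfl⟩, b, hb, rfl⟩ := Submodule.mem_sup.1 hz
    obtain ⟨a, rfl⟩ := Submodule.mem_span_singleton.1 hb
    have e1 : ((combTop d : ℂ) • (1 : Ell2 ℤ →L[ℂ] Ell2 ℤ) - zeroModeAdj d).toLinearMap y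
        = (combTop d : ℂ) • y - zeroModeAdj d y := rfl
    have e2 : inner ℂ w ((combTop d : ℂ) • y - zeroModeAdj d y) = 0 := by
      have hsa := isSelfAdjoint_zeroModeAdj d
      rw [inner_sub_right, ← ContinuousLinearMap.adjoint_inner_left (zeroModeAdj d),
        ← ContinuousLinearMap.star_eq_adjoint, hsa.star_eq, hw, zeroModeAdj_fibreGround,
        inner_smul_left, inner_smul_right, Complex.conj_ofReal, sub_self]
    rw [e1, hS, inner_add_right, e2, zero_add, inner_smul_right, hww, mul_one]
    have h := (hran y).add (hgw.const_smul a)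
    rw [zero_add] at h
    refine h.congr fun n => ?_
    simp only [smul_apply, map_add, map_smul]
    module

/-! ### Averages over the base -/

/-- The sum over the base `ℤ^d` of the fibres of a vector. -/
noncomputable def fibreTotal (ξ : Ell2 (CombVertex d)) : Ell2 ℤ := ∑' j, fibre ξ j

theorem tendsto_sum_fibre {ξ : Ell2 (CombVertex d)} (hξ : ξ ∈ rapidSpace d) :
    Tendsto (fun n : ℕ => ∑ j : Fin d → ZMod (2 * n + 1), fibre ξ (baseEmb j)) atTop
      (𝓝 (fibreTotal ξ)) := by
  have h1 : ∀ n : ℕ, ∑ j : Fin d → ZMod (2 * n + 1), fibre ξ (baseEmb j)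
      = ∑ j ∈ Finset.Icc (fun _ : Fin d => -(n : ℤ)) (fun _ => (n : ℤ)), fibre ξ j := by
    intro n
    refine Finset.sum_nbij' baseEmb (fun j l => (j l : ZMod (2 * n + 1))) (fun j _ => ?_)
      (fun _ _ => Finset.mem_univ _) (fun j _ => ?_) (fun j hj => ?_) (fun _ _ => rfl)
    · rw [Finset.mem_Icc, Pi.le_def, Pi.le_def, ← forall_and]
      intro l
      have := (j l).valMinAbs_mem_Ioc
      rw [Set.mem_Ioc] at this
      push_cast at this
      change -(n : ℤ) ≤ (j l).valMinAbs ∧ (j l).valMinAbs ≤ n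
      omega
    · exact funext fun l => (j l).coe_valMinAbs
    · rw [Finset.mem_Icc, Pi.le_def, Pi.le_def] at hj
      exact funext fun l => valMinAbs_intCast_of_abs_le (abs_le.2 ⟨hj.1 l, hj.2 l⟩)
  simp only [h1]
  refine (summable_norm_fibre hξ).of_norm.hasSum.comp (tendsto_atTop_finset_of_monotone ?_ ?_)
  · intro n m hnm
    refine Finset.Icc_subset_Icc (fun _ => ?_) (fun _ => ?_)
    · simp only [neg_le_neg_iff]; exact_mod_cast hnm
    · simp only; exact_mod_cast hnm
  · intro j
    refine ⟨∑ l, (j l).natAbs, Finset.mem_Icc.2 ?_⟩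
    rw [Pi.le_def, Pi.le_def, ← forall_and]
    intro l
    have := Finset.single_le_sum (f := fun l => (j l).natAbs) (fun _ _ => Nat.zero_le _)
      (Finset.mem_univ l)
    have h2 : (j l).natAbs ≤ (∑ l, (j l).natAbs) := this
    change -((∑ l, (j l).natAbs : ℕ) : ℤ) ≤ j l ∧ j l ≤ ((∑ l, (j l).natAbs : ℕ) : ℤ)
    omega

theorem tendsto_inv_modeNorm_smul_modeCoeff {ξ : Ell2 (CombVertex d)} (hξ : ξ ∈ rapidSpace d) :
    Tendsto (fun n => (modeNorm d n : ℂ)⁻¹ • modeCoeff (n := n) 0 ξ) atTop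
      (𝓝 (fibreTotal ξ)) := by
  have h1 : ∀ n : ℕ, (modeNorm d n : ℂ)⁻¹ • modeCoeff (n := n) 0 ξ
      = cutoff n (∑ j : Fin d → ZMod (2 * n + 1), fibre ξ (baseEmb j) - fibreTotal ξ)
        + cutoff n (fibreTotal ξ) := by
    intro n
    have : (modeNorm d n : ℂ) ≠ 0 := by exact_mod_cast modeNorm_pos.ne'
    rw [modeCoeff_eq_sum_fibre, smul_smul, inv_mul_cancel₀ this, one_smul, map_sub,
      sub_add_cancel, map_sum]
    simp [torusChar_zero_left]
  simp only [h1]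
  have h2 := tendsto_iff_norm_sub_tendsto_zero.1 (tendsto_sum_fibre hξ)
  have h3 := (squeeze_zero_norm (fun n => norm_cutoff_apply_le (n := n) _) h2).add
    (tendsto_cutoff (fibreTotal ξ))
  rwa [zero_add] at h3

theorem summable_groundState_mul (hd : 1 ≤ d) {ξ : Ell2 (CombVertex d)} (hξ : ξ ∈ rapidSpace d) :
    Summable fun x => ‖groundState d x * ξ x‖ := by
  have hw : Summable fun i => ‖fibreGround hd i‖ ^ 2 := summable_norm_sq _
  have h2 : ∀ j, Summable fun i => ‖fibreGround hd i‖ * ‖ξ (j, i)‖ := fun j =>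
    (((summable_norm_sq (fibreGround hd)).add (summable_norm_sq (fibre ξ j)))).of_nonneg_of_le
      (fun i => by positivity) fun i => by
        change _ ≤ _ + ‖ξ (j, i)‖ ^ 2
        nlinarith [sq_nonneg (‖fibreGround hd i‖ - ‖ξ (j, i)‖), norm_nonneg (fibreGround hd i),
          norm_nonneg (ξ (j, i))]
  simp only [norm_mul, groundState_eq hd]
  rw [summable_prod_of_nonneg fun _ => by positivity]
  refine ⟨h2, (summable_norm_fibre hξ).of_nonneg_of_le (fun j => tsum_nonneg fun i => by positivity)
    fun j => ?_⟩
  have h3 := Real.inner_le_Lp_mul_Lq_tsum_of_nonneg (p := 2) (q := 2)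
    (by norm_num [Real.holderConjugate_iff])
    (f := fun i => ‖fibreGround hd i‖) (g := fun i => ‖fibre ξ j i‖) (fun _ => norm_nonneg _)
    (fun _ => norm_nonneg _) (by simpa using summable_norm_sq (fibreGround hd))
    (by simpa using summable_norm_sq (fibre ξ j))
  simp only [Real.rpow_ofNat, ← norm_sq_eq_tsum, norm_fibreGround, ← Real.sqrt_eq_rpow] at h3
  rw [Real.sqrt_sq (norm_nonneg _)] at h3
  rw [one_pow, Real.sqrt_one, one_mul] at h3
  exact h3

theorem pairing_groundState (hd : 1 ≤ d) {ξ : Ell2 (CombVertex d)} (hξ : ξ ∈ rapidSpace d) :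
    pairing (groundState d) ξ = inner ℂ (fibreGround hd) (fibreTotal ξ) := by
  have hs : Summable fun x => conj (groundState d x) * ξ x :=
    (Summable.congr (summable_groundState_mul hd hξ) fun x => by
      rw [norm_mul, norm_mul, RCLike.norm_conj]).of_norm
  rw [pairing, hs.tsum_prod, fibreTotal]
  have h1 := ((innerSL ℂ (fibreGround hd)).hasSum (summable_norm_fibre hξ).of_norm.hasSum).tsum_eq
  simp only [innerSL_apply_apply] at h1
  rw [← h1]
  refine tsum_congr fun j => ?_
  rw [lp.inner_eq_tsum]
  refine tsum_congr fun i => ?_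
  rw [groundState_eq hd, RCLike.inner_apply, mul_comm]
  rfl

theorem pairing_groundState_right (hd : 1 ≤ d) {η : Ell2 (CombVertex d)} (hη : η ∈ rapidSpace d) :
    pairing η (groundState d) = inner ℂ (fibreTotal η) (fibreGround hd) := by
  rw [← inner_conj_symm, ← pairing_groundState hd hη, pairing, pairing, Complex.conj_tsum]
  refine tsum_congr fun x => ?_
  rw [map_mul, Complex.conj_conj, mul_comm]

/-- The zero mode produces the condensate. -/
theorem tendsto_zeroMode (hd : 1 ≤ d) {η ξ : Ell2 (CombVertex d)} (hη : η ∈ rapidSpace d)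
    (hξ : ξ ∈ rapidSpace d) {s : ℕ → ℝ} (hs : ∀ n, 0 < s n) (hs0 : Tendsto s atTop (𝓝 0)) {c : ℝ}
    (hc : Tendsto (fun n : ℕ => 1 / (s n * (2 * (n : ℝ) + 1) ^ d)) atTop (𝓝 c)) :
    Tendsto (fun n => (inner ℂ (modeCoeff (n := n) 0 η)
      (modeCoeff (n := n) 0 (finiteRes d n (s n) ξ)) : ℂ)) atTop
      (𝓝 ((c : ℂ) * (pairing η (groundState d) * pairing (groundState d) ξ))) := by
  set a : ℕ → Ell2 ℤ := fun n => (modeNorm d n : ℂ)⁻¹ • modeCoeff (n := n) 0 ξ with ha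
  have h1 : Tendsto (fun n => (s n : ℂ) • fibreRes d n (2 * d) (s n) (a n)) atTop
      (𝓝 (inner ℂ (fibreGround hd) (fibreTotal ξ) • fibreGround hd)) := by
    have h2 := tendsto_iff_norm_sub_tendsto_zero.1 (tendsto_inv_modeNorm_smul_modeCoeff hξ)
    have h3 : Tendsto (fun n => (s n : ℂ) • fibreRes d n (2 * d) (s n) (a n - fibreTotal ξ)) atTop
        (𝓝 0) := by
      refine squeeze_zero_norm' ?_ h2
      filter_upwards [eventually_ge_atTop 1] with n hn
      exact norm_smul_fibreRes_le hd hn (hs n) _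
    have h4 := h3.add (tendsto_smul_fibreRes hd hs hs0 hc (fibreTotal ξ))
    rw [zero_add] at h4
    refine h4.congr fun n => ?_
    rw [map_sub, smul_sub, sub_add_cancel]
  have h5 := ((Complex.continuous_ofReal.tendsto c).comp hc).mul
    ((tendsto_inv_modeNorm_smul_modeCoeff hη).inner (𝕜 := ℂ) h1)
  rw [inner_smul_right, ← pairing_groundState hd hξ, ← pairing_groundState_right hd hη,
    mul_comm (pairing (groundState d) ξ)] at h5
  refine h5.congr' ?_
  filter_upwards [eventually_ge_atTop 1] with n hn
  have hN : (modeNorm d n : ℂ) ≠ 0 := by exact_mod_cast modeNorm_pos.ne'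
  have hsn : (s n : ℂ) ≠ 0 := by exact_mod_cast (hs n).ne'
  have e : 1 / (s n * (2 * (n : ℝ) + 1) ^ d) = modeNorm d n ^ 2 / s n := by
    rw [modeNorm_sq]; field_simp
  rw [modeCoeff_zero_finiteRes hd hn (hs n)]
  simp only [Function.comp_apply, e, ha, map_smul, inner_smul_left, inner_smul_right, map_inv₀,
    Complex.conj_ofReal]
  push_cast
  field_simp

end ZeroMode


/-! ### Transience -/

section Transience

theorem re_inner_opFun_shiftedInv_le {E : Type*} [NormedAddCommGroup E] [InnerProductSpace ℂ E]
    [CompleteSpace E] {H : E →L[ℂ] E} (hH : 0 ≤ H) {s : ℝ} (hs : 0 < s) (ζ : E) :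
    (inner ℂ (opFun Real.sqrt H ζ) (opFun (shiftedInv s) H (opFun Real.sqrt H ζ))).re
      ≤ ‖ζ‖ ^ 2 := by
  have c0 : Continuous fun h => shiftedInv s h * √h :=
    (continuous_shiftedInv hs).mul Real.continuous_sqrt
  unfold opFun
  rw [inner_cfc_left, cfc_apply_cfc_apply H (continuous_shiftedInv hs) Real.continuous_sqrt,
    cfc_apply_cfc_apply H Real.continuous_sqrt c0]
  have h1 : ‖cfc (fun h => √h * (shiftedInv s h * √h)) H‖ ≤ 1 := by
    refine norm_cfc_le zero_le_one fun h hh => ?_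
    have h0 : 0 ≤ h := spectrum_nonneg_of_nonneg hH hh
    rw [shiftedInv_of_nonneg _ h0, mul_left_comm, Real.mul_self_sqrt h0,
      Real.norm_of_nonneg (by positivity), mul_comm, ← div_eq_mul_inv, div_le_one (by positivity)]
    linarith
  exact (re_inner_le_of_norm_le h1 ζ).trans (by rw [one_mul])

/-- If `δ_x = H^{1/2} ζ`, then `‖ζ‖²` bounds the matrix elements of all the resolvents at `δ_x`. -/
theorem transient_combAdj {d : ℕ} (hd : 3 ≤ d) : Transient (combAdj d) := by
  have hd1 : 1 ≤ d := by omega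
  intro x
  obtain ⟨ζ, hζ⟩ := exists_sqrt_combHam_apply_eq hd (delta_mem_rapidSpace x)
  refine lt_of_le_of_lt (iSup₂_le fun t ht => ENNReal.ofReal_le_ofReal ?_)
    (ENNReal.ofReal_lt_top (r := ‖ζ‖ ^ 2))
  rw [norm_combAdj hd1] at ht
  have hs : 0 < t - combTop d := sub_pos.2 ht
  have e : (t : ℂ) • (1 : Ell2 (CombVertex d) →L[ℂ] _) - combAdj d
      = ((t - combTop d : ℝ) : ℂ) • (1 : Ell2 (CombVertex d) →L[ℂ] _) + combHam d := by
    rw [combHam_eq hd1]; push_cast; module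
  rw [resolvent_eq_inverse, e, inverse_smul_add_eq_opFun (combHam_nonneg hd1) hs, ← hζ]
  exact re_inner_opFun_shiftedInv_le (combHam_nonneg hd1) hs ζ

theorem mem_domain_invSqrt_combHam {d : ℕ} (hd : 3 ≤ d) {ξ : Ell2 (CombVertex d)}
    (hξ : ξ ∈ rapidSpace d) : ξ ∈ (invSqrt (combHam d)).domain := by
  obtain ⟨ζ, hζ⟩ := exists_sqrt_combHam_apply_eq hd hξ
  exact (exists_invSqrt_eq (combHam_nonneg (by omega)) (injective_combHam hd) hζ).choose

end Transience

/-! ### Convergence of the two-point functions -/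

section TwoPoint

variable {d : ℕ}

theorem inverse_expSubOne_eq {E : Type*} [NormedAddCommGroup E] [InnerProductSpace ℂ E]
    [CompleteSpace E] {T : E →L[ℂ] E} (hT : IsSelfAdjoint T) {c : ℝ} (hc : 0 < c)
    (h : ∀ x, c * ‖x‖ ^ 2 ≤ (inner ℂ x (T x)).re) {β : ℝ} (hβ : 0 < β) :
    Ring.inverse (expSubOne β T)
      = ((β⁻¹ : ℝ) : ℂ) • Ring.inverse T + opFun (boseReg β) T := by
  rw [(isUnit_expSubOne_and_inverse hT hc h hβ).2, Complex.coe_smul]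
  rfl

theorem isUnit_expSubOne_finiteHam (hd : 1 ≤ d) {β : ℝ} (hβ : 0 < β) (n : ℕ) {s : ℝ}
    (hs : 0 < s) : IsUnit (expSubOne β (finiteHam d n (-s))) :=
  (isUnit_expSubOne_and_inverse (isSelfAdjoint_finiteHam _) hs (le_re_inner_finiteHam hd s) hβ).1

theorem inverse_expSubOne_finiteHam (hd : 1 ≤ d) {β : ℝ} (hβ : 0 < β) (n : ℕ) {s : ℝ}
    (hs : 0 < s) : Ring.inverse (expSubOne β (finiteHam d n (-s)))
      = ((β⁻¹ : ℝ) : ℂ) • finiteRes d n s + opFun (boseReg β) (finiteHam d n (-s)) :=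
  inverse_expSubOne_eq (isSelfAdjoint_finiteHam _) hs (le_re_inner_finiteHam hd s) hβ

theorem norm_finiteHam_le (hd : 1 ≤ d) (n : ℕ) {s : ℝ} (hs : 0 ≤ s) :
    ‖finiteHam d n (-s)‖ ≤ 2 * combTop d + s := by
  have h0 := two_lt_combTop hd
  rw [finiteHam_neg hd]
  refine ContinuousLinearMap.opNorm_le_bound _ (by linarith) fun x => ?_
  rw [sub_apply, smul_apply, one_apply_eq_self]
  refine (norm_sub_le _ _).trans ?_
  rw [norm_smul, Complex.norm_of_nonneg (by linarith)]
  have := (finiteCombAdj d n).le_of_opNorm_le (norm_finiteCombAdj_le d n) x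
  linarith

theorem norm_combHam_le (hd : 1 ≤ d) : ‖combHam d‖ ≤ 2 * combTop d := by
  have h0 := two_lt_combTop hd
  rw [combHam_eq hd]
  refine ContinuousLinearMap.opNorm_le_bound _ (by linarith) fun x => ?_
  rw [sub_apply, smul_apply, one_apply_eq_self]
  refine (norm_sub_le _ _).trans ?_
  rw [norm_smul, Complex.norm_of_nonneg (by linarith)]
  have := (combAdj d).le_of_opNorm_le (norm_combAdj_le (d := d)) x
  linarith

theorem tendsto_opFun_finiteHam (hd : 1 ≤ d) {s : ℕ → ℝ} (hs : ∀ n, 0 < s n)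
    (hs0 : Tendsto s atTop (𝓝 0)) {φ : ℝ → ℝ} (hφ : Continuous φ) (ξ : Ell2 (CombVertex d)) :
    Tendsto (fun n => opFun φ (finiteHam d n (-s n)) ξ) atTop (𝓝 (opFun φ (combHam d) ξ)) := by
  obtain ⟨C, hC⟩ := hs0.bddAbove_range
  have hC' : ∀ n, s n ≤ C := fun n => hC ⟨n, rfl⟩
  refine tendsto_cfc_apply (C := 2 * combTop d + C) (fun n => isSelfAdjoint_finiteHam _)
    (combHam_nonneg hd).isSelfAdjoint
    (fun n => (norm_finiteHam_le hd n (hs n).le).trans (by linarith [hC' n]))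
    ((norm_combHam_le hd).trans (by linarith [hC' 0, hs 0])) (fun x => ?_) hφ ξ
  have hs0' : Tendsto (fun n => (s n : ℂ)) atTop (𝓝 0) := by
    have := (Complex.continuous_ofReal.tendsto 0).comp hs0
    rwa [Complex.ofReal_zero] at this
  have h1 := ((hs0'.smul_const x).const_add ((combTop d : ℂ) • x)).sub (tendsto_finiteCombAdj x)
  rw [zero_smul, add_zero] at h1
  simp only [finiteHam_neg hd, combHam_eq hd, sub_apply, smul_apply, one_apply_eq_self]
  refine h1.congr fun n => ?_
  push_cast
  module

/-- The three summands of the two-point function: the regular part of the resolvent and the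
continuous remainder of the Bose function add up to the infinite volume form, and the zero mode
gives the condensate. -/
theorem tendsto_inner_inverse_expSubOne (hd : 3 ≤ d) {β : ℝ} (hβ : 0 < β)
    {s : ℕ → ℝ} (hs : ∀ n, 0 < s n) (hs0 : Tendsto s atTop (𝓝 0)) {c : ℝ}
    (hc : Tendsto (fun n : ℕ => 1 / (s n * (2 * (n : ℝ) + 1) ^ d)) atTop (𝓝 c))
    {η ξ : Ell2 (CombVertex d)} (hη : η ∈ rapidSpace d) (hξ : ξ ∈ rapidSpace d) :
    ∃ (hη' : η ∈ (invSqrt (expSubOne β (combHam d))).domain)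
      (hξ' : ξ ∈ (invSqrt (expSubOne β (combHam d))).domain),
      Tendsto
        (fun n => inner ℂ η (Ring.inverse (expSubOne β (finiteHam d n (-s n))) ξ)) atTop
        (𝓝 (inner ℂ (invSqrt (expSubOne β (combHam d)) ⟨η, hη'⟩)
              (invSqrt (expSubOne β (combHam d)) ⟨ξ, hξ'⟩) +
            ((c / β : ℝ) : ℂ) * (pairing η (groundState d) * pairing (groundState d) ξ))) := by
  have hd1 : 1 ≤ d := by omega
  obtain ⟨y, hy⟩ := exists_sqrt_combHam_apply_eq hd hη
  obtain ⟨z, hz⟩ := exists_sqrt_combHam_apply_eq hd hξ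
  obtain ⟨hη', hξ', e⟩ := inner_invSqrt_expSubOne (combHam_nonneg hd1) (injective_combHam hd) hβ
    hy hz
  refine ⟨hη', hξ', ?_⟩
  have h1 := tendsto_regularPart_of_tendsto_zero hd hη hξ hy hz hs hs0
  have h2 := tendsto_zeroMode hd1 hη hξ hs hs0 hc
  have h3 : Tendsto (fun n => (inner ℂ η (opFun (boseReg β) (finiteHam d n (-s n)) ξ) : ℂ)) atTop
      (𝓝 (inner ℂ η (opFun (boseReg β) (combHam d) ξ))) :=
    tendsto_const_nhds.inner (tendsto_opFun_finiteHam hd1 hs hs0 (continuous_boseReg hβ) ξ)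
  -- The factor `β⁻¹` and the additive `boseReg` come from splitting the Bose function.
  have h4 := ((h1.add h2).const_mul ((β⁻¹ : ℝ) : ℂ)).add h3
  rw [e]
  have e2 : ((β⁻¹ : ℝ) : ℂ) * (inner ℂ y z
      + (c : ℂ) * (pairing η (groundState d) * pairing (groundState d) ξ))
      + inner ℂ η (opFun (boseReg β) (combHam d) ξ)
      = ((β⁻¹ : ℝ) : ℂ) * inner ℂ y z + inner ℂ η (opFun (boseReg β) (combHam d) ξ)
        + ((c / β : ℝ) : ℂ) * (pairing η (groundState d) * pairing (groundState d) ξ) := by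
    push_cast; ring
  rw [e2] at h4
  refine h4.congr fun n => ?_
  rw [inverse_expSubOne_finiteHam hd1 hβ n (hs n), add_apply, inner_add_right, smul_apply,
    inner_smul_right, regularPart, sub_add_cancel]

end TwoPoint


/-! ### Averages of vector states -/

section AverageState

variable {E : Type*} [NormedAddCommGroup E] [InnerProductSpace ℂ E]

/-- The average of the vector states given by a finite family of vectors. -/
noncomputable def averageState {ι : Type*} [Fintype ι] (u : ι → E) (S : E →L[ℂ] E) : ℂ :=
  (Fintype.card ι : ℂ)⁻¹ * ∑ p, inner ℂ (u p) (S (u p))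

section Basic

variable {ι : Type*} [Fintype ι] (u : ι → E)

theorem averageState_add (S T : E →L[ℂ] E) :
    averageState u (S + T) = averageState u S + averageState u T := by
  simp only [averageState, add_apply, inner_add_right, Finset.sum_add_distrib, mul_add]

theorem averageState_smul (c : ℂ) (S : E →L[ℂ] E) :
    averageState u (c • S) = c * averageState u S := by
  simp only [averageState, smul_apply, inner_smul_right, ← Finset.mul_sum]
  ring

theorem averageState_sub (S T : E →L[ℂ] E) :
    averageState u (S - T) = averageState u S - averageState u T := by
  simp only [averageState, sub_apply, inner_sub_right, Finset.sum_sub_distrib, mul_sub]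

variable {u}

theorem norm_averageState_le (hu : ∀ p, ‖u p‖ = 1) (S : E →L[ℂ] E) :
    ‖averageState u S‖ ≤ ‖S‖ := by
  rw [averageState, norm_mul, norm_inv, RCLike.norm_natCast]
  have h : ‖∑ p, (inner ℂ (u p) (S (u p)) : ℂ)‖ ≤ Fintype.card ι * ‖S‖ := by
    have h1 : ‖∑ p, (inner ℂ (u p) (S (u p)) : ℂ)‖ ≤ ∑ _p : ι, ‖S‖ := by
      refine norm_sum_le_of_le _ fun p _ => (norm_inner_le_norm _ _).trans ?_
      have := S.le_opNorm (u p)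
      rw [hu, mul_one] at this
      rwa [hu, one_mul]
    rwa [Finset.sum_const, Finset.card_univ, nsmul_eq_mul] at h1
  refine (mul_le_mul_of_nonneg_left h (by positivity)).trans ?_
  rw [← mul_assoc]
  exact mul_le_of_le_one_left (norm_nonneg _) (inv_mul_le_one)

end Basic

variable [CompleteSpace E]

theorem opFun_smul_one_sub {T : E →L[ℂ] E} (hT : IsSelfAdjoint T) (c : ℝ) {φ : ℝ → ℝ}
    (hφ : Continuous φ) : opFun φ ((c : ℂ) • 1 - T) = opFun (fun t => φ (c - t)) T := by
  have h1 : (c : ℂ) • 1 - T = cfc (fun t => c - t) T := by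
    rw [cfc_sub (fun _ => c) (fun t => t) T, cfc_id' ℝ T, cfc_const c T,
      Algebra.algebraMap_eq_smul_one]
    rfl
  unfold opFun
  rw [h1]
  exact (cfc_comp' φ (fun t => c - t) T hφ.continuousOn (by fun_prop) hT).symm

/-- If the moments of the averaged vector states converge to those of a measure, then so do the
averages of continuous functions of the operators, by the Weierstrass theorem. -/
theorem tendsto_averageState_opFun {F : ℕ → Type*} [∀ n, Fintype (F n)] {u : ∀ n, F n → E}
    (hu : ∀ n p, ‖u n p‖ = 1) {T : ℕ → E →L[ℂ] E} (hT : ∀ n, IsSelfAdjoint (T n)) {C : ℝ}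
    (hC : ∀ n, ‖T n‖ ≤ C) {ν : Measure ℝ} [IsProbabilityMeasure ν]
    (hν : ∀ᵐ t ∂ν, t ∈ Set.Icc (-C) C)
    (hmom : ∀ m : ℕ, Tendsto (fun n => averageState (u n) (T n ^ m)) atTop
      (𝓝 ((∫ t, t ^ m ∂ν : ℝ) : ℂ))) {φ : ℕ → ℝ → ℝ} {ψ : ℝ → ℝ} (hφ : ∀ n, Continuous (φ n))
    (hψ : Continuous ψ) (hφψ : TendstoUniformlyOn φ ψ atTop (Set.Icc (-C) C)) :
    Tendsto (fun n => averageState (u n) (opFun (φ n) (T n))) atTop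
      (𝓝 ((∫ t, ψ t ∂ν : ℝ) : ℂ)) := by
  have hint : ∀ {f : ℝ → ℝ}, Continuous f → Integrable f ν := fun {f} hf => by
    obtain ⟨B, hB⟩ :=
      (isCompact_Icc (a := -C) (b := C)).exists_bound_of_continuousOn hf.continuousOn
    exact Integrable.of_bound hf.aestronglyMeasurable B (hν.mono fun t ht => hB t ht)
  have hpoly : ∀ p : Polynomial ℝ, Tendsto (fun n => averageState (u n) (Polynomial.aeval (T n) p))
      atTop (𝓝 ((∫ t, p.eval t ∂ν : ℝ) : ℂ)) := by
    intro p
    induction p using Polynomial.induction_on' with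
    | add p q hp hq =>
      simp only [map_add, averageState_add, Polynomial.eval_add]
      rw [integral_add (hint p.continuous) (hint q.continuous), Complex.ofReal_add]
      exact hp.add hq
    | monomial m a =>
      have := (hmom m).const_mul (a : ℂ)
      simp only [Polynomial.eval_monomial]
      rw [integral_const_mul, Complex.ofReal_mul]
      refine this.congr fun n => ?_
      rw [← averageState_smul, Polynomial.aeval_monomial, Algebra.algebraMap_eq_smul_one,
        smul_mul_assoc, one_mul]
      rfl
  rw [Metric.tendsto_nhds]
  intro ε hε
  obtain ⟨p, hp⟩ := exists_polynomial_near_of_continuousOn (-C) C ψ hψ.continuousOn (ε / 4)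
    (by positivity)
  filter_upwards [Metric.tendsto_nhds.1 (hpoly p) (ε / 4) (by positivity),
    Metric.tendstoUniformlyOn_iff.1 hφψ (ε / 4) (by positivity)] with n hn1 hn2
  have h1 : ‖averageState (u n) (opFun (φ n) (T n)) - averageState (u n) (Polynomial.aeval (T n) p)‖
      ≤ ε / 4 + ε / 4 := by
    rw [← averageState_sub]
    refine (norm_averageState_le (hu n) _).trans ?_
    rw [← cfc_polynomial p (T n) (hT n)]
    refine norm_cfc_sub_cfc_le (hT n) (hC n) (by positivity) (hφ n) p.continuous fun t ht => ?_
    have e1 := hn2 t ht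
    have e2 := hp t ht
    rw [Real.dist_eq, abs_sub_comm] at e1
    rw [abs_sub_comm] at e2
    calc |φ n t - p.eval t| = |(φ n t - ψ t) + (ψ t - p.eval t)| := by congr 1; ring
      _ ≤ _ := (abs_add_le _ _).trans (add_le_add e1.le e2.le)
  have h2 : ‖((∫ t, p.eval t ∂ν : ℝ) : ℂ) - ((∫ t, ψ t ∂ν : ℝ) : ℂ)‖ ≤ ε / 4 := by
    rw [← Complex.ofReal_sub, ← integral_sub (hint p.continuous) (hint hψ), Complex.norm_real]
    refine (norm_integral_le_of_norm_le_const (C := ε / 4)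
      (hν.mono fun t ht => (hp t ht).le)).trans ?_
    simp
  rw [dist_eq_norm] at hn1 ⊢
  set a := averageState (u n) (opFun (φ n) (T n))
  set b := averageState (u n) (Polynomial.aeval (T n) p)
  calc ‖a - ((∫ t, ψ t ∂ν : ℝ) : ℂ)‖ = ‖(a - b) + (b - ((∫ t, p.eval t ∂ν : ℝ) : ℂ))
        + (((∫ t, p.eval t ∂ν : ℝ) : ℂ) - ((∫ t, ψ t ∂ν : ℝ) : ℂ))‖ := by congr 1; ring
    _ ≤ ‖a - b‖ + ‖b - ((∫ t, p.eval t ∂ν : ℝ) : ℂ)‖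
        + ‖((∫ t, p.eval t ∂ν : ℝ) : ℂ) - ((∫ t, ψ t ∂ν : ℝ) : ℂ)‖ := norm_add₃_le
    _ < ε := by linarith

end AverageState

/-! ### The density of states of the chain -/

section Arcsine

/-- The law of `2 cos θ` for `θ` uniform on `[0, 2π]`. -/
noncomputable def arcsineLaw : Measure ℝ :=
  ENNReal.ofReal (2 * Real.pi)⁻¹ •
    Measure.map (fun θ => 2 * Real.cos θ) (volume.restrict (Set.Ioc 0 (2 * Real.pi)))

instance isProbabilityMeasure_arcsineLaw : IsProbabilityMeasure arcsineLaw := ⟨by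
  rw [arcsineLaw, Measure.smul_apply, Measure.map_apply (by fun_prop) MeasurableSet.univ,
    Set.preimage_univ, Measure.restrict_apply_univ, Real.volume_Ioc, sub_zero, smul_eq_mul,
    ← ENNReal.ofReal_mul (by positivity), inv_mul_cancel₀ (by positivity), ENNReal.ofReal_one]⟩

theorem ae_mem_Icc_arcsineLaw : ∀ᵐ t ∂arcsineLaw, t ∈ Set.Icc (-2 : ℝ) 2 := by
  refine Measure.ae_smul_measure ?_ _
  refine (ae_map_iff (by fun_prop) (measurableSet_Icc (a := (-2 : ℝ)) (b := 2))).2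
    (Eventually.of_forall fun θ => ?_)
  have h1 := Real.neg_one_le_cos θ
  have h2 := Real.cos_le_one θ
  constructor <;> linarith

theorem integral_arcsineLaw {f : ℝ → ℝ} (hf : Continuous f) :
    ∫ t, f t ∂arcsineLaw = (2 * Real.pi)⁻¹ * ∫ θ in (0 : ℝ)..2 * Real.pi, f (2 * Real.cos θ) := by
  rw [arcsineLaw, integral_smul_measure, integral_map (by fun_prop) hf.aestronglyMeasurable,
    intervalIntegral.integral_of_le (by positivity), ENNReal.toReal_ofReal (by positivity),
    smul_eq_mul]

/-- The number of walks of length `m` on `ℤ` from `y` to the origin. -/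
def walkCount : ℕ → ℤ → ℝ
  | 0, y => if y = 0 then 1 else 0
  | m + 1, y => walkCount m (y - 1) + walkCount m (y + 1)

/-- Both sides satisfy the recursion of the walks on `ℤ`, as
`2 cos θ cos yθ = cos (y - 1)θ + cos (y + 1)θ`. -/
theorem integral_two_mul_cos_pow_mul_cos (m : ℕ) (y : ℤ) :
    ∫ θ in (0 : ℝ)..2 * Real.pi, (2 * Real.cos θ) ^ m * Real.cos (y * θ)
      = 2 * Real.pi * walkCount m y := by
  induction m generalizing y with
  | zero =>
    simp only [pow_zero, one_mul, walkCount]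
    split_ifs with h
    · simp [h]
    · have hy : (y : ℝ) ≠ 0 := by exact_mod_cast h
      rw [intervalIntegral.integral_comp_mul_left (fun θ => Real.cos θ) hy, integral_cos]
      have := Real.sin_int_mul_pi (y * 2)
      push_cast at this
      rw [mul_zero, Real.sin_zero, ← mul_assoc, this]
      simp
  | succ m ih =>
    have h : ∀ θ : ℝ, (2 * Real.cos θ) ^ (m + 1) * Real.cos (y * θ)
        = (2 * Real.cos θ) ^ m * Real.cos ((y - 1 : ℤ) * θ)
          + (2 * Real.cos θ) ^ m * Real.cos ((y + 1 : ℤ) * θ) := by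
      intro θ
      push_cast
      rw [sub_mul, add_mul, one_mul, Real.cos_sub, Real.cos_add]
      ring
    simp only [h]
    rw [intervalIntegral.integral_add (Continuous.intervalIntegrable (by fun_prop) _ _)
      (Continuous.intervalIntegrable (by fun_prop) _ _), ih, ih, walkCount]
    ring

theorem integral_pow_arcsineLaw (m : ℕ) : ∫ t, t ^ m ∂arcsineLaw = walkCount m 0 := by
  have h := integral_two_mul_cos_pow_mul_cos m 0
  simp only [Int.cast_zero, zero_mul, Real.cos_zero, mul_one] at h
  rw [integral_arcsineLaw (by fun_prop), h, ← mul_assoc, inv_mul_cancel₀ (by positivity), one_mul]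

/-- Matrix elements of powers of an operator that acts like the adjacency operator of `ℤ` along a
segment. -/
theorem pow_delta_apply {V : Type*} {T : Ell2 V →L[ℂ] Ell2 V} {ι : ℤ → V}
    (hι : Function.Injective ι) {M : ℕ}
    (h : ∀ (g : Ell2 V) (y : ℤ), |y| < M → T g (ι y) = g (ι (y - 1)) + g (ι (y + 1)))
    {m : ℕ} {y : ℤ} (hy : |y| + m ≤ M) : (T ^ m) (delta (ι 0)) (ι y) = walkCount m y := by
  classical
  induction m generalizing y with
  | zero =>
    rw [pow_zero, one_apply_eq_self, delta_apply, walkCount]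
    simp [hι.eq_iff, apply_ite]
  | succ m ih =>
    push_cast at hy
    have h1 : |y - 1| ≤ |y| + 1 := by simpa using abs_sub y 1
    have h2 : |y + 1| ≤ |y| + 1 := by simpa using abs_add_le y 1
    rw [pow_succ', mul_apply_eq_comp, h _ _ (by omega), ih (by omega), ih (by omega), walkCount]
    push_cast
    rfl

/-- The number of points of a fibre at distance less than `m` from the base or from an end. -/
theorem sum_ite_boundary_le (m n : ℕ) : (∑ c : FiniteChain n,
    if (m : ℤ) ≤ |(c : ℤ)| ∧ |(c : ℤ)| + m ≤ n then (0 : ℝ) else 1) ≤ 4 * m + 3 := by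
  classical
  have h1 : (∑ c : FiniteChain n, if (m : ℤ) ≤ |(c : ℤ)| ∧ |(c : ℤ)| + m ≤ n then (0 : ℝ) else 1)
      = ((Finset.univ.filter fun c : FiniteChain n =>
        ¬ ((m : ℤ) ≤ |(c : ℤ)| ∧ |(c : ℤ)| + m ≤ n)).card : ℝ) := by
    rw [Finset.card_filter]
    push_cast
    refine Finset.sum_congr rfl fun c _ => ?_
    split_ifs <;> rfl
  have h2 : (Finset.univ.filter fun c : FiniteChain n =>
      ¬ ((m : ℤ) ≤ |(c : ℤ)| ∧ |(c : ℤ)| + m ≤ n)).card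
      ≤ (Finset.Icc (-(m : ℤ)) m ∪ Finset.Icc ((n : ℤ) - m) n
        ∪ Finset.Icc (-(n : ℤ)) (-n + m)).card := by
    refine Finset.card_le_card_of_injOn (fun c => (c : ℤ)) (fun c hc => ?_)
      (fun a _ b _ h => Subtype.ext h)
    have hc1 := c.2
    have hc2 := (Finset.mem_filter.1 hc).2
    simp only [Finset.coe_union, Finset.coe_Icc, Set.mem_union, Set.mem_Icc] at hc1 ⊢
    rw [Int.abs_eq_natAbs] at hc2
    omega
  have h3 := h2.trans ((Finset.card_union_le _ _).trans
    (Nat.add_le_add_right (Finset.card_union_le _ _) _))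
  rw [Int.card_Icc, Int.card_Icc, Int.card_Icc] at h3
  rw [h1]
  have h4 : (Finset.univ.filter fun c : FiniteChain n =>
      ¬ ((m : ℤ) ≤ |(c : ℤ)| ∧ |(c : ℤ)| + m ≤ n)).card ≤ 4 * m + 3 := by omega
  exact_mod_cast h4

theorem card_finiteCombVertex (d n : ℕ) :
    Fintype.card (FiniteCombVertex d n) = (2 * n + 1) ^ d * (2 * n + 1) := by
  rw [Fintype.card_prod, Fintype.card_pi]
  simp only [ZMod.card, Finset.prod_const, Finset.card_univ, Fintype.card_fin]
  congr 1
  rw [Fintype.card_ofFinset, Int.card_Icc]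
  omega

/-- If the operators `T n` act like the adjacency operator of `ℤ` near all points but those close
to the base or to the end of a fibre, then their averaged moments converge to those of the arcsine
law. -/
theorem tendsto_averageState_pow {V : Type*} {d : ℕ} {x : ∀ n, FiniteCombVertex d n → V}
    {T : ℕ → Ell2 V →L[ℂ] Ell2 V} {C : ℝ} (hC : ∀ n, ‖T n‖ ≤ C)
    (h : ∀ (n : ℕ) (p : FiniteCombVertex d n) (M : ℕ), (M : ℤ) ≤ |(p.2 : ℤ)| →
      |(p.2 : ℤ)| + M ≤ n → ∃ ι : ℤ → V, Function.Injective ι ∧ ι 0 = x n p ∧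
        ∀ (g : Ell2 V) (y : ℤ), |y| < M → T n g (ι y) = g (ι (y - 1)) + g (ι (y + 1)))
    (m : ℕ) : Tendsto (fun n => averageState (fun p => delta (x n p)) (T n ^ m)) atTop
      (𝓝 ((∫ t, t ^ m ∂arcsineLaw : ℝ) : ℂ)) := by
  have hC0 : 0 ≤ C := (norm_nonneg _).trans (hC 0)
  rw [integral_pow_arcsineLaw]
  set B : ℝ := C ^ m + |walkCount m 0| with hB
  have hB0 : 0 ≤ B := by positivity
  have hterm : ∀ n (p : FiniteCombVertex d n),
      ‖(inner ℂ (delta (x n p)) ((T n ^ m) (delta (x n p))) : ℂ) - walkCount m 0‖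
        ≤ B * if (m : ℤ) ≤ |(p.2 : ℤ)| ∧ |(p.2 : ℤ)| + m ≤ n then 0 else 1 := by
    intro n p
    split_ifs with hp
    · obtain ⟨ι, hι, hι0, hιT⟩ := h n p m hp.1 hp.2
      rw [inner_delta_left, ← hι0, pow_delta_apply hι hιT (by simp)]
      simp
    · rw [mul_one]
      refine (norm_sub_le _ _).trans (add_le_add ?_ (le_of_eq ?_))
      · refine (norm_inner_le_norm _ _).trans ?_
        rw [norm_delta, one_mul]
        have h1 : ‖T n ^ m‖ ≤ C ^ m := by
          rcases Nat.eq_zero_or_pos m with rfl | hm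
          · rw [pow_zero, pow_zero]
            exact ContinuousLinearMap.norm_id_le
          · exact (norm_pow_le' _ hm).trans (pow_le_pow_left₀ (norm_nonneg _) (hC n) _)
        have := (T n ^ m).le_of_opNorm_le h1 (delta (x n p))
        rwa [norm_delta, mul_one] at this
      · rw [Complex.norm_real, Real.norm_eq_abs]
  have hlim : Tendsto (fun n : ℕ => B * ((4 * m + 3) / (2 * (n : ℝ) + 1))) atTop (𝓝 0) := by
    rw [← mul_zero B]
    refine Tendsto.const_mul _ (tendsto_const_nhds.div_atTop ?_)
    exact tendsto_atTop_add_const_right _ _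
      (tendsto_natCast_atTop_atTop.const_mul_atTop (by norm_num))
  rw [tendsto_iff_norm_sub_tendsto_zero]
  refine squeeze_zero (fun _ => norm_nonneg _) (fun n => ?_) hlim
  have hcard : (Fintype.card (FiniteCombVertex d n) : ℝ) = (2 * n + 1) ^ d * (2 * n + 1) := by
    rw [card_finiteCombVertex]; push_cast; rfl
  have hcard0 : (0 : ℝ) < Fintype.card (FiniteCombVertex d n) := by rw [hcard]; positivity
  have e : averageState (fun p => delta (x n p)) (T n ^ m) - walkCount m 0
      = (Fintype.card (FiniteCombVertex d n) : ℂ)⁻¹ * ∑ p,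
        ((inner ℂ (delta (x n p)) ((T n ^ m) (delta (x n p))) : ℂ) - walkCount m 0) := by
    have : (Fintype.card (FiniteCombVertex d n) : ℂ) ≠ 0 := by exact_mod_cast hcard0.ne'
    rw [Finset.sum_sub_distrib, mul_sub, averageState, Finset.sum_const, Finset.card_univ,
      nsmul_eq_mul, inv_mul_cancel_left₀ this]
  rw [e, norm_mul, norm_inv, RCLike.norm_natCast]
  have h2 : ‖∑ p : FiniteCombVertex d n,
      ((inner ℂ (delta (x n p)) ((T n ^ m) (delta (x n p))) : ℂ) - walkCount m 0)‖
      ≤ (2 * (n : ℝ) + 1) ^ d * (B * (4 * m + 3)) := by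
    refine (norm_sum_le_of_le _ fun p _ => hterm n p).trans ?_
    rw [← Finset.mul_sum, Fintype.sum_prod_type]
    have h3 := Finset.sum_le_card_nsmul (Finset.univ : Finset (Fin d → ZMod (2 * n + 1)))
      (fun j => ∑ c : FiniteChain n,
        if (m : ℤ) ≤ |((j, c).2 : ℤ)| ∧ |((j, c).2 : ℤ)| + m ≤ n then (0 : ℝ) else 1)
      (4 * m + 3) fun j _ => sum_ite_boundary_le m n
    rw [Finset.card_univ, Fintype.card_pi] at h3
    simp only [ZMod.card, Finset.prod_const, Finset.card_univ, Fintype.card_fin, nsmul_eq_mul] at h3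
    push_cast at h3
    rw [mul_left_comm]
    exact mul_le_mul_of_nonneg_left h3 hB0
  calc _ ≤ ((Fintype.card (FiniteCombVertex d n) : ℝ))⁻¹
        * ((2 * (n : ℝ) + 1) ^ d * (B * (4 * m + 3))) := by gcongr
    _ = _ := by rw [hcard]; field_simp

end Arcsine


/-! ### Averaged functions of the hopping operators -/

section AveragedFunctions

variable {d n : ℕ}

theorem finiteCombAdj_apply_of_ne_zero (f : Ell2 (CombVertex d)) (j : Fin d → ZMod (2 * n + 1))
    {a : ℤ} (ha : |a| < n) (ha0 : a ≠ 0) :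
    finiteCombAdj d n f (baseEmb j, a) = f (baseEmb j, a - 1) + f (baseEmb j, a + 1) := by
  have ha' := abs_lt.1 ha
  have hn : 1 ≤ n := by have := abs_nonneg a; omega
  set p : FiniteCombVertex d n := (j, ⟨a, abs_le.1 ha.le⟩) with hp
  set g : ℤ → ℂ := fun b => if b ∈ Set.Icc (-(n : ℤ)) n then f (baseEmb j, b) else 0 with hg
  change adjOp _ _ f (finiteEmb d n p) = _
  rw [adjOp_apply, sum_finiteCombGraph hn p _ g (fun b hb => if_neg hb)
    (fun c => if_pos c.2)]
  have e1 : g (a - 1) = f (baseEmb j, a - 1) := if_pos ⟨by omega, by omega⟩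
  have e2 : g (a + 1) = f (baseEmb j, a + 1) := if_pos ⟨by omega, by omega⟩
  change g (a - 1) + g (a + 1) + (if a = 0 then _ else _) = _
  rw [e1, e2, if_neg ha0, add_zero]

theorem fibreAdj_zero_apply (f : Ell2 ℤ) {a : ℤ} (ha : |a| < n) :
    fibreAdj n 0 f a = f (a - 1) + f (a + 1) := by
  have ha' := abs_lt.1 ha
  rw [fibreAdj_apply, cutoff_apply, cutoff_apply, if_pos ⟨by omega, by omega⟩,
    if_pos ⟨by omega, by omega⟩, if_pos ⟨by omega, by omega⟩]
  simp

theorem norm_fibreAdj_zero_le : ‖fibreAdj n 0‖ ≤ 2 := by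
  have : fibreAdj n 0 = cutoff n ∘L chainAdj ∘L cutoff n := by
    rw [fibreAdj, Complex.ofReal_zero, zero_smul, add_zero]
  rw [this]
  exact norm_cutoff_comp_chainAdj_le

theorem ne_zero_and_abs_lt_of_abs_lt {c y : ℤ} {M : ℕ} (h1 : (M : ℤ) ≤ |c|) (h2 : |c| + M ≤ n)
    (hy : |y| < M) : c + y ≠ 0 ∧ |c + y| < n := by
  rw [Int.abs_eq_natAbs] at *
  omega

theorem tendsto_averageState_combAdj_pow (d m : ℕ) :
    Tendsto (fun n => averageState (fun p => delta (finiteEmb d n p)) (combAdj d ^ m)) atTop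
      (𝓝 ((∫ t, t ^ m ∂arcsineLaw : ℝ) : ℂ)) := by
  refine tendsto_averageState_pow (T := fun _ => combAdj d) (fun _ => norm_combAdj_le)
    (fun n p M h1 h2 => ⟨fun y => (baseEmb p.1, p.2 + y), fun y y' h => ?_, ?_, fun g y hy => ?_⟩) m
  · exact add_left_cancel (congrArg Prod.snd h)
  · exact Prod.ext rfl (add_zero _)
  · rw [combAdj_apply, if_neg (ne_zero_and_abs_lt_of_abs_lt h1 h2 hy).1, add_zero, add_sub_assoc,
      add_assoc]

theorem tendsto_averageState_finiteCombAdj_pow (d m : ℕ) :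
    Tendsto (fun n => averageState (fun p => delta (finiteEmb d n p)) (finiteCombAdj d n ^ m)) atTop
      (𝓝 ((∫ t, t ^ m ∂arcsineLaw : ℝ) : ℂ)) := by
  refine tendsto_averageState_pow (T := finiteCombAdj d) (norm_finiteCombAdj_le d)
    (fun n p M h1 h2 => ⟨fun y => (baseEmb p.1, p.2 + y), fun y y' h => ?_, ?_, fun g y hy => ?_⟩) m
  · exact add_left_cancel (congrArg Prod.snd h)
  · exact Prod.ext rfl (add_zero _)
  · have h := ne_zero_and_abs_lt_of_abs_lt h1 h2 hy
    rw [finiteCombAdj_apply_of_ne_zero g p.1 h.2 h.1, add_sub_assoc, add_assoc]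

theorem tendsto_averageState_fibreAdj_pow (d m : ℕ) :
    Tendsto (fun n => averageState (fun p : FiniteCombVertex d n => delta (p.2 : ℤ))
      (fibreAdj n 0 ^ m)) atTop (𝓝 ((∫ t, t ^ m ∂arcsineLaw : ℝ) : ℂ)) := by
  refine tendsto_averageState_pow (T := fun n => fibreAdj n 0) (x := fun n p => (p.2 : ℤ))
    (fun _ => norm_fibreAdj_zero_le)
    (fun n p M h1 h2 => ⟨fun y => p.2 + y, add_right_injective _, add_zero _, fun g y hy => ?_⟩) m
  rw [fibreAdj_zero_apply g (ne_zero_and_abs_lt_of_abs_lt h1 h2 hy).2, add_sub_assoc, add_assoc]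

theorem tendstoUniformlyOn_of_continuous {f : ℝ → ℝ → ℝ} (hf : Continuous (Function.uncurry f))
    {s : ℕ → ℝ} {a : ℝ} (hs : Tendsto s atTop (𝓝 a)) (C : ℝ) :
    TendstoUniformlyOn (fun n => f (s n)) (f a) atTop (Set.Icc (-C) C) := by
  rw [tendstoUniformlyOn_iff_tendstoUniformly_comp_coe]
  have h := Continuous.tendstoUniformly (fun (r : ℝ) (t : Set.Icc (-C) C) => f r t)
    (hf.comp (continuous_fst.prodMk (continuous_subtype_val.comp continuous_snd))) a
  exact fun u hu => hs.eventually (h u hu)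

theorem ae_mem_Icc_arcsineLaw_of_le {C : ℝ} (hC : 2 ≤ C) :
    ∀ᵐ t ∂arcsineLaw, t ∈ Set.Icc (-C) C :=
  ae_mem_Icc_arcsineLaw.mono fun _ ht => ⟨by linarith [ht.1], by linarith [ht.2]⟩

theorem tendsto_normalizedTrace_combHam (hd : 1 ≤ d) {φ : ℝ → ℝ} (hφ : Continuous φ) :
    Tendsto (fun n => normalizedTrace d n (opFun φ (combHam d))) atTop
      (𝓝 ((∫ t, φ (combTop d - t) ∂arcsineLaw : ℝ) : ℂ)) := by
  have hc : Continuous fun t => φ (combTop d - t) := by fun_prop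
  rw [combHam_eq hd, opFun_smul_one_sub (isSelfAdjoint_combAdj d) _ hφ]
  exact tendsto_averageState_opFun (u := fun n p => delta (finiteEmb d n p))
    (fun n p => norm_delta _) (T := fun _ => combAdj d) (fun _ => isSelfAdjoint_combAdj d)
    (fun _ => norm_combAdj_le) (ae_mem_Icc_arcsineLaw_of_le (two_lt_combTop hd).le)
    (tendsto_averageState_combAdj_pow d) (fun _ => hc) hc
    (tendstoUniformlyOn_of_continuous (f := fun _ t => φ (combTop d - t)) (by fun_prop)
      (tendsto_const_nhds (x := (0 : ℝ))) _)

/-- In contrast to the Bose function, a continuous function `φ` does not see the chemical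
potential in the limit. -/
theorem tendsto_normalizedTrace_finiteHam (hd : 1 ≤ d) {φ : ℝ → ℝ} (hφ : Continuous φ) {s : ℕ → ℝ}
    (hs0 : Tendsto s atTop (𝓝 0)) :
    Tendsto (fun n => normalizedTrace d n (opFun φ (finiteHam d n (-s n)))) atTop
      (𝓝 ((∫ t, φ (combTop d - t) ∂arcsineLaw : ℝ) : ℂ)) := by
  have h := tendsto_averageState_opFun (u := fun n p => delta (finiteEmb d n p))
    (fun n p => norm_delta _) (isSelfAdjoint_finiteCombAdj d)
    (norm_finiteCombAdj_le d) (ae_mem_Icc_arcsineLaw_of_le (two_lt_combTop hd).le)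
    (tendsto_averageState_finiteCombAdj_pow d) (φ := fun n t => φ (combTop d + s n - t))
    (ψ := fun t => φ (combTop d + 0 - t)) (fun _ => by fun_prop) (by fun_prop)
    (tendstoUniformlyOn_of_continuous (f := fun r t => φ (combTop d + r - t)) (by fun_prop) hs0 _)
  rw [add_zero] at h
  refine h.congr fun n => ?_
  rw [finiteHam_neg hd, opFun_smul_one_sub (isSelfAdjoint_finiteCombAdj d n) _ hφ]
  rfl

theorem fibreRes_zero_eq (s : ℝ) (hs : 0 < combTop d - 2 + s) : fibreRes d n 0 s
    = opFun (fun t => shiftedInv (combTop d - 2 + s) (2 - t)) (fibreAdj n 0) := by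
  have e : ((combTop d + s : ℝ) : ℂ) • (1 : Ell2 ℤ →L[ℂ] Ell2 ℤ) - fibreAdj n 0
      = ((combTop d - 2 + s : ℝ) : ℂ) • (1 : Ell2 ℤ →L[ℂ] Ell2 ℤ)
        + (((2 : ℝ) : ℂ) • (1 : Ell2 ℤ →L[ℂ] Ell2 ℤ) - fibreAdj n 0) := by
    push_cast; module
  rw [fibreRes, e, inverse_smul_add_eq_opFun
    (smul_one_sub_nonneg (isSelfAdjoint_fibreAdj 0) norm_fibreAdj_zero_le) hs,
    opFun_smul_one_sub (isSelfAdjoint_fibreAdj 0) 2 (continuous_shiftedInv hs)]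

theorem tendsto_averageState_fibreRes (hd : 1 ≤ d) {s : ℕ → ℝ} (hs : ∀ n, 0 < s n)
    (hs0 : Tendsto s atTop (𝓝 0)) :
    Tendsto (fun n => averageState (fun p : FiniteCombVertex d n => delta (p.2 : ℤ))
      (fibreRes d n 0 (s n))) atTop
      (𝓝 ((∫ t, shiftedInv (combTop d - 2) (2 - t) ∂arcsineLaw : ℝ) : ℂ)) := by
  have ha : 0 < combTop d - 2 := sub_pos.2 (two_lt_combTop hd)
  have hf : Continuous (Function.uncurry fun r t : ℝ =>
      shiftedInv (combTop d - 2 + max r 0) (2 - t)) := by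
    unfold shiftedInv Function.uncurry
    exact Continuous.inv₀ (by fun_prop) fun x => by positivity
  have hcont : ∀ r : ℝ, Continuous fun t => shiftedInv (combTop d - 2 + max r 0) (2 - t) :=
    fun r => (continuous_shiftedInv (by positivity)).comp (by fun_prop)
  have h := tendsto_averageState_opFun (u := fun n (p : FiniteCombVertex d n) => delta (p.2 : ℤ))
    (fun n p => norm_delta _) (T := fun n => fibreAdj n 0) (fun _ => isSelfAdjoint_fibreAdj 0)
    (fun _ => norm_fibreAdj_zero_le) ae_mem_Icc_arcsineLaw (tendsto_averageState_fibreAdj_pow d)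
    (φ := fun n t => shiftedInv (combTop d - 2 + max (s n) 0) (2 - t))
    (ψ := fun t => shiftedInv (combTop d - 2 + max 0 0) (2 - t)) (fun _ => hcont _) (hcont 0)
    (tendstoUniformlyOn_of_continuous hf hs0 _)
  rw [max_self, add_zero] at h
  refine h.congr fun n => ?_
  rw [max_eq_left (hs n).le, fibreRes_zero_eq _ (by linarith [hs n])]

/-! ### The averaged resolvent -/

theorem modeCoeff_delta (k : Fin d → ZMod (2 * n + 1)) (p : FiniteCombVertex d n) :
    modeCoeff k (delta (finiteEmb d n p))
      = (modeNorm d n * conj (torusChar k p.1) : ℂ) • delta (p.2 : ℤ) := by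
  refine ext_inner_left ℂ fun f => ?_
  rw [← inner_modeEmb_left, inner_delta_right, inner_smul_right, inner_delta_right,
    modeEmb_apply_emb, map_mul, map_mul, Complex.conj_ofReal]

theorem inner_delta_finiteRes (hd : 1 ≤ d) (hn : 1 ≤ n) {s : ℝ} (hs : 0 < s)
    (p : FiniteCombVertex d n) :
    inner ℂ (delta (finiteEmb d n p)) (finiteRes d n s (delta (finiteEmb d n p)))
      = ((modeNorm d n ^ 2 : ℝ) : ℂ) * ∑ k : Fin d → ZMod (2 * n + 1),
        inner ℂ (delta (p.2 : ℤ)) (fibreRes d n (torusEigenvalue k) s (delta (p.2 : ℤ))) := by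
  rw [inner_eq_inner_sub_boxProj_add_sum (n := n), inner_delta_left, lp.coeFn_sub, Pi.sub_apply,
    boxProj_apply_emb, sub_self, zero_add, Finset.mul_sum]
  refine Finset.sum_congr rfl fun k _ => ?_
  have h : torusChar k p.1 * conj (torusChar k p.1) = 1 := by
    rw [Complex.mul_conj, Complex.normSq_eq_norm_sq, norm_torusChar]; simp
  rw [modeCoeff_finiteRes hd hn hs, modeCoeff_delta, map_smul, inner_smul_left, inner_smul_right,
    map_mul, Complex.conj_conj, Complex.conj_ofReal]
  push_cast
  linear_combination (modeNorm d n : ℂ) ^ 2 * inner ℂ (delta (p.2 : ℤ))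
    (fibreRes d n (torusEigenvalue k) s (delta (p.2 : ℤ))) * h

/-- The trace of the resolvent of the finite comb is the sum over the frequencies of the traces of
the resolvents of the fibres. -/
theorem averageState_finiteRes (hd : 1 ≤ d) (hn : 1 ≤ n) {s : ℝ} (hs : 0 < s) :
    averageState (fun p : FiniteCombVertex d n => delta (finiteEmb d n p)) (finiteRes d n s)
      = (Fintype.card (FiniteCombVertex d n) : ℂ)⁻¹ * ∑ k : Fin d → ZMod (2 * n + 1),
        ∑ c : FiniteChain n,
          inner ℂ (delta (c : ℤ)) (fibreRes d n (torusEigenvalue k) s (delta (c : ℤ))) := by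
  rw [averageState]
  congr 1
  simp only [inner_delta_finiteRes hd hn hs]
  rw [Fintype.sum_prod_type]
  simp only [← Finset.mul_sum]
  rw [Finset.sum_const, Finset.card_univ, Fintype.card_pi]
  simp only [ZMod.card, Finset.prod_const, Finset.card_univ, Fintype.card_fin, nsmul_eq_mul]
  rw [Finset.sum_comm, ← mul_assoc]
  convert one_mul _ using 2
  have := modeNorm_mul_modeNorm_mul_pow (d := d) (n := n)
  push_cast at this ⊢
  linear_combination this

theorem inner_cutoff_eq_sum (b a : Ell2 ℤ) :
    inner ℂ b (cutoff n a) = ∑ c : FiniteChain n, conj (b c) * a c := by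
  rw [cutoff, sum_apply, inner_sum]
  simp only [InnerProductSpace.rankOne_apply, inner_delta_left, inner_smul_right, inner_delta_right]
  rw [Finset.sum_subtype (p := fun i => i ∈ Set.Icc (-(n : ℤ)) n) _ (fun i => by simp)]
  exact Finset.sum_congr rfl fun c _ => mul_comm _ _

/-- Changing the value at the base changes the trace of the resolvent of a fibre by a bounded
amount, since the perturbation has rank one. -/
theorem norm_sum_inner_fibreRes_sub_le (hd : 1 ≤ d) (hn : 1 ≤ n) {s : ℝ} (hs : 0 < s)
    (k : Fin d → ZMod (2 * n + 1)) :
    ‖∑ c : FiniteChain n, (inner ℂ (delta (c : ℤ))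
        (fibreRes d n (torusEigenvalue k) s (delta (c : ℤ))) : ℂ)
      - ∑ c : FiniteChain n, inner ℂ (delta (c : ℤ)) (fibreRes d n 0 s (delta (c : ℤ)))‖
      ≤ 2 * d / (combTop d - 2) / (s + gapConst d * torusGap k) := by
  have hL : 0 < combTop d - 2 := sub_pos.2 (two_lt_combTop hd)
  set θ := torusEigenvalue k with hθ
  have hθ' : |θ| ≤ 2 * d := by
    have h1 := torusGap_nonneg k
    have h2 := torusGap_le k
    rw [torusGap, ← hθ] at h1 h2
    rw [abs_le]; constructor <;> linarith
  have hgap : 0 < s + gapConst d * torusGap k :=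
    add_pos_of_pos_of_nonneg hs (mul_nonneg (gapConst_pos hd).le (torusGap_nonneg k))
  have hlow : ∀ f : Ell2 ℤ, (combTop d - 2) * ‖f‖ ^ 2 ≤ (inner ℂ f
      ((((combTop d + s : ℝ) : ℂ) • (1 : Ell2 ℤ →L[ℂ] Ell2 ℤ) - fibreAdj n 0) f)).re := fun f => by
    refine le_trans ?_ (re_inner_smul_one_sub
      (re_inner_le_of_norm_le (norm_fibreAdj_zero_le (n := n))) (combTop d + s) f)
    gcongr
    linarith
  have hsa : ∀ x y : Ell2 ℤ, (inner ℂ (fibreRes d n 0 s x) y : ℂ)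
      = inner ℂ x (fibreRes d n 0 s y) := fun x y => by
    rw [fibreRes_zero_eq s (by linarith), inner_opFun_left]
  set a := fibreRes d n θ s (delta (0 : ℤ)) with ha
  set b := fibreRes d n 0 s (delta (0 : ℤ)) with hb
  have hna : ‖a‖ ≤ 1 / (s + gapConst d * torusGap k) := by
    have := norm_inverse_apply_le hgap (le_re_inner_fibre hd hn k s) (delta (0 : ℤ))
    rwa [norm_delta] at this
  have hnb : ‖b‖ ≤ 1 / (combTop d - 2) := by
    have := norm_inverse_apply_le hL hlow (delta (0 : ℤ))
    rwa [norm_delta] at this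
  -- The second resolvent identity for the rank-one perturbation `θ |δ₀⟩⟨δ₀|`.
  have hres : ∀ x : Ell2 ℤ, fibreRes d n θ s x
      = fibreRes d n 0 s x + ((θ : ℂ) * fibreRes d n 0 s x 0) • a := by
    intro x
    set y := fibreRes d n 0 s x with hy
    have h1 : (((combTop d + s : ℝ) : ℂ) • (1 : Ell2 ℤ →L[ℂ] Ell2 ℤ) - fibreAdj n 0) y = x :=
      apply_inverse_apply (isUnit_of_le_re_inner hL hlow) x
    have h2 : x = (((combTop d + s : ℝ) : ℂ) • (1 : Ell2 ℤ →L[ℂ] Ell2 ℤ) - fibreAdj n θ) y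
        + ((θ : ℂ) * y 0) • delta 0 := by
      rw [← h1]
      simp only [sub_apply, smul_apply, one_apply_eq_self, fibreAdj_eq]
      push_cast
      module
    conv_lhs => rw [h2]
    rw [map_add, map_smul, ← ha, fibreRes,
      inverse_apply_eq_of_apply_eq (isUnit_fibre hd hn hs k) rfl]
  have hterm : ∀ c : FiniteChain n, (inner ℂ (delta (c : ℤ))
      (fibreRes d n θ s (delta (c : ℤ))) : ℂ)
      - inner ℂ (delta (c : ℤ)) (fibreRes d n 0 s (delta (c : ℤ))) = θ * (conj (b c) * a c) := by
    intro c
    have h1 : fibreRes d n 0 s (delta (c : ℤ)) 0 = conj (b c) := by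
      rw [← inner_delta_left, ← hsa, inner_delta_right]
    rw [hres, inner_add_right, add_sub_cancel_left, inner_smul_right, inner_delta_left, h1]
    ring
  rw [← Finset.sum_sub_distrib]
  simp only [hterm]
  rw [← Finset.mul_sum, ← inner_cutoff_eq_sum, norm_mul, Complex.norm_real, Real.norm_eq_abs]
  calc |θ| * ‖(inner ℂ b (cutoff n a) : ℂ)‖
      ≤ 2 * d * (1 / (combTop d - 2) * (1 / (s + gapConst d * torusGap k))) := by
        refine mul_le_mul hθ' ((norm_inner_le_norm _ _).trans ?_) (norm_nonneg _) (by positivity)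
        exact mul_le_mul hnb ((norm_cutoff_apply_le _).trans hna) (norm_nonneg _) (by positivity)
    _ = _ := by field_simp

/-- The density of the resolvent of the finite comb differs from that of the free fibres by a term
of order `(2n + 1)⁻¹`. The term `1 / (s (2n + 1)^d)` is the contribution of the zero mode, which
the factor `(2n + 1)⁻¹` suppresses as well. -/
theorem norm_averageState_finiteRes_sub_le (hd : 3 ≤ d) (hn : 1 ≤ n) {s : ℝ} (hs : 0 < s) :
    ‖averageState (fun p : FiniteCombVertex d n => delta (finiteEmb d n p)) (finiteRes d n s)
      - averageState (fun p : FiniteCombVertex d n => delta (p.2 : ℤ)) (fibreRes d n 0 s)‖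
      ≤ 2 * d / (combTop d - 2) * (2 * (n : ℝ) + 1)⁻¹
        * (1 / (s * (2 * (n : ℝ) + 1) ^ d) + (gapConst d)⁻¹ * (2 * d * 3 ^ (d - 1))) := by
  classical
  have hd1 : 1 ≤ d := by omega
  have hL : 0 < combTop d - 2 := sub_pos.2 (two_lt_combTop hd1)
  have hκ := gapConst_pos hd1
  have hcard : (Fintype.card (FiniteCombVertex d n) : ℝ)⁻¹
      = (2 * (n : ℝ) + 1)⁻¹ * modeNorm d n ^ 2 := by
    rw [card_finiteCombVertex, modeNorm_sq]; push_cast; rw [mul_inv, mul_comm]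
  rw [averageState_finiteRes hd1 hn hs, averageState, Fintype.sum_prod_type, ← mul_sub,
    ← Finset.sum_sub_distrib, norm_mul, norm_inv, RCLike.norm_natCast, hcard]
  have h1 : ∀ k : Fin d → ZMod (2 * n + 1), k ≠ 0 →
      2 * d / (combTop d - 2) / (s + gapConst d * torusGap k)
        ≤ 2 * d / (combTop d - 2) * (gapConst d)⁻¹ * (torusGap k)⁻¹ := by
    intro k hk
    have := torusGap_pos hk
    rw [div_eq_mul_inv _ (s + _), mul_assoc, ← mul_inv]
    gcongr
    linarith
  have e0 : torusGap (0 : Fin d → ZMod (2 * n + 1)) = 0 := by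
    rw [torusGap, torusEigenvalue_zero, sub_self]
  have h2 : ‖∑ k : Fin d → ZMod (2 * n + 1), (∑ c : FiniteChain n, (inner ℂ (delta (c : ℤ))
        (fibreRes d n (torusEigenvalue k) s (delta (c : ℤ))) : ℂ)
      - ∑ c : FiniteChain n, inner ℂ (delta (c : ℤ)) (fibreRes d n 0 s (delta (c : ℤ))))‖
      ≤ 2 * d / (combTop d - 2) * (1 / s + (gapConst d)⁻¹
        * ∑ k : Fin d → ZMod (2 * n + 1) with k ≠ 0, (torusGap k)⁻¹) := by
    refine (norm_sum_le_of_le _ fun k _ => norm_sum_inner_fibreRes_sub_le hd1 hn hs k).trans ?_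
    rw [← Finset.sum_filter_add_sum_filter_not Finset.univ (fun k => k ≠ 0)]
    have h3 : (Finset.univ.filter fun k : Fin d → ZMod (2 * n + 1) => ¬ k ≠ 0) = {0} := by
      ext k; simp
    rw [h3, Finset.sum_singleton, e0, mul_zero, add_zero, add_comm, mul_add, mul_one_div,
      ← mul_assoc, Finset.mul_sum]
    gcongr with k hk
    exact h1 k (Finset.mem_filter.1 hk).2
  have h4 := sum_inv_torusGap_le hd hn
  have e5 : 1 / (s * (2 * (n : ℝ) + 1) ^ d) = modeNorm d n ^ 2 * (1 / s) := by
    rw [modeNorm_sq]; field_simp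
  rw [e5]
  calc (2 * (n : ℝ) + 1)⁻¹ * modeNorm d n ^ 2 * _
      ≤ (2 * (n : ℝ) + 1)⁻¹ * modeNorm d n ^ 2 * (2 * d / (combTop d - 2) * (1 / s + (gapConst d)⁻¹
        * ∑ k : Fin d → ZMod (2 * n + 1) with k ≠ 0, (torusGap k)⁻¹)) :=
        mul_le_mul_of_nonneg_left h2 (by positivity)
    _ = 2 * d / (combTop d - 2) * (2 * (n : ℝ) + 1)⁻¹ * (modeNorm d n ^ 2 * (1 / s)
        + (gapConst d)⁻¹ * (modeNorm d n ^ 2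
          * ∑ k : Fin d → ZMod (2 * n + 1) with k ≠ 0, (torusGap k)⁻¹)) := by ring
    _ ≤ _ := by gcongr

theorem tendsto_averageState_finiteRes (hd : 3 ≤ d) {s : ℕ → ℝ} (hs : ∀ n, 0 < s n)
    (hs0 : Tendsto s atTop (𝓝 0)) {c : ℝ}
    (hc : Tendsto (fun n : ℕ => 1 / (s n * (2 * (n : ℝ) + 1) ^ d)) atTop (𝓝 c)) :
    Tendsto (fun n => averageState (fun p : FiniteCombVertex d n => delta (finiteEmb d n p))
      (finiteRes d n (s n))) atTop
      (𝓝 ((∫ t, shiftedInv (combTop d - 2) (2 - t) ∂arcsineLaw : ℝ) : ℂ)) := by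
  have h1 : Tendsto (fun n : ℕ => 2 * d / (combTop d - 2) * (2 * (n : ℝ) + 1)⁻¹
      * (1 / (s n * (2 * (n : ℝ) + 1) ^ d) + (gapConst d)⁻¹ * (2 * d * 3 ^ (d - 1)))) atTop
      (𝓝 0) := by
    have h2 : Tendsto (fun n : ℕ => (2 * (n : ℝ) + 1)⁻¹) atTop (𝓝 0) :=
      tendsto_inv_atTop_zero.comp (tendsto_atTop_add_const_right _ _
        (tendsto_natCast_atTop_atTop.const_mul_atTop (by norm_num)))
    have h3 := (h2.const_mul (2 * d / (combTop d - 2))).mul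
      (hc.add_const ((gapConst d)⁻¹ * (2 * d * 3 ^ (d - 1))))
    rwa [mul_zero, zero_mul] at h3
  have h4 : Tendsto (fun n => averageState
      (fun p : FiniteCombVertex d n => delta (finiteEmb d n p)) (finiteRes d n (s n))
      - averageState (fun p : FiniteCombVertex d n => delta (p.2 : ℤ)) (fibreRes d n 0 (s n)))
      atTop (𝓝 0) := by
    refine squeeze_zero_norm' ?_ h1
    filter_upwards [eventually_ge_atTop 1] with n hn
    exact norm_averageState_finiteRes_sub_le hd hn (hs n)
  have h5 := h4.add (tendsto_averageState_fibreRes (d := d) (by omega) hs hs0)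
  rw [zero_add] at h5
  exact h5.congr fun n => sub_add_cancel _ _

end AveragedFunctions


/-! ### The density of states and the critical density -/

section DensityOfStates

variable {d : ℕ}

theorem integrable_arcsineLaw {f : ℝ → ℝ} (hf : Continuous f) : Integrable f arcsineLaw := by
  obtain ⟨B, hB⟩ := (isCompact_Icc (a := (-2 : ℝ)) (b := 2)).exists_bound_of_continuousOn
    hf.continuousOn
  exact Integrable.of_bound hf.aestronglyMeasurable B
    (ae_mem_Icc_arcsineLaw.mono fun t ht => hB t ht)

/-- The density of states of the pure hopping Hamiltonian: the image of the arcsine law under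
`t ↦ ‖A‖ - t`. The base, which carries a vanishing fraction of the vertices, does not contribute. -/
noncomputable def combDensity (d : ℕ) : Measure ℝ :=
  Measure.map (fun t => combTop d - t) arcsineLaw

theorem isDensityOfStates_combDensity (hd : 1 ≤ d) :
    IsDensityOfStates d (combHam d) (combDensity d) := by
  intro φ hφ
  refine ⟨?_, ?_⟩
  · rw [combDensity, integrable_map_measure hφ.aestronglyMeasurable (by fun_prop)]
    exact integrable_arcsineLaw (hφ.comp (by fun_prop))
  · rw [combDensity, integral_map (by fun_prop) hφ.aestronglyMeasurable]
    exact tendsto_normalizedTrace_combHam hd hφ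

/-- Integrability of the constant `1` makes a density of states a finite measure, and finite
measures are determined by the integrals of bounded continuous functions. -/
theorem IsDensityOfStates.eq {T : Ell2 (CombVertex d) →L[ℂ] Ell2 (CombVertex d)} {N N' : Measure ℝ}
    (h : IsDensityOfStates d T N) (h' : IsDensityOfStates d T N') : N = N' := by
  have hfin : ∀ {N : Measure ℝ}, IsDensityOfStates d T N → IsFiniteMeasure N := fun h => by
    have := (h (fun _ => 1) continuous_const).1
    rw [integrable_const_iff] at this
    exact this.resolve_left one_ne_zero
  have := hfin h
  have := hfin h'
  refine ext_of_forall_integral_eq_of_IsFiniteMeasure fun f => ?_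
  exact Complex.ofReal_injective
    (tendsto_nhds_unique (h f f.continuous).2 (h' f f.continuous).2)

theorem existsUnique_isDensityOfStates (hd : 1 ≤ d) :
    ∃! N : Measure ℝ, IsDensityOfStates d (combHam d) N :=
  ⟨_, isDensityOfStates_combDensity hd, fun _ h => h.eq (isDensityOfStates_combDensity hd)⟩

/-- The value `(e^{β(‖A‖ - t)} - 1)⁻¹` of the Bose function for `t ∈ [-2, 2]`, written as a
continuous function of `t`. -/
noncomputable def boseFibre (d : ℕ) (β t : ℝ) : ℝ :=
  β⁻¹ * shiftedInv (combTop d - 2) (2 - t) + boseReg β (combTop d - t)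

theorem continuous_boseFibre (hd : 1 ≤ d) {β : ℝ} (hβ : 0 < β) : Continuous (boseFibre d β) :=
  (continuous_const.mul ((continuous_shiftedInv (sub_pos.2 (two_lt_combTop hd))).comp
    (by fun_prop))).add ((continuous_boseReg hβ).comp (by fun_prop))

theorem boseFibre_eq (hd : 1 ≤ d) {β : ℝ} {t : ℝ} (ht : t ≤ 2) :
    boseFibre d β t = (Real.exp (β * (combTop d - t)) - 1)⁻¹ := by
  have hL := two_lt_combTop hd
  rw [inv_exp_sub_one_eq (by linarith), boseFibre, shiftedInv_of_nonneg _ (by linarith)]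
  congr 3
  ring

theorem exp_sub_one_pos (hd : 1 ≤ d) {β : ℝ} (hβ : 0 < β) {t : ℝ} (ht : t ≤ 2) :
    0 < Real.exp (β * (combTop d - t)) - 1 := by
  have hL := two_lt_combTop hd
  exact sub_pos.2 (Real.one_lt_exp_iff.2 (mul_pos hβ (by linarith)))

theorem criticalDensity_combDensity (hd : 1 ≤ d) {β : ℝ} (hβ : 0 < β) :
    criticalDensity β (combDensity d) = ∫⁻ t, ENNReal.ofReal (boseFibre d β t) ∂arcsineLaw := by
  rw [criticalDensity, combDensity, lintegral_map (by fun_prop) (by fun_prop)]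
  refine lintegral_congr_ae (ae_mem_Icc_arcsineLaw.mono fun t ht => ?_)
  simp only
  rw [boseFibre_eq hd ht.2, ENNReal.ofReal_inv_of_pos (exp_sub_one_pos hd hβ ht.2)]

theorem criticalDensity_ne_top (hd : 1 ≤ d) {β : ℝ} (hβ : 0 < β) :
    criticalDensity β (combDensity d) ≠ ⊤ := by
  rw [criticalDensity_combDensity hd hβ]
  exact (integrable_arcsineLaw (continuous_boseFibre hd hβ)).lintegral_lt_top.ne

theorem toReal_criticalDensity (hd : 1 ≤ d) {β : ℝ} (hβ : 0 < β) :
    (criticalDensity β (combDensity d)).toReal = ∫ t, boseFibre d β t ∂arcsineLaw := by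
  rw [criticalDensity_combDensity hd hβ, integral_eq_lintegral_of_nonneg_ae
    (ae_mem_Icc_arcsineLaw.mono fun t ht => ?_)
    (continuous_boseFibre hd hβ).aestronglyMeasurable]
  rw [boseFibre_eq hd ht.2]
  exact (inv_pos.2 (exp_sub_one_pos hd hβ ht.2)).le

/-- The densities converge to the critical density; the condensate occupies a single mode, whose
weight is negligible with respect to the number of vertices. -/
theorem tendsto_normalizedTrace_inverse_expSubOne (hd : 3 ≤ d) {β : ℝ} (hβ : 0 < β) {s : ℕ → ℝ}
    (hs : ∀ n, 0 < s n) (hs0 : Tendsto s atTop (𝓝 0)) {c : ℝ}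
    (hc : Tendsto (fun n : ℕ => 1 / (s n * (2 * (n : ℝ) + 1) ^ d)) atTop (𝓝 c)) :
    Tendsto (fun n => normalizedTrace d n (Ring.inverse (expSubOne β (finiteHam d n (-s n))))) atTop
      (𝓝 ((criticalDensity β (combDensity d)).toReal : ℂ)) := by
  have hd1 : 1 ≤ d := by omega
  have h := ((tendsto_averageState_finiteRes hd hs hs0 hc).const_mul ((β⁻¹ : ℝ) : ℂ)).add
    (tendsto_normalizedTrace_finiteHam hd1 (continuous_boseReg hβ) hs0)
  have hL : 0 < combTop d - 2 := sub_pos.2 (two_lt_combTop hd1)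
  have e : ((criticalDensity β (combDensity d)).toReal : ℂ)
      = ((β⁻¹ : ℝ) : ℂ) * ((∫ t, shiftedInv (combTop d - 2) (2 - t) ∂arcsineLaw : ℝ) : ℂ)
        + ((∫ t, boseReg β (combTop d - t) ∂arcsineLaw : ℝ) : ℂ) := by
    rw [toReal_criticalDensity hd1 hβ, ← Complex.ofReal_mul, ← Complex.ofReal_add,
      ← integral_const_mul, ← integral_add]
    · rfl
    · exact integrable_arcsineLaw (continuous_const.mul ((continuous_shiftedInv hL).comp
        (by fun_prop)))
    · exact integrable_arcsineLaw ((continuous_boseReg hβ).comp (by fun_prop))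
  rw [e]
  refine h.congr fun n => ?_
  rw [inverse_expSubOne_finiteHam hd1 hβ n (hs n), ← averageState_smul]
  exact (averageState_add _ _ _).symm

end DensityOfStates

theorem mainTheorem1 (d : ℕ) (hd : 3 ≤ d) :
    -- the adjacency operator is transient
    Transient (combAdj d) ∧
    -- `H` is injective and `S₀` lies in the domain of `R(‖A‖)^{1/2} = H^{-1/2}`
    (Function.Injective (combHam d) ∧
      ∀ ξ ∈ rapidSpace d, ξ ∈ (invSqrt (combHam d)).domain) ∧
    -- `v` is a generalized Perron-Frobenius vector, and pairs with `S₀`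
    (IsGeneralizedPF (combGraph d) (combGraph_bounded d) (groundState d) ∧
      ∀ ξ ∈ rapidSpace d, Summable fun x => ‖groundState d x * ξ x‖) ∧
    -- `H` has a density of states
    (∃! N : Measure ℝ, IsDensityOfStates d (combHam d) N) ∧
    ∀ (β : ℝ), 0 < β → ∀ (μ : ℕ → ℝ) (c : ℝ),
      (∀ n, μ n < 0) → Tendsto μ atTop (𝓝 0) →
      Tendsto (fun n : ℕ => 1 / (-μ n * (2 * (n : ℝ) + 1) ^ d)) atTop (𝓝 c) →
      (∀ n, IsUnit (expSubOne β (finiteHam d n (μ n)))) ∧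
      Function.Injective (expSubOne β (combHam d)) ∧
      -- convergence of the two-point functions
      (∀ η ∈ rapidSpace d, ∀ ξ ∈ rapidSpace d,
        ∃ (hη : η ∈ (invSqrt (expSubOne β (combHam d))).domain)
          (hξ : ξ ∈ (invSqrt (expSubOne β (combHam d))).domain),
          Tendsto
            (fun n => inner ℂ η (Ring.inverse (expSubOne β (finiteHam d n (μ n))) ξ))
            atTop
            (𝓝 (inner ℂ (invSqrt (expSubOne β (combHam d)) ⟨η, hη⟩)
                  (invSqrt (expSubOne β (combHam d)) ⟨ξ, hξ⟩) +
                ((c / β : ℝ) : ℂ) * (pairing η (groundState d) * pairing (groundState d) ξ)))) ∧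
      -- convergence of the densities
      (∀ N : Measure ℝ, IsDensityOfStates d (combHam d) N →
        criticalDensity β N ≠ ⊤ ∧
        Tendsto
          (fun n => normalizedTrace d n
            (Ring.inverse (expSubOne β (finiteHam d n (μ n)))))
          atTop (𝓝 ((criticalDensity β N).toReal : ℂ))) := by
  have hd1 : 1 ≤ d := by omega
  refine ⟨transient_combAdj hd,
    ⟨injective_combHam hd, fun ξ hξ => mem_domain_invSqrt_combHam hd hξ⟩,
    ⟨isGeneralizedPF_groundState hd1, fun ξ hξ => summable_groundState_mul hd1 hξ⟩,
    existsUnique_isDensityOfStates hd1, fun β hβ μ c hμ hμ0 hc => ?_⟩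
  obtain ⟨s, rfl⟩ : ∃ s : ℕ → ℝ, μ = fun n => -s n := ⟨fun n => -μ n, funext fun n => by simp⟩
  have hs : ∀ n, 0 < s n := fun n => neg_lt_zero.1 (hμ n)
  have hs0 : Tendsto s atTop (𝓝 0) := by simpa using hμ0.neg
  simp only [neg_neg] at hc
  refine ⟨fun n => isUnit_expSubOne_finiteHam hd1 hβ n (hs n),
    expSubOne_injective (combHam_nonneg hd1) (injective_combHam hd) hβ,
    fun η hη ξ hξ => tendsto_inner_inverse_expSubOne hd hβ hs hs0 hc hη hξ, fun N hN => ?_⟩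
  rw [hN.eq (isDensityOfStates_combDensity hd1)]
  exact ⟨criticalDensity_ne_top hd1 hβ, tendsto_normalizedTrace_inverse_expSubOne hd hβ hs hs0 hc⟩
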